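/- **Lemma 3.3.** Let $n\ge 2$ and let $f$ be holomorphic in a neighbourhood of $0\in\mathbb C^n$, with $f(0)=0$, $df(0)=0$, and such that $0$ is an isolated point of $\{f=0,\ df=0\}$. Let $X=X^{n-1}=f^{-1}(0)$ be the isolated hypersurface singularity defined by $f$, and let $J(f)\subset\mathcal O_{X,0}$ be the ideal generated by the partial derivatives $\partial f/\partial z_i$. For an analytic set $Y$ and a submodule $M\subset\mathcal O_{Y,y}^p$, the integral closure $\overline M$ consists of all $h\in\mathcal O_{Y,y}^p$ such that $h\circ\varphi\in(\varphi^*M)\mathcal O_{\mathbb C,0}$ for every analytic curve $\varphi:(\mathbb C,0)\to(Y,y)$. If $M$ is finitely generated, extend it to a neighbourhood of $y$ in $Y$ as the sheaf of modules generated by a finite set of generators of $M$. For $Y$ of pure dimension $d$, the integral hull $H_k(M)$ of codimension $k$ is the set of all $h\in\mathcal O_{Y,y}^p$ that, in a neighbourhood of $y$, are in the integral closure of (the sheaf defined by) $M$ at all points off some analytic subset of $Y$ of codimension at least $k+1$. For an ideal $I\subset\mathcal O_{X,0}$, the double $I_D$ is the submodule of $\mathcal O_{X\times X,(0,0)}^2$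 generated by the elements $h_D=(h\circ\pi_1,h\circ\pi_2)$, $h\in I$, where $\pi_1,\pi_2:X\times X\to X$ are the projections. Then, in $\mathcal O_{X\times X,(0,0)}^2$ (where $\dim X\times X=2n-2$), $$H_{2n-3}\bigl(J(f)_D\bigr)=\overline{J(f)}_D .$$ Moreover, $\overline{J(f)}_D$ is the largest finitely generated submodule of $\mathcal O_{X\times X,(0,0)}^2$ whose integral closure agrees with that of $J(f)_D$ at all points of $X\times X$ off $(0,0)$, in a neighbourhood of $(0,0)$. In particular, the integral closures of $J(f)_D$ and $\overline{J(f)}_D$ agree on $X\times X$ off the origin, near the origin. -/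

import Mathlib

open Filter Topology

noncomputable section

namespace LipHull

section LocalRings

variable {E : Type*} [NormedAddCommGroup E] [NormedSpace ℂ E]
variable {E' : Type*} [NormedAddCommGroup E'] [NormedSpace ℂ E']

/-- The local ring `𝒪_{Y,y}` of the (reduced) analytic set `Y ⊆ E` at `y`, as a subring of the ring
of germs at `y` of complex functions on `Y`: the germs that are restrictions to `Y` of functions
holomorphic in a neighbourhood of `y` in the ambient space. -/
def localRing (Y : Set E) (y : E) : Subring (Germ (𝓝[Y] y) ℂ) where
  carrier := {g | ∃ F : E → ℂ, AnalyticAt ℂ F y ∧ (F : Germ (𝓝[Y] y) ℂ) = g}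
  mul_mem' := by
    rintro _ _ ⟨F, hF, rfl⟩ ⟨G, hG, rfl⟩
    exact ⟨F * G, hF.mul hG, Germ.coe_mul F G⟩
  one_mem' := ⟨1, analyticAt_const, rfl⟩
  add_mem' := by
    rintro _ _ ⟨F, hF, rfl⟩ ⟨G, hG, rfl⟩
    exact ⟨F + G, hF.add hG, Germ.coe_add F G⟩
  zero_mem' := ⟨0, analyticAt_const, rfl⟩
  neg_mem' := by
    rintro _ ⟨F, hF, rfl⟩
    exact ⟨-F, hF.neg, Germ.coe_neg F⟩

/-- `𝒪_{Y,y}` as a type. -/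
abbrev LocRing (Y : Set E) (y : E) : Type _ := localRing Y y

/-- The element of `𝒪_{Y,y}` given by a function holomorphic near `y`. -/
def toGerm (Y : Set E) {y : E} (F : E → ℂ) (hF : AnalyticAt ℂ F y) : LocRing Y y :=
  ⟨(F : Germ (𝓝[Y] y) ℂ), F, hF, rfl⟩

/-- `φ` induces a germ of analytic maps `(Y', y') → (Y, y)`. -/
structure IsMapGerm (Y' : Set E') (y' : E') (Y : Set E) (y : E) (φ : E' → E) : Prop where
  analyticAt : AnalyticAt ℂ φ y'
  map_point : φ y' = y
  map_set : ∀ᶠ t in 𝓝[Y'] y', φ t ∈ Y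

theorem IsMapGerm.tendsto {Y' : Set E'} {y' : E'} {Y : Set E} {y : E} {φ : E' → E}
    (hφ : IsMapGerm Y' y' Y y φ) : Tendsto φ (𝓝[Y'] y') (𝓝[Y] y) := by
  refine tendsto_nhdsWithin_iff.2 ⟨?_, hφ.map_set⟩
  have h := hφ.analyticAt.continuousAt.tendsto
  rw [hφ.map_point] at h
  exact h.mono_left nhdsWithin_le_nhds

/-- The pull-back `φ^* : 𝒪_{Y,y} → 𝒪_{Y',y'}`, `h ↦ h ∘ φ`. -/
def pullback {Y' : Set E'} {y' : E'} {Y : Set E} {y : E} {φ : E' → E}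
    (hφ : IsMapGerm Y' y' Y y φ) : LocRing Y y →+* LocRing Y' y' where
  toFun h := ⟨h.1.compTendsto φ hφ.tendsto, by
    obtain ⟨_, F, hF, rfl⟩ := h
    refine ⟨F ∘ φ, ?_, rfl⟩
    have hF' : AnalyticAt ℂ F (φ y') := by rw [hφ.map_point]; exact hF
    exact hF'.comp hφ.analyticAt⟩
  map_one' := rfl
  map_zero' := rfl
  map_mul' := by
    rintro ⟨_, F, hF, rfl⟩ ⟨_, G, hG, rfl⟩
    rfl
  map_add' := by
    rintro ⟨_, F, hF, rfl⟩ ⟨_, G, hG, rfl⟩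
    rfl

/-- `φ` is a germ of analytic curves `(ℂ, 0) → (Y, y)`. -/
abbrev IsCurve (Y : Set E) (y : E) (φ : ℂ → E) : Prop := IsMapGerm Set.univ 0 Y y φ

/-- The ring `𝒪_1 = 𝒪_{ℂ,0}`. -/
abbrev LocRingOne : Type := LocRing (Set.univ : Set ℂ) 0

variable {ι : Type*}

/-- The `𝒪_1`-submodule `(φ^* M) 𝒪_1` of `𝒪_1^ι` generated by the `m ∘ φ`, `m ∈ M`. -/
def pullbackModule {Y : Set E} {y : E} {φ : ℂ → E} (hφ : IsCurve Y y φ)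
    (M : Submodule (LocRing Y y) (ι → LocRing Y y)) : Submodule LocRingOne (ι → LocRingOne) :=
  Submodule.span LocRingOne ((fun (m : ι → LocRing Y y) (i : ι) => pullback hφ (m i)) '' M)

/-- The integral closure of a submodule `M` of `𝒪_{Y,y}^ι`: all `h` such that
`h ∘ φ ∈ (φ^* M) 𝒪_1` for every analytic curve `φ : (ℂ, 0) → (Y, y)`. -/
def intClosure {Y : Set E} {y : E} (M : Submodule (LocRing Y y) (ι → LocRing Y y)) :
    Submodule (LocRing Y y) (ι → LocRing Y y) where
  carrier := {h | ∀ (φ : ℂ → E) (hφ : IsCurve Y y φ),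
    (fun i => pullback hφ (h i)) ∈ pullbackModule hφ M}
  add_mem' := by
    intro a b ha hb φ hφ
    have h := (pullbackModule hφ M).add_mem (ha φ hφ) (hb φ hφ)
    convert h using 1
    funext i
    exact map_add (pullback hφ) (a i) (b i)
  zero_mem' := by
    intro φ hφ
    convert (pullbackModule hφ M).zero_mem using 1
    funext i
    exact map_zero (pullback hφ)
  smul_mem' := by
    intro c a ha φ hφ
    have h := (pullbackModule hφ M).smul_mem (pullback hφ c) (ha φ hφ)
    convert h using 1
    funext i
    exact map_mul (pullback hφ) c (a i)

/-- The integral closure of an ideal of `𝒪_{Y,y}` (the rank one case of `intClosure`). -/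
def idealClosure {Y : Set E} {y : E} (I : Ideal (LocRing Y y)) : Ideal (LocRing Y y) where
  carrier := {h | ∀ (φ : ℂ → E) (hφ : IsCurve Y y φ), pullback hφ h ∈ I.map (pullback hφ)}
  add_mem' := by
    intro a b ha hb φ hφ
    rw [map_add]
    exact Ideal.add_mem _ (ha φ hφ) (hb φ hφ)
  zero_mem' := by
    intro φ hφ
    rw [map_zero]
    exact Ideal.zero_mem _
  smul_mem' := by
    intro c a ha φ hφ
    rw [smul_eq_mul, map_mul]
    exact Ideal.mul_mem_left _ _ (ha φ hφ)

/-- The first projection `(X × X, (x, x)) → (X, x)`. -/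
theorem isMapGerm_fst (X : Set E) (x : E) : IsMapGerm (X ×ˢ X) (x, x) X x Prod.fst :=
  ⟨analyticAt_fst, rfl, eventually_nhdsWithin_of_forall fun _ h => h.1⟩

/-- The second projection `(X × X, (x, x)) → (X, x)`. -/
theorem isMapGerm_snd (X : Set E) (x : E) : IsMapGerm (X ×ˢ X) (x, x) X x Prod.snd :=
  ⟨analyticAt_snd, rfl, eventually_nhdsWithin_of_forall fun _ h => h.2⟩

/-- The double `h_D = (h ∘ π₁, h ∘ π₂) ∈ 𝒪_{X × X,(x,x)}^2` of `h ∈ 𝒪_{X,x}`. -/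
def doubleElt {X : Set E} {x : E} (h : LocRing X x) : Fin 2 → LocRing (X ×ˢ X) (x, x) :=
  ![pullback (isMapGerm_fst X x) h, pullback (isMapGerm_snd X x) h]

/-- The double `I_D` of an ideal `I` of `𝒪_{X,x}`: the submodule of `𝒪_{X × X,(x,x)}^2` generated
by the `h_D`, `h ∈ I`. -/
def double {X : Set E} {x : E} (I : Ideal (LocRing X x)) :
    Submodule (LocRing (X ×ˢ X) (x, x)) (Fin 2 → LocRing (X ×ˢ X) (x, x)) :=
  Submodule.span _ (doubleElt '' (I : Set (LocRing X x)))

/-- `g ∈ 𝒪_{Y,p}^ι` is the germ at `p` of the tuple of functions `F`. -/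
def IsGermOf {Y : Set E} {p : E} (g : ι → LocRing Y p) (F : ι → E → ℂ) : Prop :=
  ∀ i, (g i : Germ (𝓝[Y] p) ℂ) = (F i : Germ (𝓝[Y] p) ℂ)

/-- The submodule of `𝒪_{Y,p}^ι` generated by the germs at `p` of the tuples `s k`. -/
def stalk (Y : Set E) {κ : Type*} (s : κ → ι → E → ℂ) (p : E) :
    Submodule (LocRing Y p) (ι → LocRing Y p) :=
  Submodule.span _ {g | ∃ k, IsGermOf g (s k)}

/-- The tuples `s k`, holomorphic near `y`, represent generators of `M ⊆ 𝒪_{Y,y}^ι`. For a finite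
family, `p ↦ stalk Y s p` is then, for `p ∈ Y` near `y`, the coherent sheaf of modules that extends
`M` to a neighbourhood of `y` in `Y`; near `y` it does not depend on the choice of `s`. -/
def Generates {Y : Set E} {y : E} {κ : Type*} (s : κ → ι → E → ℂ)
    (M : Submodule (LocRing Y y) (ι → LocRing Y y)) : Prop :=
  (∀ k i, AnalyticAt ℂ (s k i) y) ∧ stalk Y s y = M

/-- `h` is in the integral closure of (the sheaf defined by) `M` at all points of `Y` off `Z`,
in a neighbourhood of `y`. -/
def IntegralOff {Y : Set E} {y : E} (M : Submodule (LocRing Y y) (ι → LocRing Y y)) (Z : Set E)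
    (h : ι → LocRing Y y) : Prop :=
  ∃ (r : ℕ) (s : Fin r → ι → E → ℂ) (F : ι → E → ℂ),
    Generates s M ∧ (∀ i, AnalyticAt ℂ (F i) y) ∧ IsGermOf h F ∧
      ∀ᶠ p in 𝓝[Y] y, p ∉ Z → ∃ g ∈ intClosure (stalk Y s p), IsGermOf g F

/-- The integral closures of (the sheaves defined by) the finitely generated modules `M` and `N`
agree at all points of `Y` off `Z`, in a neighbourhood of `y`. -/
def ClosuresAgreeOff {Y : Set E} {y : E} (M N : Submodule (LocRing Y y) (ι → LocRing Y y))
    (Z : Set E) : Prop :=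
  ∃ (r r' : ℕ) (s : Fin r → ι → E → ℂ) (s' : Fin r' → ι → E → ℂ),
    Generates s M ∧ Generates s' N ∧
      ∀ᶠ p in 𝓝[Y] y, p ∉ Z → intClosure (stalk Y s p) = intClosure (stalk Y s' p)

/-- `Z` is an analytic subset of `Y` near `y`. -/
def IsAnalyticSubsetAt (Y : Set E) (y : E) (Z : Set E) : Prop :=
  Z ⊆ Y ∧ ∃ (r : ℕ) (c : Fin r → E → ℂ), (∀ j, AnalyticAt ℂ (c j) y) ∧
    ∀ᶠ p in 𝓝[Y] y, p ∈ Z ↔ ∀ j, c j p = 0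

/-- The analytic set `Z` has dimension at most `e` at `y`: there is a linear subspace `L` of
codimension at most `e` such that `y` is isolated in (or not in) `Z ∩ (y + L)`. -/
def DimAtLE (Z : Set E) (y : E) (e : ℕ) : Prop :=
  ∃ L : Submodule ℂ E, Module.finrank ℂ E ≤ Module.finrank ℂ L + e ∧
    ∀ᶠ p in 𝓝 y, p ∈ Z → p - y ∈ L → p = y

/-- `Z` is, near `y`, of codimension at least `c` in a space of pure dimension `d`: its germ at `y`
is empty or has dimension at most `d - c`. -/
def CodimAtGE (d : ℕ) (Z : Set E) (y : E) (c : ℕ) : Prop :=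
  (∀ᶠ p in 𝓝 y, p ∉ Z) ∨ ∃ e, e + c ≤ d ∧ DimAtLE Z y e

/-- The integral hull `H_k(M)` of codimension `k` of a submodule `M` of `𝒪_{Y,y}^ι`, where `Y` has
pure dimension `d` at `y`: all `h ∈ 𝒪_{Y,y}^ι` that are integrally dependent on `M` off an analytic
subset of `Y` of codimension at least `k + 1`. -/
def integralHull {Y : Set E} {y : E} (d k : ℕ)
    (M : Submodule (LocRing Y y) (ι → LocRing Y y)) : Set (ι → LocRing Y y) :=
  {h | ∃ Z : Set E, IsAnalyticSubsetAt Y y Z ∧ CodimAtGE d Z y (k + 1) ∧ IntegralOff M Z h}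

end LocalRings

section Hypersurface

variable {n : ℕ}

/-- `f` defines an isolated hypersurface singularity at the origin of `ℂⁿ`: it is holomorphic
near `0`, the hypersurface `f = 0` is singular at `0`, and `0` is an isolated point of
`f = 0`, `df = 0`. -/
structure IsIsolatedHypersurfaceSingularity (f : (Fin n → ℂ) → ℂ) : Prop where
  analyticAt : AnalyticAt ℂ f 0
  map_zero : f 0 = 0
  fderiv_zero : fderiv ℂ f 0 = 0
  isolated : ∀ᶠ z in 𝓝[≠] (0 : Fin n → ℂ), f z = 0 → fderiv ℂ f z ≠ 0

/-- The hypersurface `X = f⁻¹(0)`. -/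
def hypersurface (f : (Fin n → ℂ) → ℂ) : Set (Fin n → ℂ) := {z | f z = 0}

/-- The partial derivative `∂f/∂z_i`. -/
def partialDeriv (f : (Fin n → ℂ) → ℂ) (i : Fin n) (z : Fin n → ℂ) : ℂ :=
  fderiv ℂ f z (Pi.single i 1)

theorem analyticAt_partialDeriv {f : (Fin n → ℂ) → ℂ} {z : Fin n → ℂ} (hf : AnalyticAt ℂ f z)
    (i : Fin n) : AnalyticAt ℂ (partialDeriv f i) z :=
  ((ContinuousLinearMap.apply ℂ ℂ (Pi.single i 1 : Fin n → ℂ)).analyticAt _).comp hf.fderiv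

/-- The Jacobian ideal `J(f)` in `𝒪_{X,0}`, generated by the partial derivatives of `f`. -/
def jacobianIdeal {f : (Fin n → ℂ) → ℂ} (hf : AnalyticAt ℂ f 0) :
    Ideal (LocRing (hypersurface f) 0) :=
  Ideal.span (Set.range fun i => toGerm (hypersurface f) (partialDeriv f i)
    (analyticAt_partialDeriv hf i))

end Hypersurface

end LipHull

end

open LipHull

/-! Write `J` for the Jacobian ideal, `J̄` for its integral closure, `m` for the maximal ideal of
`𝒪_{X,0}`. Codimension `2n-2` in `X × X` leaves only the origin, so both assertions reduce to one: a
pair `h = (h₁, h₂)` is integral over `J_D` at all points near, but different from, `(0,0)` if and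
only if `h ∈ J̄_D`.

If `h ∈ J̄_D`, it suffices to treat doubles of elements of `J̄` at a point `(a,b) ≠ (0,0)`. If `a =
b`, then `a ≠ 0` is a smooth point and `J` is the unit ideal there. If `a ≠ b`, some coordinate
difference is a unit, so along curves `J_D` splits into the two copies of `J` at `a` and at `b`, and
each component is integral separately. This is `eventually_mem_intClosure_doubleGens`.

Conversely, let `h` be integral off the origin (`mem_double_idealClosure_of_integralOff`). Curves
inside the slice `X × {w}`, `w ≠ 0`, show that the germ of `h₁(·, w)` at `0` lies in `J̄`. By a
Łojasiewicz inequality `J̄` contains a power of `m`, hence has finite codimension. With `e_l`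
lifting a basis of `𝒪_{X,0}/J̄`, one has `h₁ ≡ ∑ e_l(z) c_l(w)` modulo `π₁^* J̄`; the slices force
`c_l(w) = 0` for `w ≠ 0`, and then `c_l = 0` because `0` is not isolated in `X` (here `n ≥ 2`
enters). So `h₁ ∈ π₁^* J̄`, and symmetrically `h₂ ∈ π₂^* J̄`. Constant curves on the diagonal give
`h₁ = h₂` there. Finally, a pair with `h_i ∈ π_i^* I` and equal restrictions to the diagonal lies in
`I_D` (`mem_double_of_diagRes_eq`).

The analytic input is Hadamard's lemma and the Łojasiewicz inequality, the latter by induction on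
the dimension through Weierstrass division and resultants. Both rest on the analyticity of
superposition operators on a disc algebra. -/

open Filter Topology

noncomputable section

namespace LipHull

/-! ### Disc algebras and superposition operators. -/

section DiscAlgebra

open Metric

variable {E F : Type*} [NormedAddCommGroup E] [NormedSpace ℂ E] [NormedAddCommGroup F]
  [NormedSpace ℂ F]

/-- The continuous functions on the closed disc of radius `ρ` that are holomorphic inside. -/
def discSubmodule (ρ : ℝ) (F : Type*) [NormedAddCommGroup F] [NormedSpace ℂ F] :
    Submodule ℂ C(closedBall (0 : ℂ) ρ, F) where
  carrier := {a | ∃ A : ℂ → F, DifferentiableOn ℂ A (ball 0 ρ) ∧ ∀ x, a x = A x}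
  add_mem' := by
    rintro a b ⟨A, hA, ha⟩ ⟨B, hB, hb⟩
    exact ⟨A + B, hA.add hB, fun x => by simp [ha, hb]⟩
  zero_mem' := ⟨0, differentiableOn_const 0, fun x => rfl⟩
  smul_mem' := by
    rintro c a ⟨A, hA, ha⟩
    exact ⟨c • A, hA.const_smul c, fun x => by simp [ha]⟩

/-- Uniform limits of holomorphic functions are holomorphic. The resulting completeness is what
makes power series and inversion of operators available on the disc algebra. -/
theorem isClosed_discSubmodule (ρ : ℝ) [CompleteSpace F] :
    IsClosed (discSubmodule ρ F : Set C(closedBall (0 : ℂ) ρ, F)) := by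
  refine IsSeqClosed.isClosed ?_
  intro a b ha hab
  choose A hA haA using ha
  have hunif := ContinuousMap.tendsto_iff_tendstoUniformly.1 hab
  refine ⟨Function.extend Subtype.val b 0, ?_, fun x => (Subtype.val_injective.extend_apply _ _ _).symm⟩
  have hT : TendstoUniformlyOn A (Function.extend Subtype.val b 0) atTop (ball 0 ρ) := by
    intro u hu
    filter_upwards [hunif u hu] with n hn x hx
    have := hn ⟨x, ball_subset_closedBall hx⟩
    rw [haA] at this
    have h2 : Function.extend Subtype.val (⇑b) 0 x = b ⟨x, ball_subset_closedBall hx⟩ :=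
      Subtype.val_injective.extend_apply b 0 ⟨x, ball_subset_closedBall hx⟩
    rw [h2]
    exact this
  exact hT.tendstoLocallyUniformlyOn.differentiableOn (Eventually.of_forall hA) isOpen_ball

/-- The disc algebra, with values in `F`. -/
def discAlg (ρ : ℝ) (F : Type*) [NormedAddCommGroup F] [NormedSpace ℂ F] : Type _ :=
  ↥(discSubmodule ρ F)

instance (ρ : ℝ) : NormedAddCommGroup (discAlg ρ F) :=
  inferInstanceAs (NormedAddCommGroup ↥(discSubmodule ρ F))

instance (ρ : ℝ) : NormedSpace ℂ (discAlg ρ F) :=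
  inferInstanceAs (NormedSpace ℂ ↥(discSubmodule ρ F))

instance (ρ : ℝ) [CompleteSpace F] : CompleteSpace (discAlg ρ F) :=
  (isClosed_discSubmodule ρ).completeSpace_coe

/-- Constructor of elements of the disc algebra. -/
def discMk {ρ : ℝ} (a : C(closedBall (0 : ℂ) ρ, F))
    (h : ∃ A : ℂ → F, DifferentiableOn ℂ A (ball 0 ρ) ∧ ∀ x, a x = A x) : discAlg ρ F := ⟨a, h⟩

@[simp] theorem discMk_apply {ρ : ℝ} (a : C(closedBall (0 : ℂ) ρ, F)) (h) (x) :
    (discMk a h).1 x = a x := rfl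

@[ext] theorem discAlg_ext {ρ : ℝ} {a b : discAlg ρ F} (h : ∀ x, a.1 x = b.1 x) : a = b :=
  Subtype.ext (ContinuousMap.ext h)

@[simp] theorem discAlg_add_apply {ρ : ℝ} (a b : discAlg ρ F) (x) :
    (a + b).1 x = a.1 x + b.1 x := rfl

@[simp] theorem discAlg_smul_apply {ρ : ℝ} (c : ℂ) (a : discAlg ρ F) (x) :
    (c • a).1 x = c • a.1 x := rfl

theorem discAlg_norm_le {ρ : ℝ} {a : discAlg ρ F} {C : ℝ} (hC : 0 ≤ C)
    (h : ∀ x, ‖a.1 x‖ ≤ C) : ‖a‖ ≤ C :=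
  (ContinuousMap.norm_le a.1 hC).2 h

theorem discAlg_norm_apply_le {ρ : ℝ} (a : discAlg ρ F) (x) : ‖a.1 x‖ ≤ ‖a‖ :=
  a.1.norm_coe_le_norm x

/-- Evaluation at a point of the disc. -/
def discEval (ρ : ℝ) (x : closedBall (0 : ℂ) ρ) : discAlg ρ F →L[ℂ] F :=
  LinearMap.mkContinuous
    { toFun := fun a => a.1 x, map_add' := fun _ _ => rfl, map_smul' := fun _ _ => rfl } 1
    fun a => by rw [one_mul]; exact discAlg_norm_apply_le a x

@[simp] theorem discEval_apply (ρ : ℝ) (x : closedBall (0 : ℂ) ρ) (a : discAlg ρ F) :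
    discEval ρ x a = a.1 x := rfl

/-- A continuous multilinear map, applied pointwise. -/
def discMultilinear (ρ : ℝ) {n : ℕ} (p : E [×n]→L[ℂ] F) : (discAlg ρ E) [×n]→L[ℂ] (discAlg ρ F) :=
  MultilinearMap.mkContinuous
    { toFun := fun m => discMk ⟨fun x => p fun i => (m i).1 x,
          p.cont.comp (continuous_pi fun i => (m i).1.continuous)⟩ (by
        choose A hA hmA using fun i => (m i).2
        refine ⟨fun x => p fun i => A i x, fun x hx => ?_, fun x => ?_⟩
        · have h := fun i => ((hA i).differentiableAt (isOpen_ball.mem_nhds hx)).hasFDerivAt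
          exact (HasFDerivAt.multilinear_comp p h).differentiableAt.differentiableWithinAt
        · simp [← hmA])
      map_update_add' := by
        intro _ m i a b
        ext x
        have h : ∀ c : discAlg ρ E, (fun j => (Function.update m i c j).1 x) =
            Function.update (fun j => (m j).1 x) i (c.1 x) := by
          intro c
          funext j
          by_cases hj : j = i
          · subst hj; simp
          · simp [hj]
        simp [h]
      map_update_smul' := by
        intro _ m i c a
        ext x
        have h : ∀ c : discAlg ρ E, (fun j => (Function.update m i c j).1 x) =
            Function.update (fun j => (m j).1 x) i (c.1 x) := by
          intro c
          funext j
          by_cases hj : j = i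
          · subst hj; simp
          · simp [hj]
        simp [h] } ‖p‖ fun m =>
    discAlg_norm_le (by positivity) fun x => (p.le_opNorm _).trans <| by
      gcongr with i
      exact discAlg_norm_apply_le _ _

/-- The superposition operator `Φ ↦ h ∘ Φ` is analytic. -/
theorem exists_analyticAt_superposition [CompleteSpace F] (ρ : ℝ) {h : E → F} {y : E}
    {p : FormalMultilinearSeries ℂ E F} {r : ENNReal} (hp : HasFPowerSeriesOnBall h p y r) :
    ∃ S : discAlg ρ E → discAlg ρ F, ∀ Φ : discAlg ρ E, ‖Φ‖ₑ < r →
      AnalyticAt ℂ S Φ ∧ ∀ x, (S Φ).1 x = h (y + Φ.1 x) := by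
  -- The Taylor series of `h` acts pointwise on discs. Its coefficients do not grow in norm, so its
  -- radius of convergence is at least that of `h`.
  let P : FormalMultilinearSeries ℂ (discAlg ρ E) (discAlg ρ F) := fun n => discMultilinear ρ (p n)
  have hrad : p.radius ≤ P.radius := by
    refine ENNReal.le_of_forall_nnreal_lt fun s hs => ?_
    obtain ⟨C, -, hC⟩ := p.norm_mul_pow_le_of_lt_radius hs
    refine P.le_radius_of_bound C fun n => le_trans ?_ (hC n)
    gcongr
    exact MultilinearMap.mkContinuous_norm_le _ (norm_nonneg _) _
  have hr : r ≤ P.radius := hp.r_le.trans hrad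
  have hP := P.hasFPowerSeriesOnBall (hp.r_pos.trans_le hr)
  refine ⟨P.sum, fun Φ hΦ => ⟨hP.analyticAt_of_mem (by simpa using hΦ.trans_le hr), fun x => ?_⟩⟩
  have h1 := (P.hasSum (x := Φ) (by simpa using hΦ.trans_le hr)).mapL (discEval ρ x)
  have h2 := hp.hasSum (y := Φ.1 x) (by
    simp only [mem_eball, edist_zero_right]
    refine lt_of_le_of_lt ?_ hΦ
    rw [← ofReal_norm, ← ofReal_norm]
    exact ENNReal.ofReal_le_ofReal (discAlg_norm_apply_le Φ x))
  exact h1.unique h2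

end DiscAlgebra

/-! ### Hadamard's lemma with analytic coefficients. -/

section Hadamard

open Metric

variable {E F : Type*} [NormedAddCommGroup E] [NormedSpace ℂ E] [NormedAddCommGroup F]
  [NormedSpace ℂ F] [CompleteSpace F]

/-- The inclusion of the unit interval into the closed unit disc. -/
def intervalToDisc : C(Set.Icc (0 : ℝ) 1, closedBall (0 : ℂ) 1) :=
  ⟨fun t => ⟨(t : ℝ), by
    have h0 := t.2.1
    have h1 := t.2.2
    simp only [mem_closedBall, dist_zero_right, Complex.norm_real, Real.norm_eq_abs]
    rwa [abs_of_nonneg h0]⟩, by fun_prop⟩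

theorem continuous_extend_disc {F : Type*} [NormedAddCommGroup F] (a : C(closedBall (0 : ℂ) 1, F)) :
    Continuous (Set.IccExtend (zero_le_one' ℝ) (a.comp intervalToDisc)) :=
  (a.comp intervalToDisc).continuous.Icc_extend'

/-- Integration over the unit interval inside the unit disc. -/
def discIntegral (F : Type*) [NormedAddCommGroup F] [NormedSpace ℂ F] [CompleteSpace F] :
    discAlg 1 F →L[ℂ] F :=
  LinearMap.mkContinuous
    { toFun := fun a => ∫ t in (0 : ℝ)..1, Set.IccExtend (zero_le_one' ℝ) (a.1.comp intervalToDisc) t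
      map_add' := fun a b => by
        rw [← intervalIntegral.integral_add
          ((continuous_extend_disc a.1).intervalIntegrable 0 1)
          ((continuous_extend_disc b.1).intervalIntegrable 0 1)]
        rfl
      map_smul' := fun c a => by
        simp only [RingHom.id_apply]
        rw [← intervalIntegral.integral_smul]
        rfl } 1 fun a => by
    have := intervalIntegral.norm_integral_le_of_norm_le_const (a := (0 : ℝ)) (b := 1)
      (f := Set.IccExtend (zero_le_one' ℝ) (a.1.comp intervalToDisc)) (C := ‖a‖)
      fun t _ => discAlg_norm_apply_le a _
    simpa using this

/-- The affine disc `t ↦ a + t (b - a)`. -/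
def affineDisc (E : Type*) [NormedAddCommGroup E] [NormedSpace ℂ E] : E × E →L[ℂ] discAlg 1 E :=
  LinearMap.mkContinuous
    { toFun := fun ab => discMk ⟨fun t => ab.1 + (t : ℂ) • (ab.2 - ab.1), by fun_prop⟩
        ⟨fun t => ab.1 + t • (ab.2 - ab.1), by fun_prop, fun t => rfl⟩
      map_add' := fun a b => by
        ext t
        simp only [Prod.fst_add, Prod.snd_add, ContinuousMap.coe_mk, discMk_apply,
          discAlg_add_apply, smul_sub, smul_add]
        abel
      map_smul' := fun c a => by
        ext t
        simp only [Prod.smul_fst, Prod.smul_snd, ContinuousMap.coe_mk, RingHom.id_apply,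
          discMk_apply, discAlg_smul_apply, smul_add, smul_sub, smul_comm c] } 3
    fun ab => discAlg_norm_le (by positivity) fun t => by
      have ht : ‖(t : ℂ)‖ ≤ 1 := mem_closedBall_zero_iff.1 t.2
      have h1 := norm_fst_le ab
      have h2 := norm_snd_le ab
      calc ‖ab.1 + (t : ℂ) • (ab.2 - ab.1)‖ ≤ ‖ab.1‖ + ‖(t : ℂ)‖ * (‖ab.2‖ + ‖ab.1‖) := by
            refine (norm_add_le _ _).trans ?_
            rw [norm_smul]
            gcongr
            exact norm_sub_le _ _
        _ ≤ ‖ab.1‖ + 1 * (‖ab.2‖ + ‖ab.1‖) := by gcongr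
        _ ≤ 3 * ‖ab‖ := by linarith

theorem affineDisc_apply (ab : E × E) (t) :
    (affineDisc E ab).1 t = ab.1 + (t : ℂ) • (ab.2 - ab.1) := rfl

/-- Hadamard's lemma for analytic functions. -/
theorem exists_analyticAt_hadamard {G : E → F} {y : E} (hG : AnalyticAt ℂ G y) :
    ∃ B : E × E → E →L[ℂ] F, AnalyticAt ℂ B (y, y) ∧
      ∀ᶠ ab in 𝓝 (y, y), G ab.2 - G ab.1 = B ab (ab.2 - ab.1) := by
  -- The coefficient is `B(a,b) = ∫₀¹ DG(a + t(b - a)) dt`. It is analytic in `(a,b)` as a composite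
  -- of the linear map to affine discs, superposition with `DG`, and the linear integral.
  obtain ⟨p, r, hp⟩ := hG.fderiv
  obtain ⟨S, hS⟩ := exists_analyticAt_superposition 1 hp
  have hL : AnalyticAt ℂ (fun ab : E × E => affineDisc E (ab - (y, y))) (y, y) :=
    ((affineDisc E).analyticAt _).comp (analyticAt_id.sub analyticAt_const)
  have hL0 : affineDisc E ((y, y) - (y, y)) = 0 := by simp
  have hL1 : ‖affineDisc E ((y, y) - (y, y))‖ₑ < r := by
    rw [hL0, ← ofReal_norm, norm_zero, ENNReal.ofReal_zero]
    exact hp.r_pos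
  refine ⟨fun ab => discIntegral _ (S (affineDisc E (ab - (y, y)))), ?_, ?_⟩
  · refine ((discIntegral _).analyticAt _).comp (AnalyticAt.comp (g := S) ?_ hL)
    exact (hS _ hL1).1
  · have hev1 : ∀ᶠ ab in 𝓝 (y, y), ‖affineDisc E (ab - (y, y))‖ₑ < r := by
      have := hL.continuousAt.enorm
      exact this.eventually_lt_const hL1
    obtain ⟨ε, hε, hball⟩ := Metric.eventually_nhds_iff_ball.1 hG.eventually_analyticAt
    have hev2 : ∀ᶠ ab in 𝓝 (y, y), ab ∈ ball (y, y) ε := ball_mem_nhds _ hε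
    filter_upwards [hev1, hev2] with ab h1 h2
    have h2a : ab.1 ∈ ball y ε :=
      show dist ab.1 y < ε from lt_of_le_of_lt (le_max_left _ (dist ab.2 y)) h2
    have h2b : ab.2 ∈ ball y ε :=
      show dist ab.2 y < ε from lt_of_le_of_lt (le_max_right (dist ab.1 y) _) h2
    have hmem : ∀ t ∈ Set.Icc (0 : ℝ) 1, ab.1 + (t : ℂ) • (ab.2 - ab.1) ∈ ball y ε := by
      intro t ht
      have := (convex_ball y ε).add_smul_sub_mem h2a h2b ht
      simpa using this
    have hval := (hS _ h1).2
    let Ψ := Set.IccExtend (zero_le_one' ℝ)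
      ((S (affineDisc E (ab - (y, y)))).1.comp intervalToDisc)
    have hΨ : ∀ t ∈ Set.Icc (0 : ℝ) 1,
        Ψ t = fderiv ℂ G (ab.1 + (t : ℂ) • (ab.2 - ab.1)) := by
      intro t ht
      simp only [Ψ, Set.IccExtend_of_mem _ _ ht]
      refine (hval _).trans ?_
      rw [affineDisc_apply]
      congr 1
      simp [intervalToDisc]
      abel
    have hcont : Continuous Ψ := continuous_extend_disc _
    have hint : (∫ t in (0 : ℝ)..1, Ψ t (ab.2 - ab.1)) = G ab.2 - G ab.1 := by
      have := intervalIntegral.integral_eq_sub_of_hasDerivAt (a := (0 : ℝ)) (b := 1)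
        (f := fun t : ℝ => G (ab.1 + (t : ℂ) • (ab.2 - ab.1))) (f' := fun t => Ψ t (ab.2 - ab.1))
        (fun t ht => ?_) ?_
      · simpa using this
      · rw [Set.uIcc_of_le zero_le_one] at ht
        have hd := (hball _ (hmem t ht)).differentiableAt.hasFDerivAt
        rw [hΨ t ht]
        have hlin : HasDerivAt (fun t : ℝ => ab.1 + (t : ℂ) • (ab.2 - ab.1)) (ab.2 - ab.1) t := by
          have h := (Complex.ofRealCLM.hasDerivAt (x := t)).smul_const (ab.2 - ab.1)
          simpa using h.const_add ab.1
        exact (hd.restrictScalars ℝ).comp_hasDerivAt t hlin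
      · exact (hcont.clm_apply continuous_const).intervalIntegrable 0 1
    have h3 := ContinuousLinearMap.intervalIntegral_apply (𝕜 := ℂ)
      (hcont.intervalIntegrable (μ := MeasureTheory.volume) 0 1) (ab.2 - ab.1)
    exact hint.symm.trans h3.symm

end Hadamard

/-! ### Weierstrass division by perturbation of an invertible operator. -/

section Weierstrass

open Metric Asymptotics

variable {W : Type*} [NormedAddCommGroup W] [NormedSpace ℂ W]

/-- A function that is continuous on the closed disc and holomorphic inside, as an element of the
disc algebra. -/
def discOf {ρ : ℝ} (A : ℂ → ℂ) (hc : ContinuousOn A (closedBall 0 ρ))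
    (hd : DifferentiableOn ℂ A (ball 0 ρ)) : discAlg ρ ℂ :=
  discMk ⟨fun x => A x, hc.comp_continuous continuous_subtype_val fun x => x.2⟩ ⟨A, hd, fun _ => rfl⟩

theorem exists_eq_discOf {ρ : ℝ} (a : discAlg ρ ℂ) :
    ∃ (A : ℂ → ℂ) (hc : ContinuousOn A (closedBall 0 ρ)) (hd : DifferentiableOn ℂ A (ball 0 ρ)),
      a = discOf A hc hd := by
  obtain ⟨B, hB, haB⟩ := a.2
  have hext : ∀ x : closedBall (0 : ℂ) ρ, Function.extend Subtype.val a.1 0 x = a.1 x := fun x =>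
    Subtype.val_injective.extend_apply _ _ _
  refine ⟨Function.extend Subtype.val a.1 0, ?_, ?_, ?_⟩
  · rw [continuousOn_iff_continuous_domRestrict]
    exact a.1.continuous.congr fun x => (hext x).symm
  · refine hB.congr fun x hx => ?_
    exact (hext ⟨x, ball_subset_closedBall hx⟩).trans (haB _)
  · ext x
    exact (hext x).symm

/-- Each step splits off the value at the origin and passes to the slope `dslope`, which stays
holomorphic inside and continuous up to the boundary. -/
theorem exists_eq_pow_mul_add_poly {ρ : ℝ} (hρ : 0 < ρ) (d : ℕ) {A : ℂ → ℂ}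
    (hc : ContinuousOn A (closedBall 0 ρ)) (hd : DifferentiableOn ℂ A (ball 0 ρ)) :
    ∃ (B : ℂ → ℂ) (c : Fin d → ℂ), ContinuousOn B (closedBall 0 ρ) ∧
      DifferentiableOn ℂ B (ball 0 ρ) ∧ ∀ x, A x = x ^ d * B x + ∑ i, c i * x ^ (i : ℕ) := by
  induction d with
  | zero => exact ⟨A, 0, hc, hd, by simp⟩
  | succ d ih =>
    obtain ⟨B, c, hBc, hBd, hB⟩ := ih
    refine ⟨dslope B 0, Fin.snoc c (B 0), ?_, ?_, fun x => ?_⟩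
    · exact (continuousOn_dslope (closedBall_mem_nhds _ hρ)).2
        ⟨hBc, hBd.differentiableAt (ball_mem_nhds _ hρ)⟩
    · exact (Complex.differentiableOn_dslope (ball_mem_nhds _ hρ)).2 hBd
    · have := sub_smul_dslope B 0 x
      simp only [sub_zero, smul_eq_mul] at this
      rw [Fin.sum_univ_castSucc, hB x]
      simp only [Fin.snoc_castSucc, Fin.val_castSucc, Fin.snoc_last, Fin.val_last, pow_succ]
      linear_combination (-x ^ d) * this

/-- Evaluation at `0` kills the lowest coefficient; after division by `x` the relation holds off the
origin, and continuity restores it there. -/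
theorem eq_zero_of_pow_mul_add_poly {ρ : ℝ} (hρ : 0 < ρ) (d : ℕ) {B : ℂ → ℂ} (c : Fin d → ℂ)
    (hB : ContinuousOn B (closedBall 0 ρ))
    (h : ∀ x ∈ closedBall (0 : ℂ) ρ, x ^ d * B x + ∑ i, c i * x ^ (i : ℕ) = 0) :
    c = 0 ∧ ∀ x ∈ closedBall (0 : ℂ) ρ, B x = 0 := by
  induction d with
  | zero => exact ⟨Subsingleton.elim _ _, by simpa using h⟩
  | succ d ih =>
    have h0 : c 0 = 0 := by
      have := h 0 (mem_closedBall_self hρ.le)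
      simpa [Fin.sum_univ_succ] using this
    have hne : ∀ x ∈ closedBall (0 : ℂ) ρ, x ≠ 0 →
        x ^ d * B x + ∑ i : Fin d, c i.succ * x ^ (i : ℕ) = 0 := by
      intro x hx hx0
      have h1 := h x hx
      rw [Fin.sum_univ_succ, h0] at h1
      refine (mul_eq_zero.1 ?_ : x = 0 ∨ _).resolve_left hx0
      rw [mul_add, Finset.mul_sum, ← h1]
      simp only [Fin.val_succ, pow_succ, zero_mul, zero_add]
      congr 1
      · ring
      · exact Finset.sum_congr rfl fun i _ => by ring
    have hcont : ContinuousAt (fun x : ℂ => x ^ d * B x + ∑ i : Fin d, c i.succ * x ^ (i : ℕ)) 0 := by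
      have := hB.continuousAt (closedBall_mem_nhds _ hρ)
      fun_prop
    have hlim : Tendsto (fun x : ℂ => x ^ d * B x + ∑ i : Fin d, c i.succ * x ^ (i : ℕ)) (𝓝[≠] 0)
        (𝓝 0) := by
      refine tendsto_const_nhds.congr' ?_
      filter_upwards [self_mem_nhdsWithin, nhdsWithin_le_nhds (closedBall_mem_nhds (0 : ℂ) hρ)]
        with x hx hx' using (hne x hx' hx).symm
    have hzero := tendsto_nhds_unique (hcont.tendsto.mono_left nhdsWithin_le_nhds) hlim
    obtain ⟨h1, h2⟩ := ih (fun i => c i.succ) fun x hx => by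
      by_cases hx0 : x = 0
      · subst hx0; exact hzero
      · exact hne x hx hx0
    refine ⟨?_, h2⟩
    funext i
    refine Fin.cases h0 (fun j => congrFun h1 j) i

/-- Multiplication in the disc algebra. -/
def discMul (ρ : ℝ) : discAlg ρ ℂ →L[ℂ] discAlg ρ ℂ →L[ℂ] discAlg ρ ℂ :=
  LinearMap.mkContinuous₂
    (LinearMap.mk₂ ℂ (fun a b => discMk (a.1 * b.1) (by
        obtain ⟨A, hA, ha⟩ := a.2
        obtain ⟨B, hB, hb⟩ := b.2
        exact ⟨A * B, hA.mul hB, fun x => by simp [ha, hb]⟩))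
      (fun a a' b => by ext x; simp [add_mul]) (fun c a b => by ext x; simp [mul_assoc])
      (fun a b b' => by ext x; simp [mul_add]) (fun c a b => by ext x; simp [mul_left_comm])) 1
    fun a b => discAlg_norm_le (by positivity) fun x => by
      simp only [LinearMap.mk₂_apply, discMk_apply, ContinuousMap.mul_apply, norm_mul, one_mul]
      gcongr <;> exact discAlg_norm_apply_le _ _

@[simp] theorem discMul_apply {ρ : ℝ} (a b : discAlg ρ ℂ) (x) :
    (discMul ρ a b).1 x = a.1 x * b.1 x := rfl

/-- Polynomials of degree less than `d`, as elements of the disc algebra. -/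
def discPoly (ρ : ℝ) (d : ℕ) : (Fin d → ℂ) →L[ℂ] discAlg ρ ℂ :=
  ∑ i : Fin d, (ContinuousLinearMap.proj (R := ℂ) (φ := fun _ => ℂ) i).smulRight
    (discOf (ρ := ρ) (fun x => x ^ (i : ℕ)) (by fun_prop) (by fun_prop))

theorem discPoly_apply {ρ : ℝ} {d : ℕ} (c : Fin d → ℂ) (x) :
    (discPoly ρ d c).1 x = ∑ i, c i * (x : ℂ) ^ (i : ℕ) := by
  change discEval ρ x (discPoly ρ d c) = _
  simp only [discPoly, _root_.sum_apply, map_sum]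
  rfl

/-- `(q, c) ↦ q g + c`. -/
def divisionMap {ρ : ℝ} (d : ℕ) (g : discAlg ρ ℂ) :
    discAlg ρ ℂ × (Fin d → ℂ) →L[ℂ] discAlg ρ ℂ :=
  (discMul ρ g).coprod (discPoly ρ d)

theorem divisionMap_apply {ρ : ℝ} {d : ℕ} (g : discAlg ρ ℂ) (q) (x) :
    (divisionMap d g q).1 x = g.1 x * q.1.1 x + ∑ i, q.2 i * (x : ℂ) ^ (i : ℕ) := by
  rw [← discPoly_apply]
  rfl

/-- Since `u` has no zeros on the closed disc, division by `x ^ d * u` is division by `x ^ d` up to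
the factor `u`. Injectivity is thus uniqueness of Taylor division, and surjectivity, in
`divisionMap_range`, is its existence. -/
theorem divisionMap_ker {ρ : ℝ} (hρ : 0 < ρ) {d : ℕ} {g : discAlg ρ ℂ} {u : ℂ → ℂ}
    (huc : ContinuousOn u (closedBall 0 ρ)) (hu0 : ∀ x ∈ closedBall (0 : ℂ) ρ, u x ≠ 0)
    (hg : ∀ x, g.1 x = (x : ℂ) ^ d * u x) :
    (divisionMap d g).toLinearMap.ker = ⊥ := by
  rw [LinearMap.ker_eq_bot']
  rintro ⟨q, c⟩ h
  obtain ⟨Q, hQc, hQd, rfl⟩ := exists_eq_discOf q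
  obtain ⟨hc, hQ⟩ := eq_zero_of_pow_mul_add_poly hρ d (B := fun x => u x * Q x) c (huc.mul hQc) (by
    intro x hx
    have h1 : (divisionMap d g (discOf Q hQc hQd, c)).1 ⟨x, hx⟩ = 0 := by
      exact congrArg (fun a : discAlg ρ ℂ => a.1 ⟨x, hx⟩) h
    rw [divisionMap_apply, hg] at h1
    simpa [discOf, mul_assoc] using h1)
  refine Prod.ext ?_ hc
  ext x
  exact (mul_eq_zero.1 (hQ x x.2)).resolve_left (hu0 x x.2)

theorem divisionMap_range {ρ : ℝ} (hρ : 0 < ρ) {d : ℕ} {g : discAlg ρ ℂ} {u : ℂ → ℂ}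
    (huc : ContinuousOn u (closedBall 0 ρ)) (hud : DifferentiableOn ℂ u (ball 0 ρ))
    (hu0 : ∀ x ∈ closedBall (0 : ℂ) ρ, u x ≠ 0) (hg : ∀ x, g.1 x = (x : ℂ) ^ d * u x) :
    (divisionMap d g).toLinearMap.range = ⊤ := by
  rw [LinearMap.range_eq_top]
  intro a
  obtain ⟨A, hAc, hAd, rfl⟩ := exists_eq_discOf a
  obtain ⟨B, c, hBc, hBd, hB⟩ := exists_eq_pow_mul_add_poly hρ d hAc hAd
  refine ⟨(discOf (fun x => B x / u x) (hBc.div huc hu0)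
    (hBd.div hud fun x hx => hu0 x (ball_subset_closedBall hx)), c), ?_⟩
  ext x
  refine (divisionMap_apply _ _ _).trans ?_
  simp only [discOf, discMk_apply, ContinuousMap.coe_mk, hg, hB]
  have := hu0 x x.2
  field_simp

theorem analyticAt_clm_apply {A B : Type*} [NormedAddCommGroup A] [NormedSpace ℂ A]
    [NormedAddCommGroup B] [NormedSpace ℂ B] (M : A →L[ℂ] B) {S : W → A} {w : W}
    (hS : AnalyticAt ℂ S w) : AnalyticAt ℂ (fun w => M (S w)) w := (M.analyticAt _).comp hS

theorem analyticAt_clm_comp_const {U V A : Type*} [NormedAddCommGroup U] [NormedSpace ℂ U]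
    [NormedAddCommGroup V] [NormedSpace ℂ V] [NormedAddCommGroup A] [NormedSpace ℂ A]
    {D : W → V →L[ℂ] A} {w : W} (hD : AnalyticAt ℂ D w) (L : U →L[ℂ] V) :
    AnalyticAt ℂ (fun w => (D w).comp L) w :=
  (((ContinuousLinearMap.compL ℂ U V A).flip L).analyticAt _).comp hD

theorem analyticAt_coprod_const {U V A : Type*} [NormedAddCommGroup U] [NormedSpace ℂ U]
    [NormedAddCommGroup V] [NormedSpace ℂ V] [NormedAddCommGroup A] [NormedSpace ℂ A]
    {D : W → V →L[ℂ] A} {w : W} (hD : AnalyticAt ℂ D w) (L : U →L[ℂ] A) :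
    AnalyticAt ℂ (fun w => (D w).coprod L) w := by
  have h := (analyticAt_clm_comp_const hD (ContinuousLinearMap.fst ℂ V U)).add
    (analyticAt_const (v := L.comp (ContinuousLinearMap.snd ℂ V U)))
  refine h.congr (Eventually.of_forall fun w => ?_)
  ext v <;> simp

/-- Solutions of an invertible analytic family of linear equations are analytic. -/
theorem exists_analyticAt_solution {V A : Type*} [NormedAddCommGroup V] [NormedSpace ℂ V]
    [CompleteSpace V] [NormedAddCommGroup A] [NormedSpace ℂ A] {D : W → V →L[ℂ] A} {w₀ : W}
    (hD : AnalyticAt ℂ D w₀) (e : V ≃L[ℂ] A) (he : (e : V →L[ℂ] A) = D w₀) {s : W → A}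
    (hs : AnalyticAt ℂ s w₀) :
    ∃ sol : W → V, AnalyticAt ℂ sol w₀ ∧ ∀ᶠ w in 𝓝 w₀, D w (sol w) = s w := by
  -- `T` is the identity at `w₀`, hence invertible nearby, and inversion is analytic in a Banach
  -- algebra.
  let T : W → V →L[ℂ] V := fun w => (e.symm : A →L[ℂ] V).comp (D w)
  have hT0 : T w₀ = 1 := by
    ext v
    simp [T, ← he]
  have hTan : AnalyticAt ℂ T w₀ :=
    ((ContinuousLinearMap.compL ℂ V A V (e.symm : A →L[ℂ] V)).analyticAt _).comp hD
  have hinv : AnalyticAt ℂ (fun w => Ring.inverse (T w)) w₀ := by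
    refine AnalyticAt.comp (g := Ring.inverse) ?_ hTan
    rw [hT0]
    exact analyticAt_inverse (1 : (V →L[ℂ] V)ˣ)
  have hunit : ∀ᶠ w in 𝓝 w₀, IsUnit (T w) :=
    hTan.continuousAt.eventually_mem (Units.isOpen.mem_nhds (by rw [hT0]; exact isUnit_one))
  refine ⟨fun w => Ring.inverse (T w) (e.symm (s w)), ?_, ?_⟩
  · have h2 : AnalyticAt ℂ (fun w => e.symm (s w)) w₀ :=
      ((e.symm : A →L[ℂ] V).analyticAt _).comp hs
    exact ((ContinuousLinearMap.apply ℂ V).flip.analyticAt_bilinear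
      (Ring.inverse (T w₀), e.symm (s w₀))).comp₂ hinv h2
  · filter_upwards [hunit] with w hw
    have h1 : T w (Ring.inverse (T w) (e.symm (s w))) = e.symm (s w) :=
      congrArg (fun A : V →L[ℂ] V => A (e.symm (s w))) (Ring.mul_inverse_cancel _ hw)
    exact e.symm.injective h1

theorem exists_divisionMap_equiv {ρ : ℝ} (hρ : 0 < ρ) {d : ℕ} {g : discAlg ρ ℂ} {u : ℂ → ℂ}
    (huc : ContinuousOn u (closedBall 0 ρ)) (hud : DifferentiableOn ℂ u (ball 0 ρ))
    (hu0 : ∀ x ∈ closedBall (0 : ℂ) ρ, u x ≠ 0) (hg : ∀ x, g.1 x = (x : ℂ) ^ d * u x) :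
    ∃ e : (discAlg ρ ℂ × (Fin d → ℂ)) ≃L[ℂ] discAlg ρ ℂ,
      (e : (discAlg ρ ℂ × (Fin d → ℂ)) →L[ℂ] discAlg ρ ℂ) = divisionMap d g :=
  ⟨ContinuousLinearEquiv.ofBijective (divisionMap d g) (divisionMap_ker hρ huc hu0 hg)
    (divisionMap_range hρ huc hud hu0 hg), ContinuousLinearEquiv.coe_ofBijective _ _ _⟩

theorem analyticAt_divisionMap {ρ : ℝ} (d : ℕ) {S : W → discAlg ρ ℂ} {w : W}
    (hS : AnalyticAt ℂ S w) : AnalyticAt ℂ (fun w => divisionMap d (S w)) w :=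
  analyticAt_coprod_const (analyticAt_clm_apply (B := discAlg ρ ℂ →L[ℂ] discAlg ρ ℂ) (discMul ρ) hS) _

/-- The slices `h(w, ·)` of an analytic function depend analytically on `w`. -/
theorem exists_analyticAt_slice {h : W × ℂ → ℂ} (hh : AnalyticAt ℂ h 0) :
    ∀ᶠ ρ : ℝ in 𝓝[>] 0, ∃ S : W → discAlg ρ ℂ, AnalyticAt ℂ S 0 ∧
      ∀ᶠ w in 𝓝 0, ∀ x, (S w).1 x = h (w, x) := by
  obtain ⟨p, r, hp⟩ := hh
  obtain ⟨s, hs0, hs⟩ := ENNReal.lt_iff_exists_nnreal_btwn.1 hp.r_pos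
  have hspos : (0 : ℝ) < s := by exact_mod_cast hs0
  filter_upwards [Ioo_mem_nhdsGT hspos] with ρ hρ
  obtain ⟨S, hS⟩ := exists_analyticAt_superposition ρ hp
  -- The slice over `w` is superposition with the disc `x ↦ (w, x)`, a part linear in `w` plus the
  -- fixed disc `ι`, of norm at most `ρ < s < r`.
  let L : W →L[ℂ] discAlg ρ (W × ℂ) := LinearMap.mkContinuous
    { toFun := fun w => discMk (ContinuousMap.const _ (w, 0))
        ⟨fun _ => (w, 0), differentiableOn_const _, fun _ => rfl⟩
      map_add' := fun a b => by ext x <;> simp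
      map_smul' := fun c a => by ext x <;> simp } 1 fun w => by
        refine discAlg_norm_le (by positivity) fun x => ?_
        simp
  let ι : discAlg ρ (W × ℂ) := discMk ⟨fun x => (0, x), by fun_prop⟩
    ⟨fun x => (0, x), by fun_prop, fun _ => rfl⟩
  have hι : ‖ι‖ ≤ ρ := discAlg_norm_le hρ.1.le fun x => by
    have := mem_closedBall_zero_iff.1 x.2
    simpa [ι] using this
  have hΦ : AnalyticAt ℂ (fun w => L w + ι) 0 := (L.analyticAt _).add analyticAt_const
  have hlt : ‖L 0 + ι‖ₑ < r := by
    refine lt_trans ?_ hs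
    rw [map_zero, zero_add, ← ofReal_norm, ← ENNReal.ofReal_coe_nnreal]
    exact (ENNReal.ofReal_lt_ofReal_iff hspos).2 (hι.trans_lt hρ.2)
  refine ⟨fun w => S (L w + ι), AnalyticAt.comp (g := S) (hS _ hlt).1 hΦ, ?_⟩
  filter_upwards [hΦ.continuousAt.enorm.eventually_lt_const hlt] with w hw x
  rw [(hS _ hw).2 x]
  congr 1
  simp [L, ι]

/-- Weierstrass division by a function of order `d` in the last variable. -/
theorem exists_weierstrass_remainder {g : W × ℂ → ℂ} (hg : AnalyticAt ℂ g 0) {d : ℕ}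
    {u : ℂ → ℂ} (hu : AnalyticAt ℂ u 0) (hu0 : u 0 ≠ 0)
    (hgu : ∀ᶠ x in 𝓝 (0 : ℂ), g (0, x) = x ^ d * u x) {h : W × ℂ → ℂ} (hh : AnalyticAt ℂ h 0) :
    ∃ r : Fin d → W → ℂ, (∀ i, AnalyticAt ℂ (r i) 0) ∧
      (fun z => h z - ∑ i, r i z.1 * z.2 ^ (i : ℕ)) =O[𝓝 0] g := by
  have hsmall : ∀ᶠ x in 𝓝 (0 : ℂ), g (0, x) = x ^ d * u x ∧ AnalyticAt ℂ u x ∧ u x ≠ 0 :=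
    hgu.and (hu.eventually_analyticAt.and (hu.continuousAt.eventually_ne hu0))
  obtain ⟨ε, hε, hball⟩ := Metric.eventually_nhds_iff_ball.1 hsmall
  have hIoo : ∀ᶠ ρ in 𝓝[>] (0 : ℝ), ρ ∈ Set.Ioo 0 ε := Ioo_mem_nhdsGT hε
  obtain ⟨ρ, ⟨⟨hρ, hρε⟩, Sg, hSg, hSg'⟩, Sh, hSh, hSh'⟩ :=
    ((hIoo.and (exists_analyticAt_slice hg)).and (exists_analyticAt_slice hh)).exists
  have hsub : ∀ x ∈ closedBall (0 : ℂ) ρ, x ∈ ball (0 : ℂ) ε := fun x hx =>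
    closedBall_subset_ball hρε hx
  have huc : ContinuousOn u (closedBall 0 ρ) := fun x hx =>
    (hball x (hsub x hx)).2.1.continuousAt.continuousWithinAt
  have hud : DifferentiableOn ℂ u (ball 0 ρ) := fun x hx =>
    (hball x (hsub x (ball_subset_closedBall hx))).2.1.differentiableAt.differentiableWithinAt
  have hune : ∀ x ∈ closedBall (0 : ℂ) ρ, u x ≠ 0 := fun x hx => (hball x (hsub x hx)).2.2
  have hg0 : ∀ x, (Sg 0).1 x = (x : ℂ) ^ d * u x := fun x => by
    rw [hSg'.self_of_nhds x, (hball x (hsub x x.2)).1]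
  obtain ⟨e, he⟩ := exists_divisionMap_equiv hρ huc hud hune hg0
  -- The division operator is invertible at parameter `0`, so quotient and remainder depend
  -- analytically on `w`. Of the quotient only its local boundedness is needed: it gives the `O(g)`
  -- estimate.
  obtain ⟨sol, hsol, hsol_eq⟩ := exists_analyticAt_solution (analyticAt_divisionMap d hSg) e he hSh
  refine ⟨fun i w => (sol w).2 i, fun i => ?_, ?_⟩
  · exact ((ContinuousLinearMap.proj (R := ℂ) (φ := fun _ : Fin d => ℂ) i).comp
      (ContinuousLinearMap.snd ℂ _ _)).analyticAt _ |>.comp hsol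
  · have hb : ∀ᶠ w in 𝓝 0, ‖(sol w).1‖ < ‖(sol 0).1‖ + 1 :=
      hsol.continuousAt.fst.norm.eventually_lt_const (lt_add_one _)
    refine IsBigO.of_bound (‖(sol 0).1‖ + 1) ?_
    have hw := (continuous_fst.tendsto (0 : W × ℂ)).eventually (hSg'.and (hSh'.and (hsol_eq.and hb)))
    have hx := (continuous_snd.tendsto (0 : W × ℂ)).eventually (closedBall_mem_nhds (0 : ℂ) hρ)
    filter_upwards [hw, hx] with z ⟨h1, h2, h3, h4⟩ hz
    have h5 := congrArg (fun a : discAlg ρ ℂ => a.1 ⟨z.2, hz⟩) h3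
    simp only [divisionMap_apply, h1, h2] at h5
    rw [show h z = h (z.1, z.2) from rfl, ← h5, add_sub_cancel_right, norm_mul, mul_comm]
    gcongr
    exact (discAlg_norm_apply_le _ _).trans h4.le

end Weierstrass

/-! ### The Łojasiewicz inequality, by elimination of one variable. -/

section Lojasiewicz

open Metric Asymptotics

/-- In one variable, boundedness of a quotient implies divisibility. -/
theorem exists_eventuallyEq_mul_of_isBigO {a b : ℂ → ℂ} (ha : AnalyticAt ℂ a 0)
    (hb : AnalyticAt ℂ b 0) (h : b =O[𝓝 0] a) :
    ∃ c : ℂ → ℂ, AnalyticAt ℂ c 0 ∧ ∀ᶠ z in 𝓝 0, b z = c z * a z := by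
  by_cases hb0 : ∀ᶠ z in 𝓝 0, b z = 0
  · exact ⟨0, analyticAt_const, by filter_upwards [hb0] with z hz; simp [hz]⟩
  have ha0 : ¬ ∀ᶠ z in 𝓝 0, a z = 0 := fun ha0 => by
    obtain ⟨C, hC⟩ := h.bound
    refine hb0 ?_
    filter_upwards [hC, ha0] with z h1 h2
    simpa [h2] using h1
  obtain ⟨m, u, hu, hu0, hau⟩ := ha.exists_eventuallyEq_pow_smul_nonzero_iff.2 ha0
  obtain ⟨k, v, hv, hv0, hbv⟩ := hb.exists_eventuallyEq_pow_smul_nonzero_iff.2 hb0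
  simp only [sub_zero, smul_eq_mul] at hau hbv
  rcases le_or_gt m k with hmk | hmk
  · refine ⟨fun z => z ^ (k - m) * v z / u z, by fun_prop (disch := assumption), ?_⟩
    filter_upwards [hau, hbv, hu.continuousAt.eventually_ne hu0] with z h1 h2 h3
    rw [h1, h2]
    field_simp
    rw [mul_assoc, ← pow_add, Nat.sub_add_cancel hmk, mul_comm]
  · exfalso
    obtain ⟨C, hC⟩ := h.bound
    have h1 : ∀ᶠ z in 𝓝[≠] (0 : ℂ), ‖v z‖ ≤ C * (‖z‖ ^ (m - k) * ‖u z‖) := by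
      filter_upwards [nhdsWithin_le_nhds hau, nhdsWithin_le_nhds hbv, nhdsWithin_le_nhds hC,
        self_mem_nhdsWithin] with z h1 h2 h3 hz
      rw [h1, h2, norm_mul, norm_mul, norm_pow, norm_pow, ← Nat.add_sub_cancel' hmk.le, pow_add] at h3
      have hz' : 0 < ‖z‖ ^ k := pow_pos (norm_pos_iff.2 hz) k
      refine le_of_mul_le_mul_left ?_ hz'
      calc _ ≤ _ := h3
        _ = _ := by ring
    have h2 : Tendsto (fun z : ℂ => C * (‖z‖ ^ (m - k) * ‖u z‖)) (𝓝[≠] 0) (𝓝 0) := by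
      have : ContinuousAt (fun z : ℂ => C * (‖z‖ ^ (m - k) * ‖u z‖)) 0 := by
        have := hu.continuousAt
        fun_prop
      have h3 := this.tendsto
      simp only [norm_zero, zero_pow (Nat.sub_pos_of_lt hmk).ne', zero_mul, mul_zero] at h3
      exact h3.mono_left nhdsWithin_le_nhds
    have h3 := le_of_tendsto_of_tendsto (hv.continuousAt.norm.tendsto.mono_left nhdsWithin_le_nhds)
      h2 h1
    exact hv0 (norm_le_zero_iff.1 h3)

/-- Boundedness gives divisibility by `z ^ d`, and uniqueness of Taylor division leaves no
remainder. It shows that the lower coefficients of a Weierstrass polynomial vanish at the origin of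
the parameter space. -/
theorem coeff_eq_zero_of_isBigO_pow {d : ℕ} {c : Fin d → ℂ}
    (h : (fun z : ℂ => ∑ i, c i * z ^ (i : ℕ)) =O[𝓝 0] fun z => z ^ d) : c = 0 := by
  obtain ⟨b, hb, hbc⟩ := exists_eventuallyEq_mul_of_isBigO (by fun_prop) (by fun_prop) h
  obtain ⟨ε, hε, hball⟩ := Metric.eventually_nhds_iff_ball.1 (hbc.and hb.eventually_analyticAt)
  have hsub : closedBall (0 : ℂ) (ε / 2) ⊆ ball 0 ε := closedBall_subset_ball (by linarith)
  refine (eq_zero_of_pow_mul_add_poly (half_pos hε) d (B := fun z => -b z) c ?_ ?_).1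
  · exact fun z hz => (hball z (hsub hz)).2.continuousAt.neg.continuousWithinAt
  · intro z hz
    rw [(hball z (hsub hz)).1]
    ring

variable {W : Type*} [NormedAddCommGroup W] [NormedSpace ℂ W]

/-- The ring of functions that are analytic at the origin. -/
def analyticSubring (W : Type*) [NormedAddCommGroup W] [NormedSpace ℂ W] : Subring (W → ℂ) where
  carrier := {r | AnalyticAt ℂ r 0}
  mul_mem' := fun ha hb => ha.mul hb
  one_mem' := analyticAt_const
  add_mem' := fun ha hb => ha.add hb
  zero_mem' := analyticAt_const
  neg_mem' := fun ha => ha.neg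

/-- Evaluation at a point. -/
def analyticEval (w : W) : analyticSubring W →+* ℂ :=
  (Pi.evalRingHom (fun _ : W => ℂ) w).comp (analyticSubring W).subtype

theorem analyticEval_apply (w : W) (r : analyticSubring W) : analyticEval w r = r.1 w := rfl

theorem analyticAt_eval₂ (a : Polynomial (analyticSubring W)) :
    AnalyticAt ℂ (fun z : W × ℂ => a.eval₂ (analyticEval z.1) z.2) 0 := by
  simp only [Polynomial.eval₂_eq_sum_range, analyticEval_apply]
  refine Finset.analyticAt_fun_sum _ fun i _ => ?_
  have h : AnalyticAt ℂ (a.coeff i).1 (0 : W × ℂ).1 := (a.coeff i).2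
  exact (h.comp analyticAt_fst).mul (analyticAt_snd.pow i)

open Polynomial in
/-- The polynomial with analytic coefficients `r`. -/
def analyticPoly {d : ℕ} (r : Fin d → W → ℂ) (hr : ∀ i, AnalyticAt ℂ (r i) 0) :
    Polynomial (analyticSubring W) :=
  ∑ i : Fin d, C ⟨r i, hr i⟩ * X ^ (i : ℕ)

theorem eval₂_analyticPoly {d : ℕ} (r : Fin d → W → ℂ) (hr : ∀ i, AnalyticAt ℂ (r i) 0) (w : W)
    (ζ : ℂ) : (analyticPoly r hr).eval₂ (analyticEval w) ζ = ∑ i, r i w * ζ ^ (i : ℕ) := by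
  simp [analyticPoly, Polynomial.eval₂_finsetSum, analyticEval_apply]

theorem degree_analyticPoly_lt {d : ℕ} (r : Fin d → W → ℂ) (hr : ∀ i, AnalyticAt ℂ (r i) 0) :
    (analyticPoly r hr).degree < d := Polynomial.degree_sum_fin_lt _

-- For monic `p` the resultant is the product of the values of `h` at the roots of `p`. The formal
-- degrees are explicit because resultants with fixed formal degrees commute with specialisation of
-- the coefficients.
open Polynomial in
theorem exists_root_of_resultant_eq_zero {p h : ℂ[X]} {d n : ℕ} (hp : p.Monic)
    (hpd : p.natDegree = d) (hh : h.natDegree ≤ n) (h0 : p.resultant h d n = 0) :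
    ∃ ζ ∈ p.roots.toFinset, h.eval ζ = 0 := by
  subst hpd
  rw [resultant_eq_prod_eval _ _ _ hh (IsAlgClosed.splits p), hp.leadingCoeff, one_pow, one_mul,
    Multiset.prod_eq_zero_iff, Multiset.mem_map] at h0
  obtain ⟨ζ, hζ, h1⟩ := h0
  exact ⟨ζ, Multiset.mem_toFinset.2 hζ, h1⟩

open Polynomial in
/-- If `p` has a common root with sufficiently many members of the pencil `∑ t ^ k h_k`, then all
the `h_k` vanish at some root of `p`. -/
theorem exists_common_root {p : ℂ[X]} {d m : ℕ} (hpd : p.natDegree ≤ d) (h : Fin m → ℂ[X])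
    (hroot : ∀ t : Fin (d * m + 1), ∃ ζ ∈ p.roots.toFinset,
      (∑ k : Fin m, (t : ℂ[X]) ^ (k : ℕ) * h k).eval ζ = 0) :
    ∃ ζ ∈ p.roots.toFinset, ∀ k, (h k).eval ζ = 0 := by
  classical
  choose ζ hζ hζ0 using hroot
  -- Pigeonhole: `p` has at most `d` roots, so among `d * m + 1` parameters more than `m` share a
  -- root `ξ`. The polynomial `q` in the parameter, of formal degree below `m`, then has too many
  -- zeros.
  have hcard : p.roots.toFinset.card * m < (Finset.univ : Finset (Fin (d * m + 1))).card := by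
    rw [Finset.card_univ, Fintype.card_fin, Nat.lt_succ_iff]
    exact Nat.mul_le_mul_right _ ((Multiset.toFinset_card_le _).trans ((card_roots' p).trans hpd))
  obtain ⟨ξ, hξ, hlt⟩ := Finset.exists_lt_card_fiber_of_mul_lt_card_of_maps_to
    (f := ζ) (fun t _ => hζ t) hcard
  refine ⟨ξ, hξ, ?_⟩
  let q : ℂ[X] := ∑ k : Fin m, C ((h k).eval ξ) * X ^ (k : ℕ)
  have hq : q = 0 := by
    refine eq_zero_of_natDegree_lt_card_of_eval_eq_zero' q
      ((Finset.univ.filter fun t => ζ t = ξ).image fun t : Fin (d * m + 1) => ((t : ℕ) : ℂ)) ?_ ?_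
    · intro x hx
      obtain ⟨t, ht, rfl⟩ := Finset.mem_image.1 hx
      have h1 := hζ0 t
      rw [(Finset.mem_filter.1 ht).2] at h1
      simp only [eval_finsetSum, eval_mul, eval_pow, eval_natCast] at h1
      simp only [q, eval_finsetSum, eval_mul, eval_C, eval_pow, eval_X]
      rw [← h1]
      exact Finset.sum_congr rfl fun k _ => mul_comm _ _
    · rw [Finset.card_image_of_injective _ fun a b hab => Fin.ext (Nat.cast_injective hab)]
      refine lt_of_le_of_lt ?_ hlt
      refine natDegree_le_of_degree_le (degree_sum_fin_lt _).le
  intro k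
  have := congrArg (fun q => q.coeff (k : ℕ)) hq
  simpa [q, finsetSum_coeff, coeff_C_mul, coeff_X_pow, Fin.val_inj] using this

/-- The equation gives `‖ζ‖ ^ d ≤ d η max(1, ‖ζ‖ ^ d)`, which is impossible if `‖ζ‖ ≥ δ`. This keeps
the roots found by elimination inside the ball where the common zero is isolated. -/
theorem norm_root_lt {d : ℕ} {c : Fin d → ℂ} {ζ : ℂ} (h : ζ ^ d = ∑ i, c i * ζ ^ (i : ℕ)) {η δ : ℝ}
    (hδ : 0 < δ) (hδ1 : δ ≤ 1) (hc : ∀ i, ‖c i‖ ≤ η) (hη : d * η < δ ^ d) : ‖ζ‖ < δ := by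
  by_contra! hζ
  have h1 : ‖ζ‖ ^ d ≤ d * η * max 1 (‖ζ‖ ^ d) := by
    rw [← norm_pow, h]
    refine (norm_sum_le _ _).trans ?_
    have : ∀ i ∈ (Finset.univ : Finset (Fin d)), ‖c i * ζ ^ (i : ℕ)‖ ≤ η * max 1 (‖ζ ^ d‖) := by
      intro i _
      rw [norm_mul, norm_pow, norm_pow]
      have h2 : ‖ζ‖ ^ (i : ℕ) ≤ max 1 (‖ζ‖ ^ d) := by
        rcases le_total ‖ζ‖ 1 with h1 | h1
        · exact le_max_of_le_left (pow_le_one₀ (norm_nonneg _) h1)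
        · exact le_max_of_le_right (pow_le_pow_right₀ h1 i.2.le)
      exact mul_le_mul (hc i) h2 (by positivity) ((norm_nonneg _).trans (hc i))
    refine (Finset.sum_le_sum this).trans ?_
    rw [← h]
    simp [mul_assoc]
  have h3 : δ ^ d ≤ ‖ζ‖ ^ d := pow_le_pow_left₀ hδ.le hζ d
  have h4 : δ ^ d ≤ 1 := pow_le_one₀ hδ.le hδ1
  rcases le_total (‖ζ‖ ^ d) 1 with h5 | h5
  · rw [max_eq_left h5] at h1
    linarith
  · rw [max_eq_right h5] at h1
    nlinarith

open Polynomial in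
/-- Inductive step of the Łojasiewicz inequality. -/
theorem exists_lojasiewicz_prod
    (ih : ∀ (m : ℕ) (g : Fin m → W → ℂ), (∀ k, AnalyticAt ℂ (g k) 0) →
      (∀ᶠ z in 𝓝 0, (∀ k, g k z = 0) → z = 0) →
      ∃ N, 1 ≤ N ∧ (fun z => ‖z‖ ^ N) =O[𝓝 0] fun z => ∑ k, ‖g k z‖)
    (m : ℕ) (g : Fin m → W × ℂ → ℂ) (hg : ∀ k, AnalyticAt ℂ (g k) 0)
    (hiso : ∀ᶠ z in 𝓝 0, (∀ k, g k z = 0) → z = 0) :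
    ∃ N, 1 ≤ N ∧ (fun z => ‖z‖ ^ N) =O[𝓝 0] fun z => ∑ k, ‖g k z‖ := by
  have hline : Tendsto (fun ζ : ℂ => ((0 : W), ζ)) (𝓝 0) (𝓝 0) :=
    (Continuous.prodMk_right (0 : W)).tendsto 0
  have hfst : Tendsto (fun z : W × ℂ => z.1) (𝓝 0) (𝓝 0) := continuous_fst.tendsto (0 : W × ℂ)
  -- some member of the family does not vanish on the last axis
  obtain ⟨k₀, hk₀⟩ : ∃ k, ¬ ∀ᶠ ζ in 𝓝 (0 : ℂ), g k (0, ζ) = 0 := by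
    by_contra! hall
    have h1 := (eventually_all.2 hall).and (hline.eventually hiso)
    have h2 : ∀ᶠ ζ in 𝓝[≠] (0 : ℂ), False := by
      filter_upwards [nhdsWithin_le_nhds h1, self_mem_nhdsWithin] with ζ h hζ
      exact hζ (congrArg Prod.snd (h.2 h.1))
    exact h2.exists.elim fun _ h => h
  have hslice : AnalyticAt ℂ (fun ζ : ℂ => g k₀ (0, ζ)) 0 :=
    AnalyticAt.comp (g := g k₀) (f := fun ζ : ℂ => ((0 : W), ζ)) (hg k₀)
      (analyticAt_const.prod analyticAt_id)
  obtain ⟨d, u, hu, hu0, hgu⟩ := hslice.exists_eventuallyEq_pow_smul_nonzero_iff.2 hk₀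
  simp only [sub_zero, smul_eq_mul] at hgu
  -- Division of `ζ ^ d` by `g k₀` produces the Weierstrass polynomial `p`, in the weak form `p =
  -- O(g k₀)`.
  obtain ⟨r, hr, hrO⟩ := exists_weierstrass_remainder (hg k₀) hu hu0 hgu
    (h := fun z => z.2 ^ d) (analyticAt_snd.pow d)
  set p : W × ℂ → ℂ := fun z => z.2 ^ d - ∑ i, r i z.1 * z.2 ^ (i : ℕ) with hp
  have hr0 : (fun i => r i 0) = 0 := by
    refine coeff_eq_zero_of_isBigO_pow ?_
    have h1 := hrO.comp_tendsto hline
    have h2 : ((g k₀) ∘ fun ζ : ℂ => ((0 : W), ζ)) =O[𝓝 0] fun ζ : ℂ => ζ ^ d := by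
      have h3 : (fun ζ => ζ ^ d * u ζ) =O[𝓝 0] fun ζ : ℂ => ζ ^ d * 1 :=
        (isBigO_refl _ _).mul (hu.continuousAt.isBigO_one ℂ)
      simp only [mul_one] at h3
      exact h3.congr' (hgu.mono fun ζ h => h.symm) (Eventually.of_forall fun _ => rfl)
    have h4 := (isBigO_refl (fun ζ : ℂ => ζ ^ d) (𝓝 0)).sub (h1.trans h2)
    refine h4.congr_left fun ζ => ?_
    simp [hp]
  have hpan : AnalyticAt ℂ p 0 := by
    refine (analyticAt_snd.pow d).sub (Finset.analyticAt_fun_sum _ fun i _ => ?_)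
    have h : AnalyticAt ℂ (r i) (0 : W × ℂ).1 := hr i
    exact (h.comp analyticAt_fst).mul (analyticAt_snd.pow i)
  have hp0 : ∀ᶠ ζ in 𝓝 (0 : ℂ), p (0, ζ) = ζ ^ d * 1 := Eventually.of_forall fun ζ => by
    simp [hp, fun i => congrFun hr0 i]
  -- Modulo `p` every `g k` becomes a polynomial `R k` in `ζ` of degree below `d`; since `p = O(S)`,
  -- these remainders are `O(S)` too.
  choose R hR hRO using fun k => exists_weierstrass_remainder hpan analyticAt_const
    (one_ne_zero (α := ℂ)) hp0 (hg k)
  set S : W × ℂ → ℝ := fun z => ∑ k, ‖g k z‖ with hS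
  have hgS : ∀ k, g k =O[𝓝 0] S := fun k => IsBigO.of_bound 1 <| Eventually.of_forall fun z => by
    have h1 : ‖g k z‖ ≤ S z := Finset.single_le_sum (f := fun k => ‖g k z‖)
      (fun _ _ => norm_nonneg _) (Finset.mem_univ k)
    rw [one_mul, Real.norm_eq_abs]
    exact h1.trans (le_abs_self _)
  have hpS : p =O[𝓝 0] S := hrO.trans (hgS k₀)
  have hRS : ∀ k, (fun z : W × ℂ => ∑ i, R k i z.1 * z.2 ^ (i : ℕ)) =O[𝓝 0] S := fun k =>
    ((hgS k).sub ((hRO k).trans hpS)).congr_left fun z => by ring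
  -- elimination of the last variable
  let P : (analyticSubring W)[X] := X ^ d - analyticPoly r hr
  let H : Fin m → (analyticSubring W)[X] := fun k => analyticPoly (R k) (hR k)
  let Ht : Fin (d * m + 1) → (analyticSubring W)[X] := fun t =>
    ∑ k : Fin m, (t : (analyticSubring W)[X]) ^ (k : ℕ) * H k
  have hPdeg : P.natDegree ≤ d := by
    refine natDegree_le_of_degree_le ((degree_sub_le _ _).trans (max_le (degree_X_pow_le _) ?_))
    exact (degree_analyticPoly_lt r hr).le
  have hHdeg : ∀ k, (H k).natDegree ≤ d := fun k =>
    natDegree_le_of_degree_le (degree_analyticPoly_lt (R k) (hR k)).le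
  have hHtdeg : ∀ t, (Ht t).natDegree ≤ d := fun t => by
    refine natDegree_sum_le_of_forall_le _ _ fun k _ => ?_
    rw [← Nat.cast_pow, ← C_eq_natCast]
    exact (natDegree_C_mul_le _ _).trans (hHdeg k)
  -- The formal degree `d + 1` of the second polynomial is never zero, so the Bézout identity for
  -- the resultant is available even for `d = 0`.
  let res : Fin (d * m + 1) → analyticSubring W := fun t => P.resultant (Ht t) d (d + 1)
  have hPeval : ∀ z : W × ℂ, P.eval₂ (analyticEval z.1) z.2 = p z := fun z => by
    simp [P, hp, eval₂_analyticPoly]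
  have hHteval : ∀ (t) (z : W × ℂ), (Ht t).eval₂ (analyticEval z.1) z.2 =
      ∑ k : Fin m, ((t : ℕ) : ℂ) ^ (k : ℕ) * ∑ i, R k i z.1 * z.2 ^ (i : ℕ) := fun t z => by
    simp [Ht, H, eval₂_finsetSum, eval₂_analyticPoly, eval₂_mul, eval₂_pow]
  have hresS : ∀ t, (fun z : W × ℂ => (res t).1 z.1) =O[𝓝 0] S := by
    intro t
    -- The resultant is a combination of `P` and `Ht t` with locally bounded coefficients, and both
    -- of these are `O(S)`.
    obtain ⟨a, b, -, -, hab⟩ := exists_mul_add_mul_eq_C_resultant P (Ht t) hPdeg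
      ((hHtdeg t).trans d.le_succ) (Or.inr d.succ_ne_zero)
    have h1 : ∀ z : W × ℂ, (res t).1 z.1 = a.eval₂ (analyticEval z.1) z.2 * p z +
        b.eval₂ (analyticEval z.1) z.2 *
          ∑ k : Fin m, ((t : ℕ) : ℂ) ^ (k : ℕ) * ∑ i, R k i z.1 * z.2 ^ (i : ℕ) := by
      intro z
      have := congrArg (fun q => q.eval₂ (analyticEval z.1) z.2) hab
      simp only [eval₂_add, eval₂_mul, hPeval, hHteval, eval₂_C] at this
      rw [mul_comm (a.eval₂ _ _), mul_comm (b.eval₂ _ _), this]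
      rfl
    have hbdd : ∀ c : (analyticSubring W)[X],
        (fun z : W × ℂ => c.eval₂ (analyticEval z.1) z.2) =O[𝓝 0] fun _ => (1 : ℝ) := fun c =>
      (analyticAt_eval₂ c).continuousAt.isBigO_one ℝ
    have h2 : (fun z : W × ℂ => ∑ k : Fin m, ((t : ℕ) : ℂ) ^ (k : ℕ) *
        ∑ i, R k i z.1 * z.2 ^ (i : ℕ)) =O[𝓝 0] S :=
      IsBigO.fun_sum fun k _ => (hRS k).const_mul_left _
    have h3 := ((hbdd a).mul hpS).add ((hbdd b).mul h2)
    simp only [one_mul] at h3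
    exact h3.congr_left fun z => (h1 z).symm
  -- If all resultants vanish at a small `w`, then `p(w, ·)` and all `R k` share a root `ζ`, which
  -- is small. As `g k - R k = O(p)`, all `g k` vanish at `(w, ζ)`, so `w = 0` by isolation.
  have hresiso : ∀ᶠ w in 𝓝 (0 : W), (∀ t, (res t).1 w = 0) → w = 0 := by
    choose c hc using fun k => (hRO k).bound
    obtain ⟨ε, hε, hball⟩ := Metric.eventually_nhds_iff_ball.1 (hiso.and (eventually_all.2 hc))
    set δ := min ε 1 with hδ
    have hδ0 : 0 < δ := lt_min hε one_pos
    obtain ⟨η, hη0, hη⟩ : ∃ η > 0, (d : ℝ) * η < δ ^ d := by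
      refine ⟨δ ^ d / (d + 1), by positivity, ?_⟩
      rw [mul_div_assoc', div_lt_iff₀ (by positivity), mul_comm]
      gcongr
      exact lt_add_one _
    have hrsmall : ∀ᶠ w in 𝓝 (0 : W), ∀ i, ‖r i w‖ < η := eventually_all.2 fun i => by
      refine (hr i).continuousAt.norm.eventually_lt_const ?_
      simpa [congrFun hr0 i] using hη0
    filter_upwards [hrsmall, ball_mem_nhds (0 : W) hδ0] with w hrw hw hres
    have hPw : P.map (analyticEval w) = X ^ d - ∑ i : Fin d, C (r i w) * X ^ (i : ℕ) := by
      simp [P, analyticPoly, Polynomial.map_sum, analyticEval_apply]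
    have hlt : (∑ i : Fin d, C (r i w) * X ^ (i : ℕ)).degree < (d : WithBot ℕ) :=
      degree_sum_fin_lt _
    have hmonic : (P.map (analyticEval w)).Monic := hPw ▸ monic_X_pow_sub hlt
    have hdeg : (P.map (analyticEval w)).natDegree = d := by
      rw [hPw]
      refine natDegree_eq_of_degree_eq_some ?_
      rw [degree_sub_eq_left_of_degree_lt (by rwa [degree_X_pow]), degree_X_pow]
    obtain ⟨ζ, hζ, hζH⟩ := exists_common_root hdeg.le (fun k => (H k).map (analyticEval w))
      fun t => by
        have h1 : (P.map (analyticEval w)).resultant ((Ht t).map (analyticEval w)) d (d + 1) = 0 := by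
          rw [resultant_map_map]
          exact hres t
        have h2 := exists_root_of_resultant_eq_zero hmonic hdeg
          (natDegree_map_le.trans ((hHtdeg t).trans d.le_succ)) h1
        simpa [Ht, Polynomial.map_sum] using h2
    have hpz : p (w, ζ) = 0 := by
      rw [← hPeval, ← eval_map]
      exact (mem_roots'.1 (Multiset.mem_toFinset.1 hζ)).2
    have hζδ : ‖ζ‖ < δ := norm_root_lt (sub_eq_zero.1 hpz) hδ0 (min_le_right _ _)
      (fun i => (hrw i).le) hη
    have hmem : (w, ζ) ∈ ball (0 : W × ℂ) ε := by
      rw [mem_ball_zero_iff, Prod.norm_def]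
      exact (max_lt (mem_ball_zero_iff.1 hw) hζδ).trans_le (min_le_left _ _)
    obtain ⟨h1, h2⟩ := hball _ hmem
    refine congrArg Prod.fst (h1 fun k => ?_)
    have h3 := h2 k
    have h4 := hζH k
    rw [eval_map, eval₂_analyticPoly] at h4
    simpa [hpz, h4] using h3
  obtain ⟨N, hN, hNO⟩ := ih (d * m + 1) (fun t => (res t).1) (fun t => (res t).2) hresiso
  -- the final estimate
  have hwS : (fun z : W × ℂ => ‖z.1‖ ^ N) =O[𝓝 0] S := by
    refine (hNO.comp_tendsto hfst).trans (IsBigO.fun_sum fun t _ => ?_)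
    exact (hresS t).norm_left
  have hSbdd : S =O[𝓝 0] fun _ => (1 : ℝ) := by
    have : ContinuousAt S 0 := by
      have := fun k => (hg k).continuousAt
      fun_prop
    exact this.isBigO_one ℝ
  have hS_pow : ∀ M, 1 ≤ M → (fun z => S z ^ M) =O[𝓝 0] S := fun M hM => by
    obtain ⟨M, rfl⟩ := Nat.exists_eq_add_of_le hM
    have := (isBigO_refl S (𝓝 0)).mul (hSbdd.pow M)
    simpa [pow_add] using this
  have hrw : ∀ i, (fun z : W × ℂ => r i z.1 * z.2 ^ (i : ℕ)) =O[𝓝 0] fun z => ‖z.1‖ := fun i => by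
    have h1 : (r i) =O[𝓝 0] fun w : W => ‖w‖ := by
      have := (hr i).differentiableAt.isBigO_sub
      simpa [congrFun hr0 i] using this.norm_right
    have h2 : (fun z : W × ℂ => z.2 ^ (i : ℕ)) =O[𝓝 0] fun _ => (1 : ℝ) :=
      (continuous_snd.pow i).continuousAt.isBigO_one ℝ
    simpa using (h1.comp_tendsto hfst).mul h2
  have hsum : (fun z : W × ℂ => ∑ i, r i z.1 * z.2 ^ (i : ℕ)) =O[𝓝 0] fun z => ‖z.1‖ :=
    IsBigO.fun_sum fun i _ => hrw i
  -- From `ζ ^ d = p + ∑ r_i ζ ^ i` and `r_i(0) = 0` follows `ζ ^ d = O(S + ‖w‖)`; the `N`-th power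
  -- turns `‖w‖` into `O(S)`.
  have hζ : (fun z : W × ℂ => z.2 ^ (d * N)) =O[𝓝 0] S := by
    have h1 : (fun z : W × ℂ => z.2 ^ d) =O[𝓝 0] fun z => ‖S z‖ + ‖‖z.1‖‖ := by
      refine (hpS.add_add hsum).congr_left fun z => ?_
      simp [hp]
    have h2 := h1.pow N
    simp only [← pow_mul, norm_norm] at h2
    refine h2.trans ?_
    refine IsBigO.trans (IsBigO.of_bound (2 ^ (N - 1)) (Eventually.of_forall fun z => ?_))
      ((hS_pow N hN).add hwS)
    have h3 : 0 ≤ S z := Finset.sum_nonneg fun _ _ => norm_nonneg _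
    rw [Real.norm_eq_abs, Real.norm_eq_abs, Real.norm_eq_abs, abs_of_nonneg h3,
      abs_of_nonneg (by positivity), abs_of_nonneg (by positivity)]
    exact add_pow_le h3 (norm_nonneg _) N
  -- `N * (d + 1)` is at least both `N`, which serves `w`, and `d * N`, which serves `ζ`.
  refine ⟨N * (d + 1), by nlinarith, ?_⟩
  have hw1 : (fun z : W × ℂ => ‖z.1‖ ^ (N * (d + 1))) =O[𝓝 0] S := by
    simp only [pow_mul]
    exact (hwS.pow (d + 1)).trans (hS_pow _ (by lia))
  have hζ1 : (fun z : W × ℂ => ‖z.2‖ ^ (N * (d + 1))) =O[𝓝 0] S := by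
    have h1 : (fun z : W × ℂ => z.2 ^ N) =O[𝓝 0] fun _ => (1 : ℝ) :=
      (continuous_snd.pow N).continuousAt.isBigO_one ℝ
    have h2 := (hζ.mul h1).norm_left
    simp only [mul_one, ← pow_add, norm_pow] at h2
    refine h2.congr_left fun z => ?_
    ring_nf
  refine IsBigO.trans (IsBigO.of_bound 1 (Eventually.of_forall fun z => ?_)) (hw1.add hζ1)
  rw [Real.norm_eq_abs, Real.norm_eq_abs, abs_of_nonneg (by positivity),
    abs_of_nonneg (by positivity), one_mul, Prod.norm_def]
  rcases max_choice ‖z.1‖ ‖z.2‖ with h | h <;> rw [h]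
  · exact le_add_of_nonneg_right (by positivity)
  · exact le_add_of_nonneg_left (by positivity)

/-- The Łojasiewicz inequality for a finite family of functions whose only common zero is the
origin. -/
theorem exists_lojasiewicz (n : ℕ) (m : ℕ) (g : Fin m → (Fin n → ℂ) → ℂ)
    (hg : ∀ k, AnalyticAt ℂ (g k) 0) (hiso : ∀ᶠ z in 𝓝 0, (∀ k, g k z = 0) → z = 0) :
    ∃ N, 1 ≤ N ∧ (fun z => ‖z‖ ^ N) =O[𝓝 0] fun z => ∑ k, ‖g k z‖ := by
  induction n generalizing m with
  | zero =>
    refine ⟨1, le_rfl, IsBigO.of_bound 1 (Eventually.of_forall fun z => ?_)⟩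
    rw [Subsingleton.elim z 0, norm_zero]
    simp only [pow_one, norm_zero]
    positivity
  | succ n ih =>
    let e : ((Fin n → ℂ) × ℂ) ≃L[ℂ] (Fin (n + 1) → ℂ) :=
      (ContinuousLinearEquiv.prodComm ℂ (Fin n → ℂ) ℂ).trans
        (Fin.consEquivL ℂ (fun _ : Fin (n + 1) => ℂ))
    have he : Tendsto e (𝓝 0) (𝓝 0) := by simpa using e.continuous.tendsto 0
    have hes : Tendsto e.symm (𝓝 0) (𝓝 0) := by simpa using e.symm.continuous.tendsto 0
    obtain ⟨N, hN, h⟩ := exists_lojasiewicz_prod (W := Fin n → ℂ) (fun m g => ih m g) m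
      (fun k z => g k (e z)) (fun k => by
        refine AnalyticAt.comp (g := g k) ?_ (e.toContinuousLinearMap.analyticAt 0)
        simpa using hg k) (by
        filter_upwards [he.eventually hiso] with z hz h
        exact (map_eq_zero_iff e e.injective).1 (hz h))
    refine ⟨N, hN, ?_⟩
    have h1 := h.comp_tendsto hes
    have h2 : (fun z => ‖z‖ ^ N) =O[𝓝 0] fun z => ‖e.symm z‖ ^ N := by
      have : (fun z : Fin (n + 1) → ℂ => z) =O[𝓝 0] fun z => e.symm z := by
        simpa using (e.toContinuousLinearMap.isBigO_comp e.symm (𝓝 0))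
      exact (this.norm_norm).pow N
    refine h2.trans (h1.congr_right fun z => ?_)
    simp

end Lojasiewicz

/-! ### Local rings, stalks and integral closures. -/

section LocRingBasics

open Asymptotics

variable {E : Type*} [NormedAddCommGroup E] [NormedSpace ℂ E]
variable {E' : Type*} [NormedAddCommGroup E'] [NormedSpace ℂ E']
variable {ι : Type*}

theorem exists_eq_toGerm {Y : Set E} {y : E} (g : LocRing Y y) :
    ∃ (F : E → ℂ) (hF : AnalyticAt ℂ F y), g = toGerm Y F hF := by
  obtain ⟨_, F, hF, rfl⟩ := g
  exact ⟨F, hF, rfl⟩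

theorem toGerm_eq_iff {Y : Set E} {y : E} {F G : E → ℂ} (hF : AnalyticAt ℂ F y)
    (hG : AnalyticAt ℂ G y) : toGerm Y F hF = toGerm Y G hG ↔ F =ᶠ[𝓝[Y] y] G :=
  Subtype.ext_iff.trans Germ.coe_eq

theorem toGerm_eq_zero_iff {Y : Set E} {y : E} {F : E → ℂ} (hF : AnalyticAt ℂ F y) :
    toGerm Y F hF = 0 ↔ ∀ᶠ p in 𝓝[Y] y, F p = 0 :=
  toGerm_eq_iff hF analyticAt_const

theorem toGerm_add {Y : Set E} {y : E} {F G : E → ℂ} (hF : AnalyticAt ℂ F y)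
    (hG : AnalyticAt ℂ G y) :
    toGerm Y (fun z => F z + G z) (hF.add hG) = toGerm Y F hF + toGerm Y G hG := rfl

theorem toGerm_sub {Y : Set E} {y : E} {F G : E → ℂ} (hF : AnalyticAt ℂ F y)
    (hG : AnalyticAt ℂ G y) :
    toGerm Y (fun z => F z - G z) (hF.sub hG) = toGerm Y F hF - toGerm Y G hG := by
  rw [sub_eq_add_neg]
  exact (toGerm_eq_iff _ (hF.add hG.neg)).2 (Eventually.of_forall fun z => sub_eq_add_neg _ _)

theorem toGerm_mul {Y : Set E} {y : E} {F G : E → ℂ} (hF : AnalyticAt ℂ F y)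
    (hG : AnalyticAt ℂ G y) :
    toGerm Y (fun z => F z * G z) (hF.mul hG) = toGerm Y F hF * toGerm Y G hG := rfl

theorem toGerm_sum {Y : Set E} {y : E} {κ : Type*} (s : Finset κ) {F : κ → E → ℂ}
    (hF : ∀ k, AnalyticAt ℂ (F k) y) :
    toGerm Y (fun z => ∑ k ∈ s, F k z) (Finset.analyticAt_fun_sum _ fun k _ => hF k) =
      ∑ k ∈ s, toGerm Y (F k) (hF k) := by
  classical
  induction s using Finset.induction_on with
  | empty => exact (toGerm_eq_zero_iff _).2 (Eventually.of_forall fun z => Finset.sum_empty)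
  | insert a s ha ih =>
    rw [Finset.sum_insert ha, ← ih, ← toGerm_add]
    exact (toGerm_eq_iff _ _).2 (Eventually.of_forall fun z => Finset.sum_insert ha)

theorem IsMapGerm.analyticAt_comp {Y' : Set E'} {y' : E'} {Y : Set E} {y : E} {φ : E' → E}
    (hφ : IsMapGerm Y' y' Y y φ) {F : E → ℂ} (hF : AnalyticAt ℂ F y) :
    AnalyticAt ℂ (fun t => F (φ t)) y' :=
  AnalyticAt.comp (g := F) (by rw [hφ.map_point]; exact hF) hφ.analyticAt

theorem isUnit_toGerm {Y : Set E} {y : E} {F : E → ℂ} (hF : AnalyticAt ℂ F y) (h : F y ≠ 0) :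
    IsUnit (toGerm Y F hF) := by
  refine IsUnit.of_mul_eq_one (toGerm Y (fun z => (F z)⁻¹) (hF.inv h)) ?_
  rw [← toGerm_mul]
  refine (toGerm_eq_iff _ analyticAt_const).2 (nhdsWithin_le_nhds ?_)
  filter_upwards [hF.continuousAt.eventually_ne h] with z hz using mul_inv_cancel₀ hz

/-- In `𝒪_1`, an element bounded by a finite family lies in the ideal generated by it. -/
theorem toGerm_mem_span_of_isBigO {κ : Type*} [Fintype κ] {a : κ → ℂ → ℂ}
    (ha : ∀ k, AnalyticAt ℂ (a k) 0) {b : ℂ → ℂ} (hb : AnalyticAt ℂ b 0)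
    (h : b =O[𝓝 0] fun t => ∑ k, ‖a k t‖) :
    toGerm Set.univ b hb ∈ Ideal.span (Set.range fun k => toGerm Set.univ (a k) (ha k)) := by
  by_cases h0 : ∀ k, ∀ᶠ t in 𝓝 0, a k t = 0
  · have : toGerm Set.univ b hb = 0 := by
      refine (toGerm_eq_zero_iff _).2 (nhdsWithin_le_nhds ?_)
      obtain ⟨C, hC⟩ := h.bound
      filter_upwards [hC, eventually_all.2 h0] with t h1 h2
      simpa [h2] using h1
    rw [this]
    exact Ideal.zero_mem _
  · rw [not_forall] at h0
    obtain ⟨k₁, hk₁⟩ := h0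
    have : Nonempty κ := ⟨k₁⟩
    -- A member of least vanishing order dominates the whole family, so `b` is bounded by it alone
    -- and hence divisible by it.
    obtain ⟨k₀, hk₀⟩ := Finite.exists_min fun k => analyticOrderAt (a k) 0
    have hne : analyticOrderAt (a k₀) 0 ≠ ⊤ := fun htop => hk₁ (by
      have := hk₀ k₁
      rw [htop, top_le_iff] at this
      exact analyticOrderAt_eq_top.1 this)
    obtain ⟨u, hu, hu0, hau⟩ := (ha k₀).analyticOrderAt_ne_top.1 hne
    set m := analyticOrderNatAt (a k₀) 0 with hm
    simp only [sub_zero, smul_eq_mul] at hau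
    have hpow : (fun t : ℂ => t ^ m) =O[𝓝 0] a k₀ := by
      have h1 : (fun t : ℂ => t ^ m * u t * (u t)⁻¹) =O[𝓝 0] fun t => t ^ m * u t * 1 :=
        (isBigO_refl _ _).mul ((hu.inv hu0).continuousAt.isBigO_one ℂ)
      refine h1.congr' ?_ ?_
      · filter_upwards [hu.continuousAt.eventually_ne hu0] with t ht
        field_simp
      · filter_upwards [hau] with t ht
        rw [ht, mul_one]
    have hak : ∀ k, a k =O[𝓝 0] a k₀ := fun k => by
      have h1 : (m : ℕ∞) ≤ analyticOrderAt (a k) 0 := by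
        rw [hm, Nat.cast_analyticOrderNatAt hne]
        exact hk₀ k
      obtain ⟨g, hg, hgk⟩ := (natCast_le_analyticOrderAt (ha k)).1 h1
      simp only [sub_zero, smul_eq_mul] at hgk
      refine IsBigO.trans ?_ hpow
      have h2 : (fun t : ℂ => t ^ m * g t) =O[𝓝 0] fun t => t ^ m * (1 : ℂ) :=
        (isBigO_refl _ _).mul (hg.continuousAt.isBigO_one ℂ)
      simp only [mul_one] at h2
      exact h2.congr' (hgk.mono fun _ h => h.symm) (Eventually.of_forall fun _ => rfl)
    have hbk : b =O[𝓝 0] a k₀ := h.trans (IsBigO.fun_sum fun k _ => (hak k).norm_left)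
    obtain ⟨c, hc, hbc⟩ := exists_eventuallyEq_mul_of_isBigO (ha k₀) hb hbk
    have : toGerm Set.univ b hb = toGerm Set.univ c hc * toGerm Set.univ (a k₀) (ha k₀) :=
      (toGerm_eq_iff _ (hc.mul (ha k₀))).2 (nhdsWithin_le_nhds hbc)
    rw [this]
    exact Ideal.mul_mem_left _ _ (Ideal.subset_span ⟨k₀, rfl⟩)

theorem isGermOf_toGerm {Y : Set E} {p : E} {F : ι → E → ℂ} (hF : ∀ i, AnalyticAt ℂ (F i) p) :
    IsGermOf (fun i => toGerm Y (F i) (hF i)) F := fun _ => rfl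

theorem IsGermOf.eq_toGerm {Y : Set E} {p : E} {g : ι → LocRing Y p} {F : ι → E → ℂ}
    (h : IsGermOf g F) (hF : ∀ i, AnalyticAt ℂ (F i) p) : g = fun i => toGerm Y (F i) (hF i) :=
  funext fun i => Subtype.ext (h i)

theorem IsGermOf.unique {Y : Set E} {p : E} {g g' : ι → LocRing Y p} {F : ι → E → ℂ}
    (h : IsGermOf g F) (h' : IsGermOf g' F) : g = g' :=
  funext fun i => Subtype.ext ((h i).trans (h' i).symm)

theorem exists_isGermOf {Y : Set E} {p : E} (g : ι → LocRing Y p) :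
    ∃ F : ι → E → ℂ, (∀ i, AnalyticAt ℂ (F i) p) ∧ IsGermOf g F := by
  choose F hF h using fun i => exists_eq_toGerm (g i)
  exact ⟨F, hF, fun i => by rw [h i]; rfl⟩

theorem IsGermOf.eventuallyEq {Y : Set E} {p : E} {g : ι → LocRing Y p} {F G : ι → E → ℂ}
    (h : IsGermOf g F) (h' : IsGermOf g G) (i : ι) : F i =ᶠ[𝓝[Y] p] G i :=
  Germ.coe_eq.1 ((h i).symm.trans (h' i))

theorem IsGermOf.congr {Y : Set E} {p : E} {g : ι → LocRing Y p} {F G : ι → E → ℂ}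
    (h : IsGermOf g F) (h' : ∀ i, F i =ᶠ[𝓝[Y] p] G i) : IsGermOf g G := fun i =>
  (h i).trans (Germ.coe_eq.2 (h' i))

theorem stalk_eq_span {Y : Set E} {κ : Type*} {s : κ → ι → E → ℂ} {p : E}
    (hs : ∀ k i, AnalyticAt ℂ (s k i) p) :
    stalk Y s p = Submodule.span _ (Set.range fun k i => toGerm Y (s k i) (hs k i)) := by
  unfold stalk
  congr 1
  ext g
  constructor
  · rintro ⟨k, hk⟩
    exact ⟨k, (hk.eq_toGerm (hs k)).symm⟩
  · rintro ⟨k, rfl⟩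
    exact ⟨k, isGermOf_toGerm (hs k)⟩

theorem stalk_comp_equiv {Y : Set E} {κ κ' : Type*} (e : κ' ≃ κ) (s : κ → ι → E → ℂ) (p : E) :
    stalk Y (fun k => s (e k)) p = stalk Y s p := by
  unfold stalk
  congr 1
  ext g
  exact ⟨fun ⟨k, hk⟩ => ⟨e k, hk⟩, fun ⟨k, hk⟩ => ⟨e.symm k, by simpa using hk⟩⟩

theorem pullbackModule_span {Y : Set E} {y : E} {φ : ℂ → E} (hφ : IsCurve Y y φ)
    (S : Set (ι → LocRing Y y)) :
    pullbackModule hφ (Submodule.span _ S) =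
      Submodule.span LocRingOne ((fun m i => pullback hφ (m i)) '' S) := by
  apply le_antisymm
  · refine Submodule.span_le.2 ?_
    rintro _ ⟨m, hm, rfl⟩
    change (fun i => pullback hφ (m i)) ∈ Submodule.span _ _
    induction hm using Submodule.span_induction with
    | mem m hm => exact Submodule.subset_span ⟨m, hm, rfl⟩
    | zero =>
      convert Submodule.zero_mem _ using 1
      funext i
      exact map_zero (pullback hφ)
    | add a b _ _ ha hb =>
      convert Submodule.add_mem _ ha hb using 1
      funext i
      exact map_add (pullback hφ) (a i) (b i)
    | smul c a _ ha =>
      convert Submodule.smul_mem _ (pullback hφ c) ha using 1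
      funext i
      exact map_mul (pullback hφ) c (a i)
  · exact Submodule.span_mono (Set.image_mono Submodule.subset_span)

theorem pullbackModule_stalk {Y : Set E} {κ : Type*} {s : κ → ι → E → ℂ} {p : E}
    (hs : ∀ k i, AnalyticAt ℂ (s k i) p) {φ : ℂ → E} (hφ : IsCurve Y p φ) :
    pullbackModule hφ (stalk Y s p) = Submodule.span LocRingOne
      (Set.range fun k i => toGerm Set.univ (fun t => s k i (φ t)) (hφ.analyticAt_comp (hs k i))) := by
  rw [stalk_eq_span hs, pullbackModule_span, ← Set.range_comp]
  rfl

theorem le_intClosure {Y : Set E} {y : E} (M : Submodule (LocRing Y y) (ι → LocRing Y y)) :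
    M ≤ intClosure M := fun m hm _ _ => Submodule.subset_span ⟨m, hm, rfl⟩

theorem pullbackModule_mono {Y : Set E} {y : E} {φ : ℂ → E} (hφ : IsCurve Y y φ)
    {M N : Submodule (LocRing Y y) (ι → LocRing Y y)} (h : M ≤ N) :
    pullbackModule hφ M ≤ pullbackModule hφ N := Submodule.span_mono (Set.image_mono h)

theorem intClosure_mono {Y : Set E} {y : E} {M N : Submodule (LocRing Y y) (ι → LocRing Y y)}
    (h : M ≤ N) : intClosure M ≤ intClosure N := fun _ hm φ hφ => pullbackModule_mono hφ h (hm φ hφ)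

theorem intClosure_le_of_le {Y : Set E} {y : E}
    {M N : Submodule (LocRing Y y) (ι → LocRing Y y)} (h : M ≤ intClosure N) :
    intClosure M ≤ intClosure N := fun _ hm φ hφ => by
  have : pullbackModule hφ M ≤ pullbackModule hφ N := Submodule.span_le.2 <| by
    rintro _ ⟨m, hm, rfl⟩
    exact h hm φ hφ
  exact this (hm φ hφ)

theorem le_idealClosure {Y : Set E} {y : E} (I : Ideal (LocRing Y y)) : I ≤ idealClosure I :=
  fun _ hm _ hφ => Ideal.mem_map_of_mem (pullback hφ) hm

/-- Membership of germs in a family of submodules spreads from generators to the whole span. -/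
theorem eventually_mem_of_mem_span [Finite ι] {Y : Set E} {y : E} {R : E → Prop}
    {N : ∀ p : E, Submodule (LocRing Y p) (ι → LocRing Y p)} {S : Set (ι → LocRing Y y)}
    (hS : ∀ g ∈ S, ∃ F, IsGermOf g F ∧ ∀ᶠ p in 𝓝[Y] y, R p → ∃ g' ∈ N p, IsGermOf g' F)
    {g : ι → LocRing Y y} (hg : g ∈ Submodule.span (LocRing Y y) S) {F : ι → E → ℂ}
    (hF : IsGermOf g F) : ∀ᶠ p in 𝓝[Y] y, R p → ∃ g' ∈ N p, IsGermOf g' F := by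
  have key : ∀ {g : ι → LocRing Y y} {F G : ι → E → ℂ}, IsGermOf g G → IsGermOf g F →
      (∀ᶠ p in 𝓝[Y] y, R p → ∃ g' ∈ N p, IsGermOf g' G) →
      ∀ᶠ p in 𝓝[Y] y, R p → ∃ g' ∈ N p, IsGermOf g' F := by
    intro g F G hG hF h
    have h1 : ∀ᶠ p in 𝓝[Y] y, ∀ i, G i =ᶠ[𝓝[Y] p] F i :=
      eventually_all.2 fun i => eventually_eventually_nhdsWithin.2 (hG.eventuallyEq hF i)
    filter_upwards [h, h1] with p hp h1p hR
    obtain ⟨g', hg', hgG⟩ := hp hR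
    exact ⟨g', hg', hgG.congr h1p⟩
  induction hg using Submodule.span_induction generalizing F with
  | mem g hg =>
    obtain ⟨G, hG, h⟩ := hS g hg
    exact key hG hF h
  | zero =>
    refine key (G := fun _ _ => 0) (fun i => rfl) hF (Eventually.of_forall fun p _ => ?_)
    exact ⟨0, Submodule.zero_mem _, fun i => rfl⟩
  | add a b _ _ iha ihb =>
    obtain ⟨A, -, hA⟩ := exists_isGermOf a
    obtain ⟨B, -, hB⟩ := exists_isGermOf b
    refine key (G := fun i => A i + B i) (fun i => ?_) hF ?_
    · rw [Germ.coe_add, ← hA i, ← hB i]; rfl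
    · filter_upwards [iha hA, ihb hB] with p h1 h2 hR
      obtain ⟨a', ha', haA⟩ := h1 hR
      obtain ⟨b', hb', hbB⟩ := h2 hR
      refine ⟨a' + b', Submodule.add_mem _ ha' hb', fun i => ?_⟩
      rw [Germ.coe_add, ← haA i, ← hbB i]; rfl
  | smul c a _ iha =>
    obtain ⟨A, -, hA⟩ := exists_isGermOf a
    obtain ⟨C, hC, rfl⟩ := exists_eq_toGerm c
    refine key (G := fun i => C * A i) (fun i => ?_) hF ?_
    · rw [Germ.coe_mul, ← hA i]; rfl
    · filter_upwards [iha hA, nhdsWithin_le_nhds hC.eventually_analyticAt] with p h1 hCp hR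
      obtain ⟨a', ha', haA⟩ := h1 hR
      refine ⟨toGerm Y C hCp • a', Submodule.smul_mem _ _ ha', fun i => ?_⟩
      rw [Germ.coe_mul, ← haA i]; rfl

/-- Members of a stalk stay in the nearby stalks. -/
theorem eventually_mem_stalk [Finite ι] {Y : Set E} {y : E} {κ : Type*} {s : κ → ι → E → ℂ}
    (hs : ∀ k i, AnalyticAt ℂ (s k i) y) {g : ι → LocRing Y y} (hg : g ∈ stalk Y s y)
    {F : ι → E → ℂ} (hF : IsGermOf g F) :
    ∀ᶠ p in 𝓝[Y] y, ∃ g' ∈ stalk Y s p, IsGermOf g' F := by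
  have := eventually_mem_of_mem_span (R := fun _ => True) (N := fun p => stalk Y s p) ?_ hg hF
  · simpa using this
  · rintro g ⟨k, hk⟩
    refine ⟨s k, hk, ?_⟩
    have h1 : ∀ᶠ p in 𝓝 y, ∀ i, AnalyticAt ℂ (s k i) p :=
      eventually_all.2 fun i => (hs k i).eventually_analyticAt
    filter_upwards [nhdsWithin_le_nhds h1] with p hp _
    exact ⟨_, Submodule.subset_span ⟨k, isGermOf_toGerm hp⟩, isGermOf_toGerm hp⟩

/-- An inclusion of modules spreads to the nearby stalks. -/
theorem eventually_stalk_le [Finite ι] {Y : Set E} {y : E} {κ κ' : Type*} [Finite κ]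
    {s : κ → ι → E → ℂ} {s' : κ' → ι → E → ℂ} (hs : ∀ k i, AnalyticAt ℂ (s k i) y)
    (hs' : ∀ k i, AnalyticAt ℂ (s' k i) y) (h : stalk Y s y ≤ stalk Y s' y) :
    ∀ᶠ p in 𝓝[Y] y, stalk Y s p ≤ stalk Y s' p := by
  have h1 : ∀ᶠ p in 𝓝[Y] y, ∀ k, ∃ g' ∈ stalk Y s' p, IsGermOf g' (s k) :=
    eventually_all.2 fun k => eventually_mem_stalk hs'
      (h (Submodule.subset_span ⟨k, isGermOf_toGerm (hs k)⟩)) (isGermOf_toGerm (hs k))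
  filter_upwards [h1] with p hp
  refine Submodule.span_le.2 ?_
  rintro g ⟨k, hk⟩
  obtain ⟨g', hg', hgs⟩ := hp k
  rw [hk.unique hgs]
  exact hg'

end LocRingBasics

/-! ### The structure of the double of an ideal. -/

section Double

variable {n : ℕ}

theorem analyticAt_coord (j : Fin n) (x : Fin n → ℂ) :
    AnalyticAt ℂ (fun z : Fin n → ℂ => z j) x :=
  (ContinuousLinearMap.proj (R := ℂ) (φ := fun _ : Fin n => ℂ) j).analyticAt x

/-- The germ of a coordinate function. -/
def coordGerm (X : Set (Fin n → ℂ)) (x : Fin n → ℂ) (j : Fin n) : LocRing X x :=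
  toGerm X (fun z => z j) (analyticAt_coord j x)

/-- The pull-back by the first projection. -/
abbrev pr₁ (X : Set (Fin n → ℂ)) (x : Fin n → ℂ) : LocRing X x →+* LocRing (X ×ˢ X) (x, x) :=
  pullback (isMapGerm_fst X x)

/-- The pull-back by the second projection. -/
abbrev pr₂ (X : Set (Fin n → ℂ)) (x : Fin n → ℂ) : LocRing X x →+* LocRing (X ×ˢ X) (x, x) :=
  pullback (isMapGerm_snd X x)

theorem isMapGerm_diag (X : Set (Fin n → ℂ)) (x : Fin n → ℂ) :
    IsMapGerm X x (X ×ˢ X) (x, x) fun z => (z, z) :=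
  ⟨analyticAt_id.prod analyticAt_id, rfl, eventually_nhdsWithin_of_forall fun _ h => ⟨h, h⟩⟩

/-- Restriction to the diagonal. -/
abbrev diagRes (X : Set (Fin n → ℂ)) (x : Fin n → ℂ) : LocRing (X ×ˢ X) (x, x) →+* LocRing X x :=
  pullback (isMapGerm_diag X x)

theorem diagRes_pr₁ {X : Set (Fin n → ℂ)} {x : Fin n → ℂ} (a : LocRing X x) :
    diagRes X x (pr₁ X x a) = a := by
  obtain ⟨F, hF, rfl⟩ := exists_eq_toGerm a
  rfl

theorem diagRes_pr₂ {X : Set (Fin n → ℂ)} {x : Fin n → ℂ} (a : LocRing X x) :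
    diagRes X x (pr₂ X x a) = a := by
  obtain ⟨F, hF, rfl⟩ := exists_eq_toGerm a
  rfl

/-- The base point `q.1` of the first variable stays free, so that it can be specialised to the
second variable (for the ideal of the diagonal) or to `0` (for the maximal ideal). -/
theorem exists_hadamard_fst {F : (Fin n → ℂ) × (Fin n → ℂ) → ℂ} {x x' : Fin n → ℂ}
    (hF : AnalyticAt ℂ F (x, x')) :
    ∃ b : Fin n → (Fin n → ℂ) × ((Fin n → ℂ) × (Fin n → ℂ)) → ℂ,
      (∀ j, AnalyticAt ℂ (b j) (x, (x, x'))) ∧ ∀ᶠ q in 𝓝 (x, (x, x')),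
        F q.2 - F (q.1, q.2.2) = ∑ j, (q.2.1 j - q.1 j) * b j q := by
  obtain ⟨B, hB, hFB⟩ := exists_analyticAt_hadamard hF
  have hΘ : AnalyticAt ℂ (fun q : (Fin n → ℂ) × ((Fin n → ℂ) × (Fin n → ℂ)) =>
      ((q.1, q.2.2), q.2)) (x, (x, x')) :=
    (analyticAt_fst.prod (analyticAt_snd.comp analyticAt_snd)).prod analyticAt_snd
  refine ⟨fun j q => B ((q.1, q.2.2), q.2) (Pi.single j 1, 0), fun j => ?_, ?_⟩
  · have h1 : AnalyticAt ℂ (fun q : (Fin n → ℂ) × ((Fin n → ℂ) × (Fin n → ℂ)) =>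
        B ((q.1, q.2.2), q.2)) (x, (x, x')) := AnalyticAt.comp (g := B) hB hΘ
    exact ((ContinuousLinearMap.apply ℂ ℂ ((Pi.single j 1, 0) :
      (Fin n → ℂ) × (Fin n → ℂ))).analyticAt _).comp h1
  · have h2 := hΘ.continuousAt.tendsto.eventually hFB
    filter_upwards [h2] with q hq
    rw [hq]
    have h3 : q.2 - (q.1, q.2.2) = ∑ j, (q.2.1 j - q.1 j) •
        ((Pi.single j 1, 0) : (Fin n → ℂ) × (Fin n → ℂ)) := by
      refine Prod.ext ?_ ?_
      · rw [Prod.fst_sum]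
        funext i
        simp [Finset.sum_apply, Pi.single_apply]
      · simp [Prod.snd_sum]
    rw [h3, map_sum]
    exact Finset.sum_congr rfl fun j _ => by rw [map_smul, smul_eq_mul]

theorem analyticAt_coord_sub (j : Fin n) (p : (Fin n → ℂ) × (Fin n → ℂ)) :
    AnalyticAt ℂ (fun q : (Fin n → ℂ) × (Fin n → ℂ) => q.1 j - q.2 j) p :=
  ((analyticAt_coord j p.1).comp analyticAt_fst).sub ((analyticAt_coord j p.2).comp analyticAt_snd)

theorem pr₁_sub_pr₂_coordGerm (X : Set (Fin n → ℂ)) (x : Fin n → ℂ) (j : Fin n) :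
    pr₁ X x (coordGerm X x j) - pr₂ X x (coordGerm X x j) =
      toGerm (X ×ˢ X) (fun q => q.1 j - q.2 j) (analyticAt_coord_sub j (x, x)) :=
  (toGerm_sub (F := fun q : (Fin n → ℂ) × (Fin n → ℂ) => q.1 j) (G := fun q => q.2 j)
    ((isMapGerm_fst X x).analyticAt_comp (analyticAt_coord j x))
    ((isMapGerm_snd X x).analyticAt_comp (analyticAt_coord j x))).symm

/-- The coordinate differences generate the ideal of the diagonal: Hadamard's lemma with base point
the second variable. -/
theorem sub_pr₂_diagRes_mem {X : Set (Fin n → ℂ)} {x : Fin n → ℂ}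
    (b : LocRing (X ×ˢ X) (x, x)) : b - pr₂ X x (diagRes X x b) ∈
      Ideal.span (Set.range fun j => pr₁ X x (coordGerm X x j) - pr₂ X x (coordGerm X x j)) := by
  obtain ⟨F, hF, rfl⟩ := exists_eq_toGerm b
  obtain ⟨c, hc, h⟩ := exists_hadamard_fst hF
  have hΘ : AnalyticAt ℂ (fun q : (Fin n → ℂ) × (Fin n → ℂ) => (q.2, q)) (x, x) :=
    analyticAt_snd.prod analyticAt_id
  have hcΘ : ∀ j, AnalyticAt ℂ (fun q : (Fin n → ℂ) × (Fin n → ℂ) => c j (q.2, q)) (x, x) :=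
    fun j => AnalyticAt.comp (g := c j) (hc j) hΘ
  have : toGerm (X ×ˢ X) F hF - pr₂ X x (diagRes X x (toGerm (X ×ˢ X) F hF)) =
      ∑ j, toGerm (X ×ˢ X) _ (hcΘ j) *
        (pr₁ X x (coordGerm X x j) - pr₂ X x (coordGerm X x j)) := by
    simp only [pr₁_sub_pr₂_coordGerm, ← toGerm_mul]
    rw [← toGerm_sum]
    refine (toGerm_sub hF ?_).symm.trans ?_
    · exact (isMapGerm_snd X x).analyticAt_comp ((isMapGerm_diag X x).analyticAt_comp hF)
    refine (toGerm_eq_iff _ _).2 (nhdsWithin_le_nhds ?_)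
    filter_upwards [hΘ.continuousAt.tendsto.eventually h] with q hq
    simp only [mul_comm (c _ _)]
    exact hq
  rw [this]
  exact Ideal.sum_mem _ fun j _ => Ideal.mul_mem_left _ _ (Ideal.subset_span ⟨j, rfl⟩)

/-- The embedding of a ring in its square as second factor. -/
def secondEmb (R : Type*) [CommRing R] : R →ₗ[R] Fin 2 → R where
  toFun c := ![0, c]
  map_add' a b := by simp
  map_smul' a b := by simp

theorem secondEmb_apply {R : Type*} [CommRing R] (c : R) : secondEmb R c = ![0, c] := rfl

variable {X : Set (Fin n → ℂ)} {x : Fin n → ℂ}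

theorem doubleElt_add (a b : LocRing X x) : doubleElt (a + b) = doubleElt a + doubleElt b := by
  simp [doubleElt]

/-- The failure of `h ↦ h_D` to be linear over `π₁^*` is an element supported in the second slot and
vanishing on the diagonal; with `a` a coordinate this yields the extra elements of `I_D`. -/
theorem doubleElt_mul (a b : LocRing X x) :
    doubleElt (a * b) = pr₁ X x a • doubleElt b - secondEmb _ ((pr₁ X x a - pr₂ X x a) * pr₂ X x b) := by
  funext i
  fin_cases i
  · simp [doubleElt, secondEmb_apply]
  · simp only [doubleElt, secondEmb_apply, map_mul, Pi.sub_apply, Pi.smul_apply, smul_eq_mul,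
      Fin.mk_one, Matrix.cons_val_one, Matrix.cons_val_fin_one]
    ring

theorem double_mono {I I' : Ideal (LocRing X x)} (h : I ≤ I') : double I ≤ double I' :=
  Submodule.span_mono (Set.image_mono h)

theorem secondEmb_mem_of_coord {N : Submodule (LocRing (X ×ˢ X) (x, x)) (Fin 2 → LocRing (X ×ˢ X) (x, x))}
    {g : LocRing (X ×ˢ X) (x, x)}
    (h : ∀ j, secondEmb _ ((pr₁ X x (coordGerm X x j) - pr₂ X x (coordGerm X x j)) * g) ∈ N)
    {d : LocRing (X ×ˢ X) (x, x)} (hd : d ∈ Ideal.span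
      (Set.range fun j => pr₁ X x (coordGerm X x j) - pr₂ X x (coordGerm X x j))) :
    secondEmb _ (d * g) ∈ N := by
  induction hd using Submodule.span_induction with
  | mem d hd =>
    obtain ⟨j, rfl⟩ := hd
    exact h j
  | zero => rw [zero_mul, map_zero]; exact N.zero_mem
  | add a b _ _ ha hb => rw [add_mul, map_add]; exact N.add_mem ha hb
  | smul c a _ ha => rw [smul_mul_assoc, map_smul]; exact N.smul_mem _ ha

theorem secondEmb_mul_pr₂_mem_double {I : Ideal (LocRing X x)} {g : LocRing X x} (hg : g ∈ I)
    {d : LocRing (X ×ˢ X) (x, x)} (hd : d ∈ Ideal.span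
      (Set.range fun j => pr₁ X x (coordGerm X x j) - pr₂ X x (coordGerm X x j))) :
    secondEmb _ (d * pr₂ X x g) ∈ double I := by
  refine secondEmb_mem_of_coord (fun j => ?_) hd
  have h := doubleElt_mul (coordGerm X x j) g
  rw [eq_sub_iff_add_eq, ← eq_sub_iff_add_eq'] at h
  rw [h]
  exact Submodule.sub_mem _ (Submodule.smul_mem _ _ (Submodule.subset_span ⟨g, hg, rfl⟩))
    (Submodule.subset_span ⟨_, I.mul_mem_left _ hg, rfl⟩)

theorem diagRes_eq_of_mem_double {I : Ideal (LocRing X x)} {w : Fin 2 → LocRing (X ×ˢ X) (x, x)}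
    (hw : w ∈ double I) : diagRes X x (w 0) = diagRes X x (w 1) := by
  induction hw using Submodule.span_induction with
  | mem w hw =>
    obtain ⟨g, -, rfl⟩ := hw
    exact (diagRes_pr₁ g).trans (diagRes_pr₂ g).symm
  | zero => rfl
  | add a b _ _ ha hb => simp only [Pi.add_apply, map_add, ha, hb]
  | smul c a _ ha => simp only [Pi.smul_apply, smul_eq_mul, map_mul, ha]

theorem exists_mem_double_of_mem_map {I : Ideal (LocRing X x)} {h : LocRing (X ×ˢ X) (x, x)}
    (hh : h ∈ I.map (pr₁ X x)) : ∃ u ∈ I.map (pr₂ X x), ![h, u] ∈ double I := by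
  induction hh using Submodule.span_induction with
  | mem h hh =>
    obtain ⟨g, hg, rfl⟩ := hh
    exact ⟨_, Ideal.mem_map_of_mem _ hg, Submodule.subset_span ⟨g, hg, rfl⟩⟩
  | zero => exact ⟨0, Ideal.zero_mem _, by convert Submodule.zero_mem _; simp⟩
  | add a b _ _ ha hb =>
    obtain ⟨u, hu, hau⟩ := ha
    obtain ⟨v, hv, hbv⟩ := hb
    exact ⟨u + v, Ideal.add_mem _ hu hv, by simpa using Submodule.add_mem _ hau hbv⟩
  | smul c a _ ha =>
    obtain ⟨u, hu, hau⟩ := ha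
    exact ⟨c * u, Ideal.mul_mem_left _ _ hu, by simpa using Submodule.smul_mem _ c hau⟩

theorem diagRes_mem_of_mem_map {I : Ideal (LocRing X x)} {v : LocRing (X ×ˢ X) (x, x)}
    (hv : v ∈ I.map (pr₂ X x)) : diagRes X x v ∈ I := by
  have h : I.map (pr₂ X x) ≤ I.comap (diagRes X x) := Ideal.map_le_iff_le_comap.2 fun g hg => by
    rw [Ideal.mem_comap, Ideal.mem_comap, diagRes_pr₂]
    exact hg
  exact h hv

/-- For `v = ∑ c_k (g_k ∘ π₂)` the difference is `∑ (c_k - c_k|Δ ∘ π₂) (g_k ∘ π₂)`, with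
coefficients in the ideal of the diagonal. -/
theorem secondEmb_sub_mem_double {I : Ideal (LocRing X x)} {v : LocRing (X ×ˢ X) (x, x)}
    (hv : v ∈ I.map (pr₂ X x)) : secondEmb _ (v - pr₂ X x (diagRes X x v)) ∈ double I := by
  induction hv using Submodule.span_induction with
  | mem v hv =>
    obtain ⟨g, hg, rfl⟩ := hv
    rw [diagRes_pr₂, sub_self, map_zero]
    exact Submodule.zero_mem _
  | zero => simp
  | add a b _ _ ha hb =>
    convert Submodule.add_mem _ ha hb using 1
    rw [← map_add]
    congr 1
    simp only [map_add]
    ring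
  | smul c a hmem ha =>
    have h1 := secondEmb_mul_pr₂_mem_double (diagRes_mem_of_mem_map hmem) (sub_pr₂_diagRes_mem c)
    convert Submodule.add_mem _ (Submodule.smul_mem _ c ha) h1 using 1
    rw [← map_smul, ← map_add]
    congr 1
    simp only [smul_eq_mul, map_mul]
    ring

/-- A criterion for membership in the double of an ideal. -/
theorem mem_double_of_diagRes_eq {I : Ideal (LocRing X x)} {h : Fin 2 → LocRing (X ×ˢ X) (x, x)}
    (h0 : h 0 ∈ I.map (pr₁ X x)) (h1 : h 1 ∈ I.map (pr₂ X x))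
    (hd : diagRes X x (h 0) = diagRes X x (h 1)) : h ∈ double I := by
  -- Some element of `I_D` has first component `h 0`. Subtracting it leaves a second-slot element of
  -- `π₂^* I` that vanishes on the diagonal.
  obtain ⟨u, hu, hmem⟩ := exists_mem_double_of_mem_map h0
  have hdu : diagRes X x (h 0) = diagRes X x u := diagRes_eq_of_mem_double hmem
  have h2 := secondEmb_sub_mem_double (Ideal.sub_mem _ h1 hu)
  have h3 : diagRes X x (h 1 - u) = 0 := by rw [map_sub, ← hd, hdu, sub_self]
  rw [h3, map_zero, sub_zero] at h2
  convert Submodule.add_mem _ hmem h2 using 1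
  funext i
  fin_cases i <;> simp [secondEmb_apply]

/-- Generators of the double of the ideal generated by the `G k`. -/
def doubleGens {κ : Type*} (G : κ → (Fin n → ℂ) → ℂ) :
    Option (Fin n) × κ → Fin 2 → (Fin n → ℂ) × (Fin n → ℂ) → ℂ
  | (none, k) => ![fun q => G k q.1, fun q => G k q.2]
  | (some j, k) => ![fun _ => 0, fun q => (q.1 j - q.2 j) * G k q.2]

theorem analyticAt_doubleGens {κ : Type*} {G : κ → (Fin n → ℂ) → ℂ}
    {p : (Fin n → ℂ) × (Fin n → ℂ)} (h1 : ∀ k, AnalyticAt ℂ (G k) p.1)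
    (h2 : ∀ k, AnalyticAt ℂ (G k) p.2) (a : Option (Fin n) × κ) (i : Fin 2) :
    AnalyticAt ℂ (doubleGens G a i) p := by
  have h1' : ∀ k, AnalyticAt ℂ (fun q : (Fin n → ℂ) × (Fin n → ℂ) => G k q.1) p := fun k =>
    AnalyticAt.comp (g := G k) (h1 k) analyticAt_fst
  have h2' : ∀ k, AnalyticAt ℂ (fun q : (Fin n → ℂ) × (Fin n → ℂ) => G k q.2) p := fun k =>
    AnalyticAt.comp (g := G k) (h2 k) analyticAt_snd
  obtain ⟨o, k⟩ := a
  cases o with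
  | none => fin_cases i; exacts [h1' k, h2' k]
  | some j => fin_cases i; exacts [analyticAt_const, (analyticAt_coord_sub j p).mul (h2' k)]

/-- Doubles of generators of `I` alone need not generate `I_D`; by `doubleElt_mul` the second-slot
elements `(z_j - w_j)(G k ∘ π₂)` make up the difference. -/
theorem stalk_doubleGens {κ : Type*} {G : κ → (Fin n → ℂ) → ℂ} (hG : ∀ k, AnalyticAt ℂ (G k) x) :
    stalk (X ×ˢ X) (doubleGens G) (x, x) =
      double (Ideal.span (Set.range fun k => toGerm X (G k) (hG k))) := by
  set I := Ideal.span (Set.range fun k => toGerm X (G k) (hG k)) with hI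
  have hgen : ∀ k, IsGermOf (doubleElt (toGerm X (G k) (hG k))) (doubleGens G (none, k)) := by
    intro k i
    fin_cases i <;> rfl
  have hgen' : ∀ j k, IsGermOf (secondEmb _ ((pr₁ X x (coordGerm X x j) - pr₂ X x (coordGerm X x j)) *
      pr₂ X x (toGerm X (G k) (hG k)))) (doubleGens G (some j, k)) := by
    intro j k i
    fin_cases i
    · rfl
    · exact congrArg (fun g : LocRing (X ×ˢ X) (x, x) => (g : Germ (𝓝[X ×ˢ X] (x, x)) ℂ))
        (congrArg (· * pr₂ X x (toGerm X (G k) (hG k))) (pr₁_sub_pr₂_coordGerm X x j))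
  apply le_antisymm
  · refine Submodule.span_le.2 ?_
    rintro g ⟨⟨o, k⟩, hg⟩
    have hk : toGerm X (G k) (hG k) ∈ I := Ideal.subset_span ⟨k, rfl⟩
    cases o with
    | none =>
      rw [hg.unique (hgen k)]
      exact Submodule.subset_span ⟨_, hk, rfl⟩
    | some j =>
      rw [hg.unique (hgen' j k)]
      exact secondEmb_mul_pr₂_mem_double hk (Ideal.subset_span ⟨j, rfl⟩)
  · refine Submodule.span_le.2 ?_
    rintro _ ⟨g, hg, rfl⟩
    -- Both memberships are proved together, since the double of a product involves a second-slot
    -- element of the factor.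
    have key : doubleElt g ∈ stalk (X ×ˢ X) (doubleGens G) (x, x) ∧ ∀ j, secondEmb _
        ((pr₁ X x (coordGerm X x j) - pr₂ X x (coordGerm X x j)) * pr₂ X x g) ∈
          stalk (X ×ˢ X) (doubleGens G) (x, x) := by
      rw [SetLike.mem_coe, hI] at hg
      induction hg using Submodule.span_induction with
      | mem g hg =>
        obtain ⟨k, rfl⟩ := hg
        exact ⟨Submodule.subset_span ⟨_, hgen k⟩, fun j => Submodule.subset_span ⟨_, hgen' j k⟩⟩
      | zero =>
        refine ⟨?_, fun j => ?_⟩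
        · convert Submodule.zero_mem _
          simp [doubleElt]
        · rw [map_zero, mul_zero, map_zero]
          exact Submodule.zero_mem _
      | add a b _ _ ha hb =>
        refine ⟨?_, fun j => ?_⟩
        · rw [doubleElt_add]
          exact Submodule.add_mem _ ha.1 hb.1
        · rw [map_add, mul_add, map_add]
          exact Submodule.add_mem _ (ha.2 j) (hb.2 j)
      | smul c a _ ha =>
        refine ⟨?_, fun j => ?_⟩
        · rw [smul_eq_mul, doubleElt_mul]
          refine Submodule.sub_mem _ (Submodule.smul_mem _ _ ha.1) ?_
          refine secondEmb_mem_of_coord ha.2 ?_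
          simpa [diagRes_pr₁] using sub_pr₂_diagRes_mem (pr₁ X x c)
        · have : (pr₁ X x (coordGerm X x j) - pr₂ X x (coordGerm X x j)) * pr₂ X x (c • a) =
              pr₂ X x c • ((pr₁ X x (coordGerm X x j) - pr₂ X x (coordGerm X x j)) * pr₂ X x a) := by
            rw [smul_eq_mul, map_mul, smul_eq_mul, mul_left_comm]
          rw [this, map_smul]
          exact Submodule.smul_mem _ _ (ha.2 j)
    exact key.1

end Double

/-! ### Growth estimates, and powers of the maximal ideal in the closure of the Jacobian ideal. -/

section IdealClosureGrowth

open Asymptotics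

variable {E : Type*} [NormedAddCommGroup E] [NormedSpace ℂ E]

/-- The estimate pulls back along every curve, and in `𝒪_1` boundedness by a finite family means
membership in its ideal. -/
theorem toGerm_mem_idealClosure_of_isBigO {Y : Set E} {y : E} {κ : Type*} [Fintype κ]
    {G : κ → E → ℂ} (hG : ∀ k, AnalyticAt ℂ (G k) y) {H : E → ℂ} (hH : AnalyticAt ℂ H y)
    (h : H =O[𝓝[Y] y] fun z => ∑ k, ‖G k z‖) :
    toGerm Y H hH ∈ idealClosure (Ideal.span (Set.range fun k => toGerm Y (G k) (hG k))) := by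
  intro φ hφ
  rw [Ideal.map_span, ← Set.range_comp]
  have h1 := h.comp_tendsto hφ.tendsto
  rw [nhdsWithin_univ] at h1
  exact toGerm_mem_span_of_isBigO (fun k => hφ.analyticAt_comp (hG k)) (hφ.analyticAt_comp hH) h1

end IdealClosureGrowth

section MaxIdeal

open Asymptotics

variable {n : ℕ}

/-- The ideal generated by the coordinate functions. -/
def coordIdeal (X : Set (Fin n → ℂ)) : Ideal (LocRing X 0) :=
  Ideal.span (Set.range (coordGerm X 0))

theorem exists_isBigO_of_mem_coordIdeal {X : Set (Fin n → ℂ)} {g : LocRing X 0}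
    (hg : g ∈ coordIdeal X) :
    ∃ (H : (Fin n → ℂ) → ℂ) (hH : AnalyticAt ℂ H 0), g = toGerm X H hH ∧
      H =O[𝓝 0] fun z => ‖z‖ := by
  induction hg using Submodule.span_induction with
  | mem g hg =>
    obtain ⟨j, rfl⟩ := hg
    exact ⟨_, analyticAt_coord j 0, rfl, IsBigO.of_bound 1 (Eventually.of_forall fun z => by
      simpa using norm_le_pi_norm z j)⟩
  | zero => exact ⟨fun _ => 0, analyticAt_const, rfl, isBigO_zero _ _⟩
  | add a b _ _ ha hb =>
    obtain ⟨A, hA, rfl, hAO⟩ := ha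
    obtain ⟨B, hB, rfl, hBO⟩ := hb
    exact ⟨_, hA.add hB, rfl, hAO.add hBO⟩
  | smul c a _ ha =>
    obtain ⟨A, hA, rfl, hAO⟩ := ha
    obtain ⟨C, hC, rfl⟩ := exists_eq_toGerm c
    refine ⟨fun z => C z * A z, hC.mul hA, rfl, ?_⟩
    simpa using (hC.continuousAt.isBigO_one ℝ).mul hAO

theorem exists_isBigO_of_mem_coordIdeal_pow {X : Set (Fin n → ℂ)} {N : ℕ} {g : LocRing X 0}
    (hg : g ∈ coordIdeal X ^ N) :
    ∃ (H : (Fin n → ℂ) → ℂ) (hH : AnalyticAt ℂ H 0), g = toGerm X H hH ∧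
      H =O[𝓝 0] fun z => ‖z‖ ^ N := by
  induction N generalizing g with
  | zero =>
    obtain ⟨H, hH, rfl⟩ := exists_eq_toGerm g
    exact ⟨H, hH, rfl, by simpa using hH.continuousAt.isBigO_one ℝ⟩
  | succ N ih =>
    rw [pow_succ] at hg
    induction hg using Submodule.mul_induction_on' with
    | mem_mul_mem a ha b hb =>
      obtain ⟨A, hA, rfl, hAO⟩ := ih ha
      obtain ⟨B, hB, rfl, hBO⟩ := exists_isBigO_of_mem_coordIdeal hb
      exact ⟨fun z => A z * B z, hA.mul hB, rfl, by simpa only [pow_succ] using hAO.mul hBO⟩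
    | add a _ b _ ha hb =>
      obtain ⟨A, hA, rfl, hAO⟩ := ha
      obtain ⟨B, hB, rfl, hBO⟩ := hb
      exact ⟨_, hA.add hB, rfl, hAO.add hBO⟩

theorem fderiv_eq_zero_of_partialDeriv {f : (Fin n → ℂ) → ℂ} {z : Fin n → ℂ}
    (h : ∀ i, partialDeriv f i z = 0) : fderiv ℂ f z = 0 := by
  refine ContinuousLinearMap.coe_injective (LinearMap.pi_ext' fun i => LinearMap.ext_ring ?_)
  simpa [partialDeriv] using h i

/-- A power of the maximal ideal lies in the integral closure of the Jacobian ideal of an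
isolated singularity. -/
theorem exists_coordIdeal_pow_le {f : (Fin n → ℂ) → ℂ}
    (hf : IsIsolatedHypersurfaceSingularity f) :
    ∃ N, coordIdeal (hypersurface f) ^ N ≤ idealClosure (jacobianIdeal hf.analyticAt) := by
  -- The family is `f` together with its partial derivatives. On `X` the term of `f` drops out of
  -- the resulting bound.
  obtain ⟨N, -, hN⟩ := exists_lojasiewicz n (n + 1)
    (Fin.cons f (partialDeriv f) : Fin (n + 1) → (Fin n → ℂ) → ℂ)
    (fun k => by
      refine Fin.cases ?_ (fun i => ?_) k
      · exact hf.analyticAt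
      · exact analyticAt_partialDeriv hf.analyticAt i)
    (by
      filter_upwards [eventually_nhdsWithin_iff.1 hf.isolated] with z hz h
      by_contra hne
      refine hz hne (by simpa using h 0) (fderiv_eq_zero_of_partialDeriv fun i => ?_)
      simpa using h i.succ)
  refine ⟨N, fun g hg => ?_⟩
  obtain ⟨H, hH, rfl, hHO⟩ := exists_isBigO_of_mem_coordIdeal_pow hg
  refine toGerm_mem_idealClosure_of_isBigO _ hH ?_
  refine ((hHO.trans hN).mono nhdsWithin_le_nhds).congr' EventuallyEq.rfl ?_
  filter_upwards [self_mem_nhdsWithin] with z hz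
  have hz : f z = 0 := hz
  simp [Fin.sum_univ_succ, hz]

end MaxIdeal

/-! ### Ideals containing a power of the maximal ideal. -/

section FiniteCodimension

/-- Constants. -/
instance {E : Type*} [NormedAddCommGroup E] [NormedSpace ℂ E] (Y : Set E) (y : E) :
    Algebra ℂ (LocRing Y y) :=
  RingHom.toAlgebra
    { toFun := fun c => toGerm Y (fun _ => c) analyticAt_const
      map_one' := rfl
      map_zero' := rfl
      map_mul' := fun _ _ => rfl
      map_add' := fun _ _ => rfl }

theorem algebraMap_eq_toGerm {E : Type*} [NormedAddCommGroup E] [NormedSpace ℂ E] (Y : Set E)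
    (y : E) (c : ℂ) :
    algebraMap ℂ (LocRing Y y) c = toGerm Y (fun _ => c) analyticAt_const := rfl

variable {n : ℕ} {X : Set (Fin n → ℂ)}

theorem exists_sub_algebraMap_mem_coordIdeal (a : LocRing X 0) :
    ∃ c : ℂ, a - algebraMap ℂ _ c ∈ coordIdeal X := by
  obtain ⟨F, hF, rfl⟩ := exists_eq_toGerm a
  obtain ⟨b, hb, h⟩ := exists_hadamard_fst (F := fun q : (Fin n → ℂ) × (Fin n → ℂ) => F q.1)
    (x := 0) (x' := 0) (AnalyticAt.comp (g := F) hF analyticAt_fst)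
  have hΘ : AnalyticAt ℂ (fun z : Fin n → ℂ => ((0 : Fin n → ℂ), (z, (0 : Fin n → ℂ)))) 0 :=
    analyticAt_const.prod (analyticAt_id.prod analyticAt_const)
  have hbΘ : ∀ j, AnalyticAt ℂ (fun z : Fin n → ℂ => b j (0, (z, 0))) 0 := fun j =>
    AnalyticAt.comp (g := b j) (hb j) hΘ
  refine ⟨F 0, ?_⟩
  have : toGerm X F hF - algebraMap ℂ _ (F 0) =
      ∑ j, toGerm X _ (hbΘ j) * coordGerm X 0 j := by
    simp only [coordGerm, ← toGerm_mul]
    rw [← toGerm_sum, algebraMap_eq_toGerm, ← toGerm_sub]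
    refine (toGerm_eq_iff _ _).2 (nhdsWithin_le_nhds ?_)
    filter_upwards [hΘ.continuousAt.tendsto.eventually h] with z hz
    simpa [mul_comm] using hz
  rw [this]
  exact Ideal.sum_mem _ fun j _ => Ideal.mul_mem_left _ _ (Ideal.subset_span ⟨j, rfl⟩)

theorem coordIdeal_fg : (coordIdeal X).FG := Submodule.fg_span (Set.finite_range _)

/-- As `𝒪_X = ℂ + m`, finitely many ideal generators of `m ^ k` span it over `ℂ` modulo `m ^ (k +
1)`. -/
theorem exists_finiteDimensional_sup_pow (k : ℕ) : ∃ U : Submodule ℂ (LocRing X 0), U.FG ∧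
    ∀ a : LocRing X 0, ∃ u ∈ U, a - u ∈ coordIdeal X ^ k := by
  induction k with
  | zero => exact ⟨⊥, Submodule.fg_bot, fun a => ⟨0, Submodule.zero_mem _, by simp⟩⟩
  | succ k ih =>
    obtain ⟨U, hU, h⟩ := ih
    obtain ⟨S, hS⟩ := (coordIdeal_fg (X := X)).pow (n := k)
    have key : ∀ w ∈ coordIdeal X ^ k, ∃ v ∈ Submodule.span ℂ (S : Set (LocRing X 0)),
        w - v ∈ coordIdeal X ^ (k + 1) := by
      intro w hw
      have hSk : ∀ s ∈ S, s ∈ coordIdeal X ^ k := fun s hs => hS ▸ Submodule.subset_span hs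
      rw [← hS] at hw
      have : ∀ b : LocRing X 0, ∃ v ∈ Submodule.span ℂ (S : Set (LocRing X 0)),
          b * w - v ∈ coordIdeal X ^ (k + 1) := by
        induction hw using Submodule.span_induction with
        | mem s hs =>
          intro b
          obtain ⟨c, hc⟩ := exists_sub_algebraMap_mem_coordIdeal b
          refine ⟨c • s, Submodule.smul_mem _ _ (Submodule.subset_span hs), ?_⟩
          rw [Algebra.smul_def, ← sub_mul, pow_succ']
          exact Ideal.mul_mem_mul hc (hSk s hs)
        | zero => exact fun b => ⟨0, Submodule.zero_mem _, by simp⟩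
        | add a a' _ _ ha ha' =>
          intro b
          obtain ⟨v, hv, h1⟩ := ha b
          obtain ⟨v', hv', h2⟩ := ha' b
          refine ⟨v + v', Submodule.add_mem _ hv hv', ?_⟩
          convert Ideal.add_mem _ h1 h2 using 1
          ring
        | smul c a _ ha =>
          intro b
          obtain ⟨v, hv, h1⟩ := ha (b * c)
          exact ⟨v, hv, by rwa [smul_eq_mul, ← mul_assoc]⟩
      simpa using this 1
    refine ⟨U ⊔ Submodule.span ℂ S, hU.sup ⟨S, rfl⟩, fun a => ?_⟩
    obtain ⟨u, hu, hau⟩ := h a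
    obtain ⟨v, hv, hw⟩ := key _ hau
    exact ⟨u + v, Submodule.add_mem_sup hu hv, by rwa [← sub_sub]⟩

variable {I : Ideal (LocRing X 0)} {N : ℕ}

/-- `I` is generated by `m ^ N` and its intersection with a finite-dimensional complement `U`.
Finite generation is what allows the closure of `J(f)` to be spread out as a sheaf near the origin.
-/
theorem ideal_fg_of_pow_le (hI : coordIdeal X ^ N ≤ I) : I.FG := by
  obtain ⟨U, hU, h⟩ := exists_finiteDimensional_sup_pow (X := X) N
  have : Module.Finite ℂ U := Module.Finite.iff_fg.2 hU
  have : IsNoetherian ℂ U := inferInstance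
  obtain ⟨S, hS⟩ := ((IsNoetherian.noetherian
    ((I.restrictScalars ℂ).comap U.subtype)).map U.subtype)
  obtain ⟨T, hT⟩ := (coordIdeal_fg (X := X)).pow (n := N)
  classical
  refine ⟨S ∪ T, le_antisymm (Submodule.span_le.2 ?_) fun a ha => ?_⟩
  · intro s hs
    rw [Finset.coe_union] at hs
    rcases hs with hs | hs
    · have : s ∈ ((I.restrictScalars ℂ).comap U.subtype).map U.subtype :=
        hS ▸ Submodule.subset_span hs
      obtain ⟨u, hu, rfl⟩ := this
      exact hu
    · exact hI (hT ▸ Submodule.subset_span hs)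
  · obtain ⟨u, hu, hau⟩ := h a
    have huI : u ∈ I := by simpa using I.sub_mem ha (hI hau)
    have h1 : u ∈ Submodule.span ℂ (S : Set (LocRing X 0)) := by
      rw [hS]
      exact ⟨⟨u, hu⟩, huI, rfl⟩
    rw [Finset.coe_union, Ideal.span_union, ← sub_add_cancel a u]
    refine Submodule.add_mem _ (Submodule.mem_sup_right (hT ▸ hau)) (Submodule.mem_sup_left ?_)
    exact Submodule.span_subset_span ℂ _ _ h1

theorem finite_quotient_of_pow_le (hI : coordIdeal X ^ N ≤ I) : Module.Finite ℂ (LocRing X 0 ⧸ I) := by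
  obtain ⟨U, hU, h⟩ := exists_finiteDimensional_sup_pow (X := X) N
  have hmap := hU.map (Ideal.Quotient.mkₐ ℂ I).toLinearMap
  refine ⟨?_⟩
  suffices h' : U.map (Ideal.Quotient.mkₐ ℂ I).toLinearMap = ⊤ from h' ▸ hmap
  refine Submodule.eq_top_iff'.2 fun q => ?_
  obtain ⟨a, rfl⟩ := Ideal.Quotient.mk_surjective q
  obtain ⟨u, hu, hau⟩ := h a
  exact ⟨u, hu, (Ideal.Quotient.eq.2 (hI hau)).symm⟩

/-- Lifts of a basis of the quotient by an ideal of finite codimension. -/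
theorem exists_quotient_basis_lift (hI : coordIdeal X ^ N ≤ I) :
    ∃ (d : ℕ) (e : Fin d → LocRing X 0),
      (∀ a, ∃ c : Fin d → ℂ, a - ∑ l, algebraMap ℂ _ (c l) * e l ∈ I) ∧
      ∀ c : Fin d → ℂ, ∑ l, algebraMap ℂ _ (c l) * e l ∈ I → c = 0 := by
  have := finite_quotient_of_pow_le hI
  have : Module.Free ℂ (LocRing X 0 ⧸ I) := Module.Free.of_divisionRing ℂ _
  let B := Module.finBasis ℂ (LocRing X 0 ⧸ I)
  choose e he using fun l => Ideal.Quotient.mk_surjective (B l)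
  have hsum : ∀ c : Fin _ → ℂ, Ideal.Quotient.mk I (∑ l, algebraMap ℂ _ (c l) * e l) =
      ∑ l, c l • B l := fun c => by
    rw [map_sum]
    refine Finset.sum_congr rfl fun l _ => ?_
    rw [map_mul, he, Algebra.smul_def]
    rfl
  refine ⟨_, e, fun a => ⟨B.repr (Ideal.Quotient.mk I a), ?_⟩, fun c hc => ?_⟩
  · rw [← Ideal.Quotient.eq, hsum, B.sum_repr]
  · rw [← Ideal.Quotient.eq_zero_iff_mem, hsum] at hc
    exact funext (Fintype.linearIndependent_iff.1 B.linearIndependent c hc)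

end FiniteCodimension

/-! ### Functions on `X × X` and their slices over the second factor. -/

section Slices

variable {n : ℕ} {X : Set (Fin n → ℂ)}

theorem pr₁_algebraMap (c : ℂ) :
    pr₁ X 0 (algebraMap ℂ _ c) = pr₂ X 0 (algebraMap ℂ _ c) := rfl

theorem exists_sub_pr₂_mem_map_coordIdeal (b : LocRing (X ×ˢ X) (0, 0)) :
    ∃ a : LocRing X 0, b - pr₂ X 0 a ∈ (coordIdeal X).map (pr₁ X 0) := by
  obtain ⟨F, hF, rfl⟩ := exists_eq_toGerm b
  obtain ⟨b, hb, h⟩ := exists_hadamard_fst hF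
  have hΘ : AnalyticAt ℂ (fun q : (Fin n → ℂ) × (Fin n → ℂ) => ((0 : Fin n → ℂ), q)) (0, 0) :=
    analyticAt_const.prod analyticAt_id
  have hbΘ : ∀ j, AnalyticAt ℂ (fun q : (Fin n → ℂ) × (Fin n → ℂ) => b j (0, q)) (0, 0) := fun j =>
    AnalyticAt.comp (g := b j) (hb j) hΘ
  have hF0 : AnalyticAt ℂ (fun w : Fin n → ℂ => F (0, w)) 0 :=
    AnalyticAt.comp (g := F) hF (analyticAt_const.prod analyticAt_id)
  have hc : ∀ j, AnalyticAt ℂ (fun q : (Fin n → ℂ) × (Fin n → ℂ) => q.1 j) (0, 0) := fun j =>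
    (isMapGerm_fst X 0).analyticAt_comp (analyticAt_coord j 0)
  refine ⟨toGerm X _ hF0, ?_⟩
  have : toGerm (X ×ˢ X) F hF - pr₂ X 0 (toGerm X _ hF0) =
      ∑ j, toGerm (X ×ˢ X) _ (hbΘ j) * toGerm (X ×ˢ X) _ (hc j) := by
    simp only [← toGerm_mul]
    rw [← toGerm_sum]
    refine (toGerm_sub hF ((isMapGerm_snd X 0).analyticAt_comp hF0)).symm.trans ?_
    refine (toGerm_eq_iff _ _).2 (nhdsWithin_le_nhds ?_)
    filter_upwards [hΘ.continuousAt.tendsto.eventually h] with q hq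
    simpa [mul_comm] using hq
  rw [this]
  exact Ideal.sum_mem _ fun j _ => Ideal.mul_mem_left _ _
    (Ideal.mem_map_of_mem (pr₁ X 0) (x := coordGerm X 0 j) (Ideal.subset_span ⟨j, rfl⟩))

variable {I : Ideal (LocRing X 0)} {N d : ℕ} {e : Fin d → LocRing X 0}

/-- Generators of `𝒪_X` modulo an ideal `I` of finite codimension generate `𝒪_{X × X}` modulo
`π₁^* I` over `π₂^* 𝒪_X`. -/
theorem exists_sub_sum_mem_map (hI : coordIdeal X ^ N ≤ I)
    (he : ∀ a, ∃ c : Fin d → ℂ, a - ∑ l, algebraMap ℂ _ (c l) * e l ∈ I)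
    (b : LocRing (X ×ˢ X) (0, 0)) :
    ∃ c : Fin d → LocRing X 0, b - ∑ l, pr₁ X 0 (e l) * pr₂ X 0 (c l) ∈ I.map (pr₁ X 0) := by
  -- Successive approximation modulo `m ^ k` in the first variable; it ends at `k = N` because `m ^
  -- N ≤ I`, so no convergence question arises.
  have key : ∀ k, ∃ c : Fin d → LocRing X 0, b - ∑ l, pr₁ X 0 (e l) * pr₂ X 0 (c l) ∈
      I.map (pr₁ X 0) ⊔ (coordIdeal X ^ k).map (pr₁ X 0) := by
    intro k
    induction k with
    | zero => exact ⟨0, by simp [Ideal.one_eq_top, Ideal.map_top]⟩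
    | succ k ih =>
      obtain ⟨c, hc⟩ := ih
      have hw' : ∀ w ∈ (coordIdeal X ^ k).map (pr₁ X 0), ∀ a : LocRing (X ×ˢ X) (0, 0), ∃ c : Fin d → LocRing X 0,
          a * w - ∑ l, pr₁ X 0 (e l) * pr₂ X 0 (c l) ∈
            I.map (pr₁ X 0) ⊔ (coordIdeal X ^ (k + 1)).map (pr₁ X 0) := by
        intro w hw
        induction hw using Submodule.span_induction with
        | mem w hw =>
          obtain ⟨s, hs, rfl⟩ := hw
          intro a
          obtain ⟨a₀, ha₀⟩ := exists_sub_pr₂_mem_map_coordIdeal a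
          obtain ⟨c, hc⟩ := he s
          refine ⟨fun l => algebraMap ℂ _ (c l) * a₀, ?_⟩
          have h1 : (a - pr₂ X 0 a₀) * pr₁ X 0 s ∈ (coordIdeal X ^ (k + 1)).map (pr₁ X 0) := by
            rw [pow_succ', Ideal.map_mul]
            exact Ideal.mul_mem_mul ha₀ (Ideal.mem_map_of_mem _ hs)
          have h2 : pr₂ X 0 a₀ * pr₁ X 0 (s - ∑ l, algebraMap ℂ _ (c l) * e l) ∈ I.map (pr₁ X 0) :=
            Ideal.mul_mem_left _ _ (Ideal.mem_map_of_mem _ hc)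
          convert Ideal.add_mem _ (Ideal.mem_sup_right h1) (Ideal.mem_sup_left h2) using 1
          simp only [map_sub, map_sum, map_mul, pr₁_algebraMap, mul_sub, Finset.mul_sum]
          rw [sub_mul, sub_add_sub_cancel]
          congr 1
          exact Finset.sum_congr rfl fun l _ => by ring
        | zero => exact fun a => ⟨0, by simp⟩
        | add u v _ _ hu hv =>
          intro a
          obtain ⟨c, hc⟩ := hu a
          obtain ⟨c', hc'⟩ := hv a
          refine ⟨c + c', ?_⟩
          convert Ideal.add_mem _ hc hc' using 1
          simp only [Pi.add_apply, map_add, mul_add, Finset.sum_add_distrib]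
          ring
        | smul b' u _ hu =>
          intro a
          obtain ⟨c, hc⟩ := hu (a * b')
          exact ⟨c, by rwa [smul_eq_mul, ← mul_assoc]⟩
      obtain ⟨i, hi, w, hw, hiw⟩ := Submodule.mem_sup.1 hc
      obtain ⟨c', hc'⟩ := hw' w hw 1
      refine ⟨c + c', ?_⟩
      convert Ideal.add_mem _ (Ideal.mem_sup_left hi) hc' using 1
      rw [one_mul, ← add_sub_assoc, hiw]
      simp only [Pi.add_apply, map_add, mul_add, Finset.sum_add_distrib]
      ring
  obtain ⟨c, hc⟩ := key N
  rw [sup_eq_left.2 (Ideal.map_mono hI)] at hc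
  exact ⟨c, hc⟩

theorem eventually_slice_eventuallyEq {F G : (Fin n → ℂ) × (Fin n → ℂ) → ℂ} (h : F =ᶠ[𝓝[X ×ˢ X] (0, 0)] G) :
    ∀ᶠ w in 𝓝[X] 0, (fun z => F (z, w)) =ᶠ[𝓝[X] 0] fun z => G (z, w) := by
  rw [nhdsWithin_prod_eq] at h
  exact (eventually_swap_iff.1 h).curry

/-- Freezing `w` turns a multiple of `g ∘ π₁` into a multiple of `g`. The choice of representative
is harmless, as equality near `(0,0)` on `X × X` passes to slices over nearby `w`. -/
theorem eventually_slice_mem {F : (Fin n → ℂ) × (Fin n → ℂ) → ℂ}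
    (hF : AnalyticAt ℂ F (0, 0)) (h : toGerm (X ×ˢ X) F hF ∈ I.map (pr₁ X 0)) :
    ∀ᶠ w in 𝓝[X] 0, ∃ g ∈ I, (g : Germ (𝓝[X] (0 : Fin n → ℂ)) ℂ) = (fun z => F (z, w) :) := by
  generalize hb : toGerm (X ×ˢ X) F hF = b at h
  suffices h : ∃ (G : (Fin n → ℂ) × (Fin n → ℂ) → ℂ) (hG : AnalyticAt ℂ G (0, 0)),
      b = toGerm (X ×ˢ X) G hG ∧
      ∀ᶠ w in 𝓝[X] 0, ∃ g ∈ I, (g : Germ (𝓝[X] (0 : Fin n → ℂ)) ℂ) = (fun z => G (z, w) :) by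
    obtain ⟨G, hG, hbG, h⟩ := h
    have h1 := eventually_slice_eventuallyEq ((toGerm_eq_iff hF hG).1 (hb.trans hbG))
    filter_upwards [h, h1] with w ⟨g, hg, hgG⟩ hw
    exact ⟨g, hg, hgG.trans (Germ.coe_eq.2 hw.symm)⟩
  clear hb hF F
  induction h using Submodule.span_induction with
  | mem b hb =>
    obtain ⟨g, hg, rfl⟩ := hb
    obtain ⟨G, hG, rfl⟩ := exists_eq_toGerm g
    exact ⟨fun q => G q.1, (isMapGerm_fst X 0).analyticAt_comp hG, rfl,
      Eventually.of_forall fun w => ⟨_, hg, rfl⟩⟩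
  | zero => exact ⟨fun _ => 0, analyticAt_const, rfl,
      Eventually.of_forall fun w => ⟨0, I.zero_mem, rfl⟩⟩
  | add a b _ _ ha hb =>
    obtain ⟨A, hA, rfl, hAs⟩ := ha
    obtain ⟨B, hB, rfl, hBs⟩ := hb
    refine ⟨fun q => A q + B q, hA.add hB, rfl, ?_⟩
    filter_upwards [hAs, hBs] with w ⟨a, ha, haA⟩ ⟨b, hb, hbB⟩
    exact ⟨a + b, I.add_mem ha hb, by rw [Subring.coe_add, haA, hbB]; rfl⟩
  | smul c a _ ha =>
    obtain ⟨A, hA, rfl, hAs⟩ := ha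
    obtain ⟨C, hC, rfl⟩ := exists_eq_toGerm c
    refine ⟨fun q => C q * A q, hC.mul hA, rfl, ?_⟩
    have hCw : ∀ᶠ w in 𝓝[X] (0 : Fin n → ℂ), AnalyticAt ℂ C (0, w) :=
      nhdsWithin_le_nhds (((Continuous.prodMk_right (0 : Fin n → ℂ)).tendsto' 0 (0, 0)
        rfl).eventually hC.eventually_analyticAt)
    filter_upwards [hAs, hCw] with w ⟨a, ha, haA⟩ hw
    have hw' : AnalyticAt ℂ (fun z : Fin n → ℂ => C (z, w)) 0 :=
      AnalyticAt.comp (g := C) (f := fun z => (z, w)) hw (analyticAt_id.prod analyticAt_const)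
    exact ⟨toGerm X _ hw' * a, I.mul_mem_left _ ha, by rw [Subring.coe_mul, haA]; rfl⟩

/-- A function on `X × X` whose slices lie in an ideal `I` of finite codimension lies in `π₁^* I`. -/
theorem mem_map_pr₁_of_eventually_slice_mem (hX : (𝓝[X \ {0}] (0 : Fin n → ℂ)).NeBot) (hI : coordIdeal X ^ N ≤ I)
    {F : (Fin n → ℂ) × (Fin n → ℂ) → ℂ} (hF : AnalyticAt ℂ F (0, 0))
    (h : ∀ᶠ w in 𝓝[X] 0, w ≠ 0 →
      ∃ g ∈ I, (g : Germ (𝓝[X] (0 : Fin n → ℂ)) ℂ) = (fun z => F (z, w) :)) :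
    toGerm (X ×ˢ X) F hF ∈ I.map (pr₁ X 0) := by
  obtain ⟨d, e, he, hind⟩ := exists_quotient_basis_lift hI
  obtain ⟨c, hc⟩ := exists_sub_sum_mem_map hI he (toGerm (X ×ˢ X) F hF)
  choose C hC hcC using fun l => exists_eq_toGerm (c l)
  choose E hE heE using fun l => exists_eq_toGerm (e l)
  have hEC : ∀ l, AnalyticAt ℂ (fun q : (Fin n → ℂ) × (Fin n → ℂ) => E l q.1 * C l q.2) (0, 0) :=
    fun l => ((isMapGerm_fst X 0).analyticAt_comp (hE l)).mul
      ((isMapGerm_snd X 0).analyticAt_comp (hC l))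
  have hS : AnalyticAt ℂ (fun q : (Fin n → ℂ) × (Fin n → ℂ) => ∑ l, E l q.1 * C l q.2) (0, 0) :=
    Finset.analyticAt_fun_sum _ fun l _ => hEC l
  have hsum : toGerm (X ×ˢ X) F hF - ∑ l, pr₁ X 0 (e l) * pr₂ X 0 (c l) =
      toGerm (X ×ˢ X) (fun q => F q - ∑ l, E l q.1 * C l q.2) (hF.sub hS) := by
    rw [toGerm_sub hF hS, toGerm_sum _ hEC]
    congr 1
    exact Finset.sum_congr rfl fun l _ => by rw [hcC, heE]; rfl
  have h1 := eventually_slice_mem (hF.sub hS) (hsum ▸ hc)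
  -- For fixed `w` the combination `∑ C_l(w) e_l` lies in `I`, and the `e_l` are linearly
  -- independent modulo `I`.
  have h2 : ∀ᶠ w in 𝓝[X] 0, w ≠ 0 → ∀ l, C l w = 0 := by
    filter_upwards [h, h1] with w hw ⟨g, hg, hgF⟩ hne
    obtain ⟨g', hg', hgF'⟩ := hw hne
    have h3 : g' - g = ∑ l, algebraMap ℂ _ (C l w) * e l := by
      have h4 : AnalyticAt ℂ (fun z => ∑ l, C l w * E l z) 0 :=
        Finset.analyticAt_fun_sum _ fun l _ => analyticAt_const.mul (hE l)
      have h5 : ∑ l, algebraMap ℂ _ (C l w) * e l = toGerm X _ h4 := by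
        rw [toGerm_sum (F := fun l z => C l w * E l z) _ fun l => analyticAt_const.mul (hE l)]
        exact Finset.sum_congr rfl fun l _ => by rw [heE]; rfl
      rw [h5]
      refine Subtype.ext ?_
      rw [AddSubgroupClass.coe_sub, hgF, hgF', ← Germ.coe_sub]
      refine Germ.coe_eq.2 (Eventually.of_forall fun z => ?_)
      simp [mul_comm]
    have h4 := hind (fun l => C l w) (h3 ▸ I.sub_mem hg' hg)
    exact fun l => congrFun h4 l
  have h3 : ∀ l, c l = 0 := fun l => by
    have h4 : ∀ᶠ w in 𝓝[X \ {0}] (0 : Fin n → ℂ), C l w = 0 := by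
      filter_upwards [nhdsWithin_mono _ Set.sdiff_subset h2, self_mem_nhdsWithin] with w hw hw'
      exact hw hw'.2 l
    -- The value at the origin is a limit along `X \ {0}`, which accumulates there.
    have h5 : C l 0 = 0 := tendsto_nhds_unique
      ((hC l).continuousAt.tendsto.mono_left nhdsWithin_le_nhds)
      ((tendsto_congr' h4).2 tendsto_const_nhds)
    rw [hcC, toGerm_eq_zero_iff]
    filter_upwards [h2] with w hw
    by_cases hw0 : w = 0
    · rw [hw0, h5]
    · exact hw hw0 l
  simpa [h3] using hc

end Slices

/-! ### Zeros of holomorphic functions in dimension at least two. -/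

section NotIsolated

variable {n : ℕ}

/-- In dimension at least two the zeros of a holomorphic function are not isolated. -/
theorem neBot_nhdsWithin_hypersurface_diff (hn : 2 ≤ n) {f : (Fin n → ℂ) → ℂ}
    (hf : AnalyticAt ℂ f 0) (h0 : f 0 = 0) :
    (𝓝[hypersurface f \ {0}] (0 : Fin n → ℂ)).NeBot := by
  rw [neBot_iff]
  intro hbot
  have hiso : ∀ᶠ z in 𝓝 (0 : Fin n → ℂ), f z = 0 → z = 0 := by
    have h1 : ∀ᶠ z in 𝓝[hypersurface f \ {0}] (0 : Fin n → ℂ), False := by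
      rw [hbot]; exact eventually_bot
    filter_upwards [eventually_nhdsWithin_iff.1 h1] with z hz hfz
    by_contra hne
    exact hz ⟨hfz, hne⟩
  let i0 : Fin n := ⟨0, by omega⟩
  let i1 : Fin n := ⟨1, by omega⟩
  have hi : i0 ≠ i1 := by simp [i0, i1]
  -- Restriction to a coordinate plane: were the zero isolated, `1/f` would be holomorphic on each
  -- disc `ζ ↦ (ζ, t)` with `t ≠ 0` small. There `‖f‖` exceeds `δ/2` on the circle but is below
  -- `δ/2` at the centre, against the maximum principle.
  let Θ : ℂ × ℂ → Fin n → ℂ := fun p => Pi.single i0 p.1 + Pi.single i1 p.2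
  have hΘ : Differentiable ℂ Θ := by
    have h1 : Differentiable ℂ fun z : ℂ => (Pi.single i0 z : Fin n → ℂ) :=
      (ContinuousLinearMap.single ℂ (fun _ : Fin n => ℂ) i0).differentiable
    have h2 : Differentiable ℂ fun z : ℂ => (Pi.single i1 z : Fin n → ℂ) :=
      (ContinuousLinearMap.single ℂ (fun _ : Fin n => ℂ) i1).differentiable
    exact (h1.comp differentiable_fst).add (h2.comp differentiable_snd)
  have hΘ0 : Θ (0, 0) = 0 := by simp [Θ]
  have hΘt : Tendsto Θ (𝓝 (0, 0)) (𝓝 0) := hΘ0 ▸ hΘ.continuous.tendsto (0, 0)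
  have hg : ∀ᶠ p in 𝓝 ((0, 0) : ℂ × ℂ),
      (f (Θ p) = 0 → Θ p = 0) ∧ DifferentiableAt ℂ (fun p => f (Θ p)) p := by
    filter_upwards [hΘt.eventually hiso, hΘt.eventually hf.eventually_analyticAt] with p h1 h2
    exact ⟨h1, h2.differentiableAt.comp p (hΘ p)⟩
  obtain ⟨ε, hε, hball⟩ := Metric.eventually_nhds_iff.1 hg
  have hball' : ∀ ζ t : ℂ, ‖ζ‖ < ε → ‖t‖ < ε → (f (Θ (ζ, t)) = 0 → Θ (ζ, t) = 0) ∧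
      DifferentiableAt ℂ (fun p => f (Θ p)) (ζ, t) := fun ζ t h1 h2 => by
    refine hball ?_
    rw [dist_eq_norm, Prod.mk_zero_zero, sub_zero]
    exact max_lt h1 h2
  set r := ε / 2 with hr
  have hr0 : 0 < r := by positivity
  have hrε : r < ε := by rw [hr]; linarith
  have hK : IsCompact (Metric.sphere (0 : ℂ) r) := isCompact_sphere _ _
  have hΘne : ∀ ζ : ℂ, ζ ≠ 0 → Θ (ζ, 0) ≠ 0 := fun ζ hζ h => hζ (by
    have := congrFun h i0
    simpa [Θ] using this)
  obtain ⟨δ, hδ, hδle⟩ : ∃ δ > 0, ∀ ζ ∈ Metric.sphere (0 : ℂ) r, δ ≤ ‖f (Θ (ζ, 0))‖ := by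
    have hcont : ContinuousOn (fun ζ : ℂ => ‖f (Θ (ζ, 0))‖) (Metric.sphere (0 : ℂ) r) := by
      intro ζ hζ
      rw [mem_sphere_zero_iff_norm] at hζ
      have h1 := (hball' ζ 0 (by rw [hζ]; exact hrε) (by simpa using hε)).2.continuousAt
      exact (ContinuousAt.comp (f := fun ζ : ℂ => (ζ, (0 : ℂ))) (g := fun p => f (Θ p)) h1
        (by fun_prop)).norm.continuousWithinAt
    obtain ⟨ζ₀, hζ₀, hmin⟩ := hK.exists_isMinOn
      (NormedSpace.sphere_nonempty.2 hr0.le) hcont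
    refine ⟨‖f (Θ (ζ₀, 0))‖, norm_pos_iff.2 fun h => ?_, fun ζ hζ => hmin hζ⟩
    rw [mem_sphere_zero_iff_norm] at hζ₀
    refine hΘne ζ₀ (norm_pos_iff.1 (hζ₀ ▸ hr0)) ((hball' ζ₀ 0 (by rw [hζ₀]; exact hrε)
      (by simpa using hε)).1 h)
  have hunif : ∀ᶠ t in 𝓝 (0 : ℂ), ∀ ζ ∈ Metric.sphere (0 : ℂ) r, δ / 2 < ‖f (Θ (ζ, t))‖ := by
    refine hK.eventually_forall_of_forall_eventually fun ζ hζ => ?_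
    have hζr : ‖ζ‖ = r := mem_sphere_zero_iff_norm.1 hζ
    have h1 := (hball' ζ 0 (by rw [hζr]; exact hrε) (by simpa using hε)).2.continuousAt
    have h2 : ContinuousAt (fun p : ℂ × ℂ => ‖f (Θ (p.2, p.1))‖) (0, ζ) :=
      (ContinuousAt.comp (f := Prod.swap) (g := fun p => f (Θ p)) (x := ((0 : ℂ), ζ)) h1
        continuous_swap.continuousAt).norm
    exact h2.eventually (lt_mem_nhds (by simpa using lt_of_lt_of_le (half_lt_self hδ) (hδle ζ hζ)))
  have hsmall : ∀ᶠ t in 𝓝 (0 : ℂ), ‖f (Θ (0, t))‖ < δ / 2 := by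
    have h1 : ContinuousAt (fun t : ℂ => ‖f (Θ (0, t))‖) 0 :=
      (ContinuousAt.comp (f := fun t : ℂ => ((0 : ℂ), t)) (g := fun p => f (Θ p))
        (hball' 0 0 (by simpa using hε) (by simpa using hε)).2.continuousAt
        (by fun_prop)).norm
    refine h1.eventually (gt_mem_nhds ?_)
    change ‖f (Θ (0, 0))‖ < δ / 2
    rw [hΘ0, h0, norm_zero]
    positivity
  have hε' : ∀ᶠ t in 𝓝 (0 : ℂ), ‖t‖ < ε := by
    filter_upwards [Metric.ball_mem_nhds (0 : ℂ) hε] with t ht using mem_ball_zero_iff.1 ht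
  obtain ⟨t, ⟨h1, h2, h3⟩, ht : t ≠ 0⟩ := (((hunif.and (hsmall.and hε')).filter_mono
    nhdsWithin_le_nhds).and (self_mem_nhdsWithin (s := {0}ᶜ) (a := (0 : ℂ)))).exists
  have hne : ∀ ζ : ℂ, ‖ζ‖ < ε → f (Θ (ζ, t)) ≠ 0 := fun ζ hζ h => ht (by
    have := congrFun ((hball' ζ t hζ h3).1 h) i1
    simpa [Θ, hi.symm] using this)
  have hd : ∀ ζ ∈ Metric.closedBall (0 : ℂ) r,
      DifferentiableAt ℂ (fun ζ => (f (Θ (ζ, t)))⁻¹) ζ := fun ζ hζ => by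
    have hζr : ‖ζ‖ < ε := (mem_closedBall_zero_iff.1 hζ).trans_lt hrε
    refine DifferentiableAt.inv ?_ (hne ζ hζr)
    exact DifferentiableAt.comp (f := fun ζ : ℂ => (ζ, t)) (g := fun p => f (Θ p)) ζ
      (hball' ζ t hζr h3).2 (by fun_prop)
  have hdc : DiffContOnCl ℂ (fun ζ => (f (Θ (ζ, t)))⁻¹) (Metric.ball 0 r) := by
    refine DifferentiableOn.diffContOnCl fun ζ hζ => ?_
    rw [closure_ball _ hr0.ne'] at hζ
    exact (hd ζ hζ).differentiableWithinAt
  have hmax := Complex.norm_le_of_forall_mem_frontier_norm_le (C := (δ / 2)⁻¹)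
    Metric.isBounded_ball hdc (fun ζ hζ => by
      rw [frontier_ball _ hr0.ne'] at hζ
      rw [norm_inv]
      exact inv_anti₀ (by positivity) (h1 ζ hζ).le) (z := 0)
    (subset_closure (Metric.mem_ball_self hr0))
  rw [norm_inv] at hmax
  have := (inv_le_inv₀ (norm_pos_iff.2 (hne 0 (by simpa using hε))) (by positivity)).1 hmax
  linarith

end NotIsolated

/-! ### Integral dependence on the double away from the origin. -/

section OffTheOrigin

variable {n : ℕ} {X : Set (Fin n → ℂ)}

/-- The pair of functions `(H ∘ π₁, H ∘ π₂)`. -/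
def doublePair (H : (Fin n → ℂ) → ℂ) : Fin 2 → (Fin n → ℂ) × (Fin n → ℂ) → ℂ :=
  ![fun q => H q.1, fun q => H q.2]

theorem analyticAt_doublePair {H : (Fin n → ℂ) → ℂ} {p : (Fin n → ℂ) × (Fin n → ℂ)}
    (h1 : AnalyticAt ℂ H p.1) (h2 : AnalyticAt ℂ H p.2) (i : Fin 2) :
    AnalyticAt ℂ (doublePair H i) p := by
  fin_cases i
  exacts [AnalyticAt.comp (g := H) h1 analyticAt_fst, AnalyticAt.comp (g := H) h2 analyticAt_snd]

theorem isGermOf_doubleElt {x : Fin n → ℂ} {H : (Fin n → ℂ) → ℂ} (hH : AnalyticAt ℂ H x) :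
    IsGermOf (doubleElt (toGerm X H hH)) (doublePair H) := by
  intro i
  fin_cases i <;> rfl

/-- Off the diagonal some `z_j - w_j` is a unit along every curve. The pulled-back module then
contains `(0, G k ∘ π₂)`, hence also `(G k ∘ π₁, 0)`, and the two components decouple. -/
theorem mem_intClosure_stalk_doubleGens_of_ne {κ : Type*} {a b : Fin n → ℂ} (hab : a ≠ b)
    {G : κ → (Fin n → ℂ) → ℂ} (hGa : ∀ k, AnalyticAt ℂ (G k) a) (hGb : ∀ k, AnalyticAt ℂ (G k) b)
    {H : (Fin n → ℂ) → ℂ} (hHa : AnalyticAt ℂ H a) (hHb : AnalyticAt ℂ H b)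
    (h1 : toGerm X H hHa ∈ idealClosure (Ideal.span (Set.range fun k => toGerm X (G k) (hGa k))))
    (h2 : toGerm X H hHb ∈ idealClosure (Ideal.span (Set.range fun k => toGerm X (G k) (hGb k)))) :
    (fun i => toGerm (X ×ˢ X) (doublePair H i) (analyticAt_doublePair (p := (a, b)) hHa hHb i)) ∈
      intClosure (stalk (X ×ˢ X) (doubleGens G) (a, b)) := by
  intro φ hφ
  have hφ1 : IsCurve X a fun t => (φ t).1 := ⟨analyticAt_fst.comp hφ.analyticAt,
    congrArg Prod.fst hφ.map_point, hφ.map_set.mono fun _ h => h.1⟩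
  have hφ2 : IsCurve X b fun t => (φ t).2 := ⟨analyticAt_snd.comp hφ.analyticAt,
    congrArg Prod.snd hφ.map_point, hφ.map_set.mono fun _ h => h.2⟩
  have h1 := h1 _ hφ1
  have h2 := h2 _ hφ2
  rw [Ideal.map_span, ← Set.range_comp] at h1 h2
  rw [pullbackModule_stalk (p := (a, b)) (fun k i => analyticAt_doubleGens hGa hGb k i) hφ]
  set M := Submodule.span LocRingOne (Set.range fun k i => toGerm Set.univ
    (fun t => doubleGens G k i (φ t))
      (hφ.analyticAt_comp (analyticAt_doubleGens (p := (a, b)) hGa hGb k i))) with hM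
  have hsecond : ∀ c ∈ Ideal.span (Set.range (pullback hφ2 ∘ fun k => toGerm X (G k) (hGb k))),
      (![0, c] : Fin 2 → LocRingOne) ∈ M := by
    intro c hc
    induction hc using Submodule.span_induction with
    | mem c hc =>
      obtain ⟨k, rfl⟩ := hc
      obtain ⟨j, hj⟩ := Function.ne_iff.1 hab
      have hu := isUnit_toGerm (Y := Set.univ) (hφ.analyticAt_comp (analyticAt_coord_sub j (a, b)))
        (by rw [hφ.map_point]; exact sub_ne_zero.2 hj)
      rw [← M.smul_mem_iff_of_isUnit hu]
      refine Submodule.subset_span ⟨(some j, k), ?_⟩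
      funext i
      fin_cases i
      · exact (mul_zero _).symm
      · rfl
    | zero => convert M.zero_mem; simp
    | add u v _ _ hu hv => simpa using M.add_mem hu hv
    | smul c u _ hu => simpa using M.smul_mem c hu
  have hfirst : ∀ c ∈ Ideal.span (Set.range (pullback hφ1 ∘ fun k => toGerm X (G k) (hGa k))),
      (![c, 0] : Fin 2 → LocRingOne) ∈ M := by
    intro c hc
    induction hc using Submodule.span_induction with
    | mem c hc =>
      obtain ⟨k, rfl⟩ := hc
      convert M.sub_mem (Submodule.subset_span ⟨(none, k), rfl⟩)
        (hsecond _ (Ideal.subset_span ⟨k, rfl⟩)) using 1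
      funext i
      fin_cases i
      · exact (sub_zero _).symm
      · exact (sub_self _).symm
    | zero => convert M.zero_mem; simp
    | add u v _ _ hu hv => simpa using M.add_mem hu hv
    | smul c u _ hu => simpa using M.smul_mem c hu
  convert M.add_mem (hfirst _ h1) (hsecond _ h2) using 1
  funext i
  fin_cases i
  · exact (add_zero _).symm
  · exact (zero_add _).symm

theorem span_toGerm_eq_top {κ : Type*} {a : Fin n → ℂ} {G : κ → (Fin n → ℂ) → ℂ}
    (hG : ∀ k, AnalyticAt ℂ (G k) a) {k : κ} (hk : G k a ≠ 0) :
    Ideal.span (Set.range fun k => toGerm X (G k) (hG k)) = ⊤ :=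
  Ideal.eq_top_of_isUnit_mem _ (Ideal.subset_span ⟨k, rfl⟩) (isUnit_toGerm (hG k) hk)

theorem mem_stalk_doubleGens_diag {κ : Type*} {a : Fin n → ℂ} {G : κ → (Fin n → ℂ) → ℂ}
    (hG : ∀ k, AnalyticAt ℂ (G k) a) {k : κ} (hk : G k a ≠ 0) (g : LocRing X a) :
    doubleElt g ∈ stalk (X ×ˢ X) (doubleGens G) (a, a) := by
  rw [stalk_doubleGens hG, span_toGerm_eq_top hG hk]
  exact Submodule.subset_span ⟨g, trivial, rfl⟩

theorem mem_idealClosure_span_toGerm_of_ne_zero {κ : Type*} {a : Fin n → ℂ} {G : κ → (Fin n → ℂ) → ℂ}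
    (hG : ∀ k, AnalyticAt ℂ (G k) a) {k : κ} (hk : G k a ≠ 0) (g : LocRing X a) :
    g ∈ idealClosure (Ideal.span (Set.range fun k => toGerm X (G k) (hG k))) := by
  refine le_idealClosure _ ?_
  rw [span_toGerm_eq_top hG hk]
  trivial

/-- At a nonzero point of `X` some partial derivative is a unit, so integrality over `J` is
automatic; at `0` it is the hypothesis on `g`. Diagonal points other than the origin have unit
Jacobian ideal, and all other points are covered by the decoupling. -/
theorem eventually_mem_intClosure_doubleGens {f : (Fin n → ℂ) → ℂ}
    (hf : IsIsolatedHypersurfaceSingularity f)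
    {w : Fin 2 → LocRing (hypersurface f ×ˢ hypersurface f) (0, 0)}
    (hw : w ∈ double (idealClosure (jacobianIdeal hf.analyticAt)))
    {F : Fin 2 → (Fin n → ℂ) × (Fin n → ℂ) → ℂ} (hF : IsGermOf w F) :
    ∀ᶠ p in 𝓝[hypersurface f ×ˢ hypersurface f] (0, 0), p ∉ ({(0, 0)} : Set _) →
      ∃ g ∈ intClosure (stalk (hypersurface f ×ˢ hypersurface f) (doubleGens (partialDeriv f)) p),
        IsGermOf g F := by
  refine eventually_mem_of_mem_span ?_ hw hF
  rintro _ ⟨g, hg, rfl⟩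
  obtain ⟨H, hH, rfl⟩ := exists_eq_toGerm g
  refine ⟨doublePair H, isGermOf_doubleElt hH, ?_⟩
  have hU : ∀ᶠ z in 𝓝 (0 : Fin n → ℂ), AnalyticAt ℂ f z ∧ AnalyticAt ℂ H z ∧
      (z ≠ 0 → f z = 0 → ∃ k, partialDeriv f k z ≠ 0) := by
    filter_upwards [hf.analyticAt.eventually_analyticAt, hH.eventually_analyticAt,
      eventually_nhdsWithin_iff.1 hf.isolated] with z h1 h2 h3
    refine ⟨h1, h2, fun hz hfz => ?_⟩
    by_contra! hall
    exact h3 hz hfz (fderiv_eq_zero_of_partialDeriv hall)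
  have hUU : ∀ᶠ p in 𝓝[hypersurface f ×ˢ hypersurface f] ((0, 0) : (Fin n → ℂ) × (Fin n → ℂ)),
      _ := nhdsWithin_le_nhds (hU.prod_nhds hU)
  filter_upwards [hUU, self_mem_nhdsWithin] with p ⟨⟨hfa, hHa, ha⟩, ⟨hfb, hHb, hb⟩⟩ hp hne
  obtain ⟨a, b⟩ := p
  simp only at hfa hHa ha hfb hHb hb
  have hcl : ∀ c : Fin n → ℂ, ∀ (hfc : AnalyticAt ℂ f c) (hHc : AnalyticAt ℂ H c),
      (c ≠ 0 → f c = 0 → ∃ k, partialDeriv f k c ≠ 0) → c ∈ hypersurface f →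
      toGerm (hypersurface f) H hHc ∈ idealClosure (Ideal.span (Set.range fun k =>
        toGerm (hypersurface f) (partialDeriv f k) (analyticAt_partialDeriv hfc k))) := by
    intro c hfc hHc hc hcX
    by_cases hc0 : c = 0
    · subst hc0
      exact hg
    · obtain ⟨k, hk⟩ := hc hc0 hcX
      exact mem_idealClosure_span_toGerm_of_ne_zero _ hk _
  by_cases hab : a = b
  · subst hab
    obtain ⟨k, hk⟩ := ha (fun h0 => hne (by rw [h0]; rfl)) hp.1
    exact ⟨_, le_intClosure _ (mem_stalk_doubleGens_diag (analyticAt_partialDeriv hfa) hk _),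
      isGermOf_doubleElt hHa⟩
  · exact ⟨_, mem_intClosure_stalk_doubleGens_of_ne hab (analyticAt_partialDeriv hfa)
      (analyticAt_partialDeriv hfb) hHa hHb (hcl a hfa hHa ha hp.1) (hcl b hfb hHb hb hp.2),
      isGermOf_toGerm _⟩

section Curves

variable {κ : Type*} {G : κ → (Fin n → ℂ) → ℂ} {a b : Fin n → ℂ}

/-- Only curves `(ψ(t), b)` are tested. The first components of the generators are `G k ∘ π₁` and
`0`, so projecting gives the curve condition for the ideal. -/
theorem slice_fst_mem_of_mem_intClosure (hGa : ∀ k, AnalyticAt ℂ (G k) a)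
    (hGb : ∀ k, AnalyticAt ℂ (G k) b) (hb : b ∈ X)
    {F : Fin 2 → (Fin n → ℂ) × (Fin n → ℂ) → ℂ} (hF : ∀ i, AnalyticAt ℂ (F i) (a, b))
    {g : Fin 2 → LocRing (X ×ˢ X) (a, b)} (hgF : IsGermOf g F)
    (hg : g ∈ intClosure (stalk (X ×ˢ X) (doubleGens G) (a, b)))
    (hF' : AnalyticAt ℂ (fun z => F 0 (z, b)) a) :
    toGerm X (fun z => F 0 (z, b)) hF' ∈
      idealClosure (Ideal.span (Set.range fun k => toGerm X (G k) (hGa k))) := by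
  intro ψ hψ
  have hφ : IsCurve (X ×ˢ X) (a, b) fun t => (ψ t, b) := ⟨hψ.analyticAt.prod analyticAt_const,
    Prod.ext hψ.map_point rfl, hψ.map_set.mono fun _ h => ⟨h, hb⟩⟩
  have h := hg _ hφ
  rw [hgF.eq_toGerm hF, pullbackModule_stalk (p := (a, b))
    (fun k i => analyticAt_doubleGens hGa hGb k i) hφ] at h
  rw [Ideal.map_span, ← Set.range_comp]
  have h1 := Submodule.mem_map_of_mem (f := LinearMap.proj (R := LocRingOne)
    (φ := fun _ : Fin 2 => LocRingOne) 0) h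
  rw [Submodule.map_span, ← Set.range_comp] at h1
  refine Submodule.span_le.2 ?_ h1
  rintro _ ⟨⟨o, k⟩, rfl⟩
  cases o with
  | none => exact Ideal.subset_span ⟨k, rfl⟩
  | some j => exact Ideal.zero_mem _

theorem slice_snd_mem_of_mem_intClosure (hGa : ∀ k, AnalyticAt ℂ (G k) a)
    (hGb : ∀ k, AnalyticAt ℂ (G k) b) (ha : a ∈ X)
    {F : Fin 2 → (Fin n → ℂ) × (Fin n → ℂ) → ℂ} (hF : ∀ i, AnalyticAt ℂ (F i) (a, b))
    {g : Fin 2 → LocRing (X ×ˢ X) (a, b)} (hgF : IsGermOf g F)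
    (hg : g ∈ intClosure (stalk (X ×ˢ X) (doubleGens G) (a, b)))
    (hF' : AnalyticAt ℂ (fun z => F 1 (a, z)) b) :
    toGerm X (fun z => F 1 (a, z)) hF' ∈
      idealClosure (Ideal.span (Set.range fun k => toGerm X (G k) (hGb k))) := by
  intro ψ hψ
  have hφ : IsCurve (X ×ˢ X) (a, b) fun t => (a, ψ t) := ⟨analyticAt_const.prod hψ.analyticAt,
    Prod.ext rfl hψ.map_point, hψ.map_set.mono fun _ h => ⟨ha, h⟩⟩
  have h := hg _ hφ
  rw [hgF.eq_toGerm hF, pullbackModule_stalk (p := (a, b))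
    (fun k i => analyticAt_doubleGens hGa hGb k i) hφ] at h
  rw [Ideal.map_span, ← Set.range_comp]
  have h1 := Submodule.mem_map_of_mem (f := LinearMap.proj (R := LocRingOne)
    (φ := fun _ : Fin 2 => LocRingOne) 1) h
  rw [Submodule.map_span, ← Set.range_comp] at h1
  refine Submodule.span_le.2 ?_ h1
  rintro _ ⟨⟨o, k⟩, rfl⟩
  cases o with
  | none => exact Ideal.subset_span ⟨k, rfl⟩
  | some j =>
    exact Ideal.mul_mem_left _ (toGerm Set.univ _ (hφ.analyticAt_comp
      (analyticAt_coord_sub j (a, b)))) (b := toGerm Set.univ _ (hψ.analyticAt_comp (hGb k)))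
        (Ideal.subset_span ⟨k, rfl⟩)

/-- Every generator has equal components on the diagonal; the constant curve at `(a, a)` transfers
this to the values of integral elements. -/
theorem apply_diag_eq_of_mem_intClosure (hGa : ∀ k, AnalyticAt ℂ (G k) a) (ha : a ∈ X)
    {F : Fin 2 → (Fin n → ℂ) × (Fin n → ℂ) → ℂ} (hF : ∀ i, AnalyticAt ℂ (F i) (a, a))
    {g : Fin 2 → LocRing (X ×ˢ X) (a, a)} (hgF : IsGermOf g F)
    (hg : g ∈ intClosure (stalk (X ×ˢ X) (doubleGens G) (a, a))) :
    F 0 (a, a) = F 1 (a, a) := by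
  have hφ : IsCurve (X ×ˢ X) (a, a) fun _ => (a, a) :=
    ⟨analyticAt_const, rfl, Eventually.of_forall fun _ => ⟨ha, ha⟩⟩
  have h := hg _ hφ
  rw [hgF.eq_toGerm hF, pullbackModule_stalk (p := (a, a))
    (fun k i => analyticAt_doubleGens hGa hGa k i) hφ] at h
  have h1 : Submodule.span LocRingOne (Set.range fun k i => toGerm Set.univ
      (fun _ => doubleGens G k i (a, a)) (hφ.analyticAt_comp
        (analyticAt_doubleGens (p := (a, a)) hGa hGa k i))) ≤
      LinearMap.ker (LinearMap.proj (R := LocRingOne) (φ := fun _ : Fin 2 => LocRingOne) 0 -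
        LinearMap.proj 1) := by
    refine Submodule.span_le.2 ?_
    rintro _ ⟨⟨o, k⟩, rfl⟩
    refine LinearMap.mem_ker.2 (sub_eq_zero.2 ?_)
    cases o with
    | none => rfl
    | some j =>
      refine (toGerm_eq_iff analyticAt_const analyticAt_const).2 (Eventually.of_forall fun t => ?_)
      simp [doubleGens]
  have h2 := sub_eq_zero.1 (LinearMap.mem_ker.1 (h1 h))
  have h3 := (toGerm_eq_iff (hφ.analyticAt_comp (hF 0)) (hφ.analyticAt_comp (hF 1))).1 h2
  rw [nhdsWithin_univ] at h3
  exact h3.self_of_nhds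

end Curves

theorem isMapGerm_swap (X : Set (Fin n → ℂ)) (x : Fin n → ℂ) :
    IsMapGerm (X ×ˢ X) (x, x) (X ×ˢ X) (x, x) Prod.swap :=
  ⟨analyticAt_snd.prod analyticAt_fst, rfl, eventually_nhdsWithin_of_forall fun _ h => ⟨h.2, h.1⟩⟩

theorem map_pr₁_map_swap {x : Fin n → ℂ} (I : Ideal (LocRing X x)) :
    (I.map (pr₁ X x)).map (pullback (isMapGerm_swap X x)) = I.map (pr₂ X x) := by
  rw [Ideal.map_map]
  congr 1
  ext a
  obtain ⟨F, hF, rfl⟩ := exists_eq_toGerm a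
  rfl

/-- Sections that are integral over the double of the Jacobian ideal off the origin belong to the
double of the integral closure of the Jacobian ideal. -/
theorem mem_double_idealClosure_of_integralOff (hn : 2 ≤ n) {f : (Fin n → ℂ) → ℂ}
    (hf : IsIsolatedHypersurfaceSingularity f)
    {h : Fin 2 → LocRing (hypersurface f ×ˢ hypersurface f) (0, 0)}
    (hh : IntegralOff (double (jacobianIdeal hf.analyticAt)) {(0, 0)} h) :
    h ∈ double (idealClosure (jacobianIdeal hf.analyticAt)) := by
  obtain ⟨r, s, F, ⟨hs, hsM⟩, hF, hhF, hev⟩ := hh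
  set X := hypersurface f with hX
  have h0 : (0 : Fin n → ℂ) ∈ X := hf.map_zero
  have hne := neBot_nhdsWithin_hypersurface_diff hn hf.analyticAt hf.map_zero
  obtain ⟨N, hN⟩ := exists_coordIdeal_pow_le hf
  -- The given generators may be exchanged for the explicit ones: the inclusion of stalks at the
  -- origin persists nearby.
  have hle := eventually_stalk_le (s' := doubleGens (partialDeriv f)) hs
    (analyticAt_doubleGens (analyticAt_partialDeriv hf.analyticAt)
      (analyticAt_partialDeriv hf.analyticAt))
    (hsM.trans (stalk_doubleGens (analyticAt_partialDeriv hf.analyticAt)).symm).le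
  have han : ∀ᶠ p in 𝓝[X ×ˢ X] (0, 0), ∀ i, AnalyticAt ℂ (F i) p :=
    nhdsWithin_le_nhds (eventually_all.2 fun i => (hF i).eventually_analyticAt)
  have hmain : ∀ᶠ p in 𝓝[X ×ˢ X] ((0, 0) : (Fin n → ℂ) × (Fin n → ℂ)),
      (∀ i, AnalyticAt ℂ (F i) p) ∧ (p ≠ (0, 0) →
        ∃ g ∈ intClosure (stalk (X ×ˢ X) (doubleGens (partialDeriv f)) p), IsGermOf g F) := by
    filter_upwards [han, hle, hev] with p h1 h2 h3
    refine ⟨h1, fun hp => ?_⟩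
    obtain ⟨g, hg, hgF⟩ := h3 hp
    exact ⟨g, intClosure_mono h2 hg, hgF⟩
  have hfan : ∀ᶠ w in 𝓝[X] (0 : Fin n → ℂ), AnalyticAt ℂ f w :=
    nhdsWithin_le_nhds hf.analyticAt.eventually_analyticAt
  have htend : ∀ φ : (Fin n → ℂ) → (Fin n → ℂ) × (Fin n → ℂ), Continuous φ → φ 0 = (0, 0) →
      (∀ w ∈ X, φ w ∈ X ×ˢ X) → Tendsto φ (𝓝[X] 0) (𝓝[X ×ˢ X] (0, 0)) :=
    fun φ hφ hφ0 hφX => tendsto_nhdsWithin_iff.2 ⟨(hφ.tendsto' 0 _ hφ0).mono_left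
      nhdsWithin_le_nhds, eventually_nhdsWithin_of_forall hφX⟩
  have hG0 := analyticAt_partialDeriv hf.analyticAt
  -- Integrality is used at the points `(0, w)`, `w ≠ 0`, in the direction of the first factor; the
  -- second component follows from the points `(w, 0)` and the swap of factors.
  have hfst : toGerm (X ×ˢ X) (F 0) (hF 0) ∈
      (idealClosure (jacobianIdeal hf.analyticAt)).map (pr₁ X 0) := by
    refine mem_map_pr₁_of_eventually_slice_mem hne hN (hF 0) ?_
    filter_upwards [(htend (fun w => (0, w)) (by fun_prop) rfl fun w hw => ⟨h0, hw⟩).eventually hmain,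
      hfan, self_mem_nhdsWithin] with w ⟨h1, h2⟩ h3 hw hw0
    obtain ⟨g, hg, hgF⟩ := h2 fun h => hw0 (congrArg Prod.snd h)
    have h4 : AnalyticAt ℂ (fun z => F 0 (z, w)) 0 := AnalyticAt.comp (g := F 0)
      (f := fun z => (z, w)) (h1 0) (analyticAt_id.prod analyticAt_const)
    exact ⟨_, slice_fst_mem_of_mem_intClosure hG0 (analyticAt_partialDeriv h3) hw h1 hgF hg h4, rfl⟩
  have hsnd : toGerm (X ×ˢ X) (F 1) (hF 1) ∈
      (idealClosure (jacobianIdeal hf.analyticAt)).map (pr₂ X 0) := by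
    have hFs : AnalyticAt ℂ (fun q => F 1 (Prod.swap q)) ((0 : Fin n → ℂ), (0 : Fin n → ℂ)) :=
      (isMapGerm_swap X 0).analyticAt_comp (hF 1)
    suffices h : toGerm (X ×ˢ X) _ hFs ∈
        (idealClosure (jacobianIdeal hf.analyticAt)).map (pr₁ X 0) by
      rw [← map_pr₁_map_swap]
      exact Ideal.mem_map_of_mem (pullback (isMapGerm_swap X 0)) h
    refine mem_map_pr₁_of_eventually_slice_mem hne hN hFs ?_
    filter_upwards [(htend (fun w => (w, 0)) (by fun_prop) rfl fun w hw => ⟨hw, h0⟩).eventually hmain,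
      hfan, self_mem_nhdsWithin] with w ⟨h1, h2⟩ h3 hw hw0
    obtain ⟨g, hg, hgF⟩ := h2 fun h => hw0 (congrArg Prod.fst h)
    have h4 : AnalyticAt ℂ (fun z => F 1 (w, z)) 0 := AnalyticAt.comp (g := F 1)
      (f := fun z => (w, z)) (h1 1) (analyticAt_const.prod analyticAt_id)
    exact ⟨_, slice_snd_mem_of_mem_intClosure (analyticAt_partialDeriv h3) hG0 hw h1 hgF hg h4, rfl⟩
  rw [hhF.eq_toGerm hF]
  refine mem_double_of_diagRes_eq hfst hsnd ?_
  have hdiag := htend (fun w => (w, w)) (by fun_prop) rfl fun w hw => ⟨hw, hw⟩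
  have hd : ∀ᶠ w in 𝓝[X] (0 : Fin n → ℂ), w ≠ 0 → F 0 (w, w) = F 1 (w, w) := by
    filter_upwards [hdiag.eventually hmain, hfan, self_mem_nhdsWithin] with w ⟨h1, h2⟩ h3 hw hw0
    obtain ⟨g, hg, hgF⟩ := h2 fun h => hw0 (congrArg Prod.fst h)
    exact apply_diag_eq_of_mem_intClosure (analyticAt_partialDeriv h3) hw h1 hgF hg
  have hF0 := fun i => (isMapGerm_diag X 0).analyticAt_comp (hF i)
  -- Nothing is known at the origin itself; equality there comes by continuity along `X \ {0}`.
  have hd0 : F 0 (0, 0) = F 1 (0, 0) := by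
    refine tendsto_nhds_unique_of_eventuallyEq (l := 𝓝[X \ {0}] (0 : Fin n → ℂ))
      ((hF0 0).continuousAt.tendsto.mono_left nhdsWithin_le_nhds)
      ((hF0 1).continuousAt.tendsto.mono_left nhdsWithin_le_nhds) ?_
    filter_upwards [nhdsWithin_mono _ Set.sdiff_subset hd, self_mem_nhdsWithin] with w hw hw'
    exact hw hw'.2
  refine (toGerm_eq_iff (hF0 0) (hF0 1)).2 ?_
  filter_upwards [hd] with w hw
  by_cases hw0 : w = 0
  · rw [hw0]; exact hd0
  · exact hw hw0

end OffTheOrigin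

/-! ### The integral hull and the maximality statement. -/

section Main

variable {n : ℕ}

theorem generates_doubleGens {X : Set (Fin n → ℂ)} {κ : Type*} {r : ℕ} (e : Fin r ≃ Option (Fin n) × κ)
    {G : κ → (Fin n → ℂ) → ℂ} (hG : ∀ k, AnalyticAt ℂ (G k) 0) :
    Generates (fun i => doubleGens G (e i))
      (double (Ideal.span (Set.range fun k => toGerm X (G k) (hG k)))) :=
  ⟨fun i => analyticAt_doubleGens (p := (0, 0)) hG hG (e i),
    (stalk_comp_equiv e _ _).trans (stalk_doubleGens hG)⟩

/-- The partial derivatives give generators of the double of the Jacobian ideal. -/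
theorem generates_double_jacobianIdeal {f : (Fin n → ℂ) → ℂ} (hf : AnalyticAt ℂ f 0) :
    ∃ (r : ℕ) (e : Fin r ≃ Option (Fin n) × Fin n),
      Generates (fun i => doubleGens (partialDeriv f) (e i)) (double (jacobianIdeal hf)) :=
  ⟨_, (Fintype.equivFin _).symm, generates_doubleGens _ (analyticAt_partialDeriv hf)⟩

theorem exists_span_toGerm_of_fg {X : Set (Fin n → ℂ)} {I : Ideal (LocRing X 0)} (hI : I.FG) :
    ∃ (d : ℕ) (G : Fin d → (Fin n → ℂ) → ℂ) (hG : ∀ k, AnalyticAt ℂ (G k) 0),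
      I = Ideal.span (Set.range fun k => toGerm X (G k) (hG k)) := by
  obtain ⟨d, g, hg⟩ := Submodule.fg_iff_exists_fin_generating_family.1 hI
  choose G hG hgG using fun k => exists_eq_toGerm (g k)
  refine ⟨d, G, hG, hg.symm.trans ?_⟩
  rw [funext hgG]

/-- For `n ≥ 2` the truncated `2 * n - 3 + 1` equals `2 * n - 2`, so `e = 0`; then `L` has full
dimension and the origin is isolated in `Z` or `Z` misses it. -/
theorem eventually_eq_zero_of_codimAtGE {Z : Set ((Fin n → ℂ) × (Fin n → ℂ))} (hn : 2 ≤ n)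
    (hZ : CodimAtGE (2 * n - 2) Z 0 (2 * n - 3 + 1)) : ∀ᶠ p in 𝓝 0, p ∈ Z → p = 0 := by
  rcases hZ with hZ | ⟨e, he, L, hL, hZ⟩
  · exact hZ.mono fun p hp h => absurd h hp
  · obtain rfl : e = 0 := by omega
    have : L = ⊤ := Submodule.eq_top_of_finrank_eq (le_antisymm (Submodule.finrank_le L) hL)
    subst this
    exact hZ.mono fun p hp h => hp h trivial

theorem isAnalyticSubsetAt_singleton {X : Set (Fin n → ℂ)} (h0 : (0 : Fin n → ℂ) ∈ X) :
    IsAnalyticSubsetAt (X ×ˢ X) (0, 0) {(0, 0)} := by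
  refine ⟨by rintro _ rfl; exact ⟨h0, h0⟩, n + n,
    Fin.append (fun j q => q.1 j) (fun j q => q.2 j), fun j => ?_, Eventually.of_forall fun p => ?_⟩
  · refine Fin.addCases (fun j => ?_) (fun j => ?_) j
    · rw [Fin.append_left]
      exact (isMapGerm_fst X 0).analyticAt_comp (analyticAt_coord j 0)
    · rw [Fin.append_right]
      exact (isMapGerm_snd X 0).analyticAt_comp (analyticAt_coord j 0)
  · constructor
    · rintro rfl j
      refine Fin.addCases (fun j => ?_) (fun j => ?_) j
      · rw [Fin.append_left]; rfl
      · rw [Fin.append_right]; rfl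
    · intro h
      refine Prod.ext (funext fun j => ?_) (funext fun j => ?_)
      · have := h (Fin.castAdd n j)
        rwa [Fin.append_left] at this
      · have := h (Fin.natAdd n j)
        rwa [Fin.append_right] at this

theorem integralHull_double_jacobianIdeal (hn : 2 ≤ n) {f : (Fin n → ℂ) → ℂ}
    (hf : IsIsolatedHypersurfaceSingularity f) :
    integralHull (2 * n - 2) (2 * n - 3) (double (jacobianIdeal hf.analyticAt)) =
      (double (idealClosure (jacobianIdeal hf.analyticAt)) : Set _) := by
  apply Set.Subset.antisymm
  · rintro h ⟨Z, -, hZ, r, s, F, hs, hF, hhF, hev⟩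
    refine mem_double_idealClosure_of_integralOff hn hf ⟨r, s, F, hs, hF, hhF, ?_⟩
    filter_upwards [hev, nhdsWithin_le_nhds (eventually_eq_zero_of_codimAtGE hn hZ)] with p h1 h2 hp
    exact h1 fun h => hp (h2 h)
  · intro h hh
    obtain ⟨F, hF, hhF⟩ := exists_isGermOf h
    obtain ⟨r, e, hgen⟩ := generates_double_jacobianIdeal hf.analyticAt
    refine ⟨{(0, 0)}, isAnalyticSubsetAt_singleton hf.map_zero, Or.inr ⟨0, by omega, ⊤, ?_, ?_⟩,
      r, _, F, hgen, hF, hhF, ?_⟩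
    · rw [finrank_top]; exact Nat.le_add_right _ _
    · exact Eventually.of_forall fun p hp _ => hp
    · simp only [stalk_comp_equiv]
      exact eventually_mem_intClosure_doubleGens hf hh hhF

theorem isGreatest_double_idealClosure_jacobianIdeal (hn : 2 ≤ n) {f : (Fin n → ℂ) → ℂ}
    (hf : IsIsolatedHypersurfaceSingularity f) :
    IsGreatest {N | ClosuresAgreeOff (double (jacobianIdeal hf.analyticAt)) N {(0, 0)}}
      (double (idealClosure (jacobianIdeal hf.analyticAt))) := by
  constructor
  · obtain ⟨N, hN⟩ := exists_coordIdeal_pow_le hf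
    -- Finitely many generators `G` of the closure of `J(f)` are needed to speak of the stalks of
    -- its double near the origin.
    obtain ⟨d, G, hG, hIG⟩ := exists_span_toGerm_of_fg (ideal_fg_of_pow_le hN)
    obtain ⟨r, e, hgen⟩ := generates_double_jacobianIdeal hf.analyticAt
    have hgen' := generates_doubleGens (X := hypersurface f)
      (Fintype.equivFin (Option (Fin n) × Fin d)).symm hG
    rw [← hIG] at hgen'
    refine ⟨r, _, _, _, hgen, hgen', ?_⟩
    have h1 := eventually_stalk_le hgen.1 hgen'.1
      (hgen.2.trans_le ((double_mono (le_idealClosure _)).trans hgen'.2.ge))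
    have h2 : ∀ᶠ p in 𝓝[hypersurface f ×ˢ hypersurface f] ((0, 0) : (Fin n → ℂ) × (Fin n → ℂ)),
        ∀ i, p ∉ ({(0, 0)} : Set _) → ∃ g ∈ intClosure (stalk (hypersurface f ×ˢ hypersurface f)
          (doubleGens (partialDeriv f)) p), IsGermOf g
            (doubleGens G ((Fintype.equivFin (Option (Fin n) × Fin d)).symm i)) :=
      eventually_all.2 fun i => eventually_mem_intClosure_doubleGens hf
        (hgen'.2.le (Submodule.subset_span ⟨i, isGermOf_toGerm (hgen'.1 i)⟩))
        (isGermOf_toGerm (hgen'.1 i))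
    filter_upwards [h1, h2] with p h1 h2 hp
    refine le_antisymm (intClosure_mono h1) (intClosure_le_of_le (Submodule.span_le.2 ?_))
    rintro g ⟨i, hi⟩
    obtain ⟨g', hg', hgi⟩ := h2 i hp
    rw [hi.unique hgi, stalk_comp_equiv]
    exact hg'
  -- An element of `M` stays in the nearby stalks of `M`, hence in their integral closures; off the
  -- origin these are the closures of the Jacobian double.
  · rintro M ⟨r, r', s, s', hs, hs', hev⟩ h hh
    obtain ⟨F, hF, hhF⟩ := exists_isGermOf h
    refine mem_double_idealClosure_of_integralOff hn hf ⟨r, s, F, hs, hF, hhF, ?_⟩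
    filter_upwards [hev, eventually_mem_stalk hs'.1 (hs'.2.symm ▸ hh) hhF] with p h1 ⟨g, hg, hgF⟩ hp
    exact ⟨g, (h1 hp).symm ▸ le_intClosure _ hg, hgF⟩

end Main

end LipHull

end

theorem lemma3p3 (n : ℕ) (hn : 2 ≤ n) (f : (Fin n → ℂ) → ℂ)
    (hf : IsIsolatedHypersurfaceSingularity f) :
    integralHull (2 * n - 2) (2 * n - 3) (double (jacobianIdeal hf.analyticAt)) =
        (double (idealClosure (jacobianIdeal hf.analyticAt)) : Set _) ∧
      IsGreatest {N | ClosuresAgreeOff (double (jacobianIdeal hf.analyticAt)) N {(0, 0)}}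
        (double (idealClosure (jacobianIdeal hf.analyticAt))) := by
  exact ⟨integralHull_double_jacobianIdeal hn hf, isGreatest_double_idealClosure_jacobianIdeal hn hf⟩
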